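/- Let $m\ge 0$ and consider Minkowski spacetime $\mathbb{R}^4$ with Cartesian coordinates $(t,x,y,z)$ and metric of signature $(-,+,+,+)$; all functions are real valued, and vector spaces and spans are over $\mathbb{R}$. Let $P=\Box-m^2=-\partial_t^2+\partial_x^2+\partial_y^2+\partial_z^2-m^2$, and let $\iota_z$ be the reflection $z\mapsto -z$, acting on functions by composition. A subscript $0$ denotes compactly supported smooth functions. A smooth function $\alpha$ is timelike compact, $\alpha\in C^\infty_{tc}(\mathbb{R}^4)$, if $\mathrm{supp}(\alpha)\cap J^\pm(p)$ is compact (possibly empty) for all $p\in\mathbb{R}^4$, where $J^\pm$ is the causal future/past. A subscript $-$ denotes the subspace of odd functions, $\iota_z\alpha=-\alpha$. There are unique linear maps $E^\pm:C^\infty_{tc}(\mathbb{R}^4)\to C^\infty(\mathbb{R}^4)$ such that $P\circ E^\pm$ and $E^\pm\circ P$ are the identity on $C^\infty_{tc}(\mathbb{R}^4)$ and $\mathrm{supp}(E^\pm\alpha)\subseteq J^\pm(\mathrm{supp}\,\alpha)$ for all $\alpha$; let $E=E^+-E^-$. (A) For $[\zeta]\in C^\infty_{0,-}(\mathbb{R}^4)/P[C^\infty_{0,-}(\mathbb{R}^4)]$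 the functional $$F_{[\zeta]}:\frac{C^\infty_{tc,-}(\mathbb{R}^4)}{P[C^\infty_{tc,-}(\mathbb{R}^4)]}\to\mathbb{C},\qquad F_{[\zeta]}([\alpha])=\int_{\mathbb{R}^4}\zeta\,E(\alpha)\,d^4x,$$ is well defined, i.e. independent of the representatives $\zeta,\alpha$, and linear in $[\zeta]$. Let $\mathcal{O}^{KG}_-(\mathbb{R}^4)$ be the span of all $F_{[\zeta]}$. Then: 1. (separating) if $[\alpha]\ne[\alpha']$, there is a $[\zeta]$ with $F_{[\zeta]}([\alpha])\ne F_{[\zeta]}([\alpha'])$; 2. (optimal) if $[\zeta]\neq[\zeta']$, there is an $[\alpha]$ with $F_{[\zeta]}([\alpha])\ne F_{[\zeta']}([\alpha])$; 3. (symplectic) $\sigma(F_{[\zeta]},F_{[\zeta']})=\langle\zeta,E\zeta'\rangle=\int_{\mathbb{R}^4}\zeta\,E(\zeta')\,d^4x$ defines a bilinear form $\sigma:\mathcal{O}^{KG}_-(\mathbb{R}^4)\times\mathcal{O}^{KG}_-(\mathbb{R}^4)\to\mathbb{R}$ which is antisymmetric and weakly non-degenerate: $\sigma(F,F')=0$ for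 all $F'$ implies $F=0$. (B) Let $\mathbb{H}^4=\mathbb{R}^3\times[0,\infty)$ be the half space $z\ge0$, let $C^\infty(\mathbb{H}^4)$ be the space of functions on $\mathbb{H}^4$ which extend smoothly to an open neighbourhood of $\mathbb{H}^4$ in $\mathbb{R}^4$, and let $$\mathcal{S}^{CP}(\mathbb{H}^4)=\{u\in C^\infty(\mathbb{H}^4): Pu=0,\ u|_{z=0}=0\},\qquad \eta:C^\infty(\mathbb{R}^4)\to C^\infty(\mathbb{H}^4),\quad \eta\phi=\tfrac1{\sqrt2}(\phi-\iota_z\phi)|_{\mathbb{H}^4}.$$ Let $\mathcal{C}^{CP}_0(\mathbb{H}^4)$ be the space of all $f\in C^\infty(\mathbb{H}^4)$ with compact support in $\mathbb{H}^4$ which vanish at $z=0$ and are of the form $f=\eta\phi$ with $\phi\in C^\infty(\mathbb{R}^4)$. For such $f$ let $\eta^\dagger f\in C^\infty_{0,-}(\mathbb{R}^4)$ be given by $\frac1{\sqrt2}f(p)$ for $z\ge0$ and $-\frac1{\sqrt2}f(\iota_zp)$ for $z<0$, so that $\int_{\mathbb{R}^4}(\eta^\dagger f)\,\phi\,d^4x=\int_{\mathbb{H}^4}f\,\eta(\phi)\,d^4x$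 for all $\phi\in C^\infty(\mathbb{R}^4)$, and let $E_{\mathbb{H}^4}=\eta\circ E\circ\eta^\dagger:\mathcal{C}^{CP}_0(\mathbb{H}^4)\to\mathcal{S}^{CP}(\mathbb{H}^4)$ be the CP-propagator. For $[f]\in\mathcal{C}^{CP}_0(\mathbb{H}^4)/P[\mathcal{C}^{CP}_0(\mathbb{H}^4)]$ the functional $F_{[f]}:\mathcal{S}^{CP}(\mathbb{H}^4)\to\mathbb{C}$, $F_{[f]}(u)=\int_{\mathbb{H}^4}f\,u\,d^4x$, is well defined and linear in $[f]$. Let $\mathcal{O}^{CP}(\mathbb{H}^4)$ be the span of all $F_{[f]}$. Then $$\sigma_{\mathbb{H}^4}(F_{[f]},F_{[f']})=\int_{\mathbb{H}^4}f\,E_{\mathbb{H}^4}(f')\,d^4x$$ defines an antisymmetric, weakly non-degenerate bilinear form $\mathcal{O}^{CP}(\mathbb{H}^4)\times\mathcal{O}^{CP}(\mathbb{H}^4)\to\mathbb{R}$, and the pull-back $$\eta^*:\mathcal{O}^{CP}(\mathbb{H}^4)\to\mathcal{O}^{KG}_-(\mathbb{R}^4),\qquad (\eta^*G)([\alpha])=G(\eta(E(\alpha))),$$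 is an isomorphism of symplectic spaces: a linear bijection with $\sigma(\eta^*G,\eta^*G')=\sigma_{\mathbb{H}^4}(G,G')$ for all $G,G'$. -/

import Mathlib

open MeasureTheory Set
open scoped ContDiff

namespace CasimirPolder

noncomputable section

/-! ## Functions on Minkowski spacetime -/

/-- Minkowski spacetime in Cartesian coordinates `(t, x, y, z) = (p 0, p 1, p 2, p 3)`,
with metric of signature `(-,+,+,+)`. -/
abbrev Mink : Type := Fin 4 → ℝ

/-- The causal future `J⁺(A)` of a set of points (it contains `A`). -/
def causalFuture (A : Set Mink) : Set Mink :=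
  {q | ∃ p ∈ A, p 0 ≤ q 0 ∧
    (q 1 - p 1) ^ 2 + (q 2 - p 2) ^ 2 + (q 3 - p 3) ^ 2 ≤ (q 0 - p 0) ^ 2}

/-- The causal past `J⁻(A)` of a set of points (it contains `A`). -/
def causalPast (A : Set Mink) : Set Mink :=
  {q | ∃ p ∈ A, q 0 ≤ p 0 ∧
    (q 1 - p 1) ^ 2 + (q 2 - p 2) ^ 2 + (q 3 - p 3) ^ 2 ≤ (q 0 - p 0) ^ 2}

/-- `C^∞(ℝ⁴)`: smooth real functions on Minkowski spacetime. -/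
@[ext]
structure Smooth where
  /-- the underlying function -/
  toFun : Mink → ℝ
  smooth : ContDiff ℝ ∞ toFun

namespace Smooth

instance : CoeFun Smooth (fun _ => Mink → ℝ) := ⟨Smooth.toFun⟩

instance : Zero Smooth := ⟨⟨fun _ => 0, contDiff_const⟩⟩

instance : Add Smooth := ⟨fun φ ψ => ⟨fun p => φ p + ψ p, φ.smooth.add ψ.smooth⟩⟩

instance : Neg Smooth := ⟨fun φ => ⟨fun p => -φ p, φ.smooth.neg⟩⟩

instance : AddCommGroup Smooth where
  add_assoc φ ψ χ := Smooth.ext (funext fun p => add_assoc (φ p) (ψ p) (χ p))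
  zero_add φ := Smooth.ext (funext fun p => zero_add (φ p))
  add_zero φ := Smooth.ext (funext fun p => add_zero (φ p))
  neg_add_cancel φ := Smooth.ext (funext fun p => neg_add_cancel (φ p))
  add_comm φ ψ := Smooth.ext (funext fun p => add_comm (φ p) (ψ p))
  nsmul := nsmulRec
  zsmul := zsmulRec

instance : Module ℝ Smooth where
  smul c φ := ⟨fun p => c * φ p, contDiff_const.mul φ.smooth⟩
  one_smul φ := Smooth.ext (funext fun p => one_mul (φ p))
  mul_smul c d φ := Smooth.ext (funext fun p => mul_assoc c d (φ p))
  smul_zero c := Smooth.ext (funext fun _ => mul_zero c)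
  smul_add c φ ψ := Smooth.ext (funext fun p => mul_add c (φ p) (ψ p))
  add_smul c d φ := Smooth.ext (funext fun p => add_mul c d (φ p))
  zero_smul φ := Smooth.ext (funext fun p => zero_mul (φ p))

@[simp] theorem zero_apply (p : Mink) : (0 : Smooth) p = 0 := rfl
@[simp] theorem add_apply (φ ψ : Smooth) (p : Mink) : (φ + ψ) p = φ p + ψ p := rfl
@[simp] theorem smul_apply (c : ℝ) (φ : Smooth) (p : Mink) : (c • φ) p = c * φ p := rfl
@[simp] theorem sub_apply (φ ψ : Smooth) (p : Mink) : (φ - ψ) p = φ p - ψ p :=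
  (sub_eq_add_neg (φ p) (ψ p)).symm

theorem differentiableAt (φ : Smooth) (p : Mink) : DifferentiableAt ℝ φ p :=
  (φ.smooth.differentiable (by simp)).differentiableAt

end Smooth

/-- The partial derivative `∂_i : C^∞(ℝ⁴) → C^∞(ℝ⁴)`. -/
def partialD (i : Fin 4) : Smooth →ₗ[ℝ] Smooth where
  toFun φ := ⟨fun p => fderiv ℝ φ p (Pi.single i 1),
    (φ.smooth.fderiv_right (m := ∞) (by simp)).clm_apply contDiff_const⟩
  map_add' φ ψ := by
    ext p
    have h := fderiv_add (φ.differentiableAt p) (ψ.differentiableAt p)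
    exact DFunLike.congr_fun h (Pi.single i 1)
  map_smul' c φ := by
    ext p
    have h := fderiv_const_smul (φ.differentiableAt p) c
    exact DFunLike.congr_fun h (Pi.single i 1)

/-- The Klein-Gordon operator `P = □ - m² = -∂_t² + ∂_x² + ∂_y² + ∂_z² - m²` on `C^∞(ℝ⁴)`. -/
def KG (m : ℝ) : Smooth →ₗ[ℝ] Smooth :=
  -(partialD 0 ∘ₗ partialD 0) + partialD 1 ∘ₗ partialD 1 + partialD 2 ∘ₗ partialD 2
    + partialD 3 ∘ₗ partialD 3 - m ^ 2 • LinearMap.id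

/-- The reflection `(t, x, y, z) ↦ (t, x, y, -z)`. -/
def reflPt : Mink →L[ℝ] Mink :=
  ContinuousLinearMap.pi fun i =>
    (if i = 3 then (-1 : ℝ) else 1) • ContinuousLinearMap.proj (R := ℝ) (φ := fun _ => ℝ) i

theorem reflPt_apply (p : Mink) (i : Fin 4) : reflPt p i = if i = 3 then -p i else p i := by
  by_cases h : i = 3 <;> simp [reflPt, h]

theorem reflPt_reflPt (p : Mink) : reflPt (reflPt p) = p := by
  ext i
  by_cases h : i = 3 <;> simp [reflPt_apply, h]

theorem reflPt_three (p : Mink) : reflPt p 3 = -p 3 := by simp [reflPt_apply]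

/-- The action `ι_z` of the reflection on smooth functions. -/
def zRefl : Smooth →ₗ[ℝ] Smooth where
  toFun φ := ⟨fun p => φ (reflPt p), φ.smooth.comp reflPt.contDiff⟩
  map_add' _ _ := rfl
  map_smul' _ _ := rfl

@[simp] theorem zRefl_apply (φ : Smooth) (p : Mink) : zRefl φ p = φ (reflPt p) := rfl

/-- `C^∞_-(ℝ⁴)`: smooth functions which are odd under `z ↦ -z`. -/
def OddFn : Submodule ℝ Smooth where
  carrier := {φ | ∀ p, φ (reflPt p) = -φ p}
  add_mem' := by
    intro φ ψ hφ hψ p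
    have h1 := hφ p
    have h2 := hψ p
    simp only [Smooth.add_apply, h1, h2]
    ring
  zero_mem' := by intro p; simp
  smul_mem' := by
    intro c φ hφ p
    have h1 := hφ p
    simp only [Smooth.smul_apply, h1]
    ring

/-- `C^∞_0(ℝ⁴)`: smooth functions of compact support. -/
def TestFn : Submodule ℝ Smooth where
  carrier := {φ | HasCompactSupport φ}
  add_mem' := fun hf hg => HasCompactSupport.add hf hg
  zero_mem' := HasCompactSupport.zero
  smul_mem' := fun c _ hf => HasCompactSupport.mul_left (f := fun _ => c) hf

theorem isClosed_causalFuture (p : Mink) : IsClosed (causalFuture {p}) := by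
  have : causalFuture {p} = {q : Mink | p 0 ≤ q 0} ∩ {q : Mink |
      (q 1 - p 1) ^ 2 + (q 2 - p 2) ^ 2 + (q 3 - p 3) ^ 2 ≤ (q 0 - p 0) ^ 2} := by
    ext q; simp [causalFuture]
  rw [this]
  exact (isClosed_le (by fun_prop) (by fun_prop)).inter (isClosed_le (by fun_prop) (by fun_prop))

theorem isClosed_causalPast (p : Mink) : IsClosed (causalPast {p}) := by
  have : causalPast {p} = {q : Mink | q 0 ≤ p 0} ∩ {q : Mink |
      (q 1 - p 1) ^ 2 + (q 2 - p 2) ^ 2 + (q 3 - p 3) ^ 2 ≤ (q 0 - p 0) ^ 2} := by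
    ext q; simp [causalPast]
  rw [this]
  exact (isClosed_le (by fun_prop) (by fun_prop)).inter (isClosed_le (by fun_prop) (by fun_prop))

/-- `C^∞_tc(ℝ⁴)`: timelike compact smooth functions, whose support meets the causal future and
the causal past of every point in a compact (possibly empty) set. -/
def TimelikeCompact : Submodule ℝ Smooth where
  carrier := {φ | ∀ p : Mink, IsCompact (tsupport φ ∩ causalFuture {p}) ∧
    IsCompact (tsupport φ ∩ causalPast {p})}
  add_mem' := by
    intro φ ψ hφ hψ p
    have h : tsupport (φ + ψ) ⊆ tsupport φ ∪ tsupport ψ := by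
      refine closure_minimal ?_ ((isClosed_tsupport _).union (isClosed_tsupport _))
      intro q hq
      by_contra hn
      rw [mem_union, not_or] at hn
      apply hq
      simp [image_eq_zero_of_notMem_tsupport hn.1, image_eq_zero_of_notMem_tsupport hn.2]
    constructor
    · refine ((hφ p).1.union (hψ p).1).of_isClosed_subset
        ((isClosed_tsupport _).inter (isClosed_causalFuture p)) ?_
      rw [← union_inter_distrib_right]
      exact inter_subset_inter_left _ h
    · refine ((hφ p).2.union (hψ p).2).of_isClosed_subset
        ((isClosed_tsupport _).inter (isClosed_causalPast p)) ?_
      rw [← union_inter_distrib_right]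
      exact inter_subset_inter_left _ h
  zero_mem' := by
    intro p
    have h : tsupport (0 : Smooth) = ∅ := tsupport_eq_empty_iff.2 rfl
    simp [h]
  smul_mem' := by
    intro c φ hφ p
    have h : tsupport (c • φ) ⊆ tsupport φ :=
      closure_mono fun q hq hn => hq (by simp [hn])
    exact ⟨(hφ p).1.of_isClosed_subset
        ((isClosed_tsupport _).inter (isClosed_causalFuture p)) (inter_subset_inter_left _ h),
      (hφ p).2.of_isClosed_subset
        ((isClosed_tsupport _).inter (isClosed_causalPast p)) (inter_subset_inter_left _ h)⟩

theorem testFn_le_timelikeCompact : TestFn ≤ TimelikeCompact := fun _ hφ p =>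
  ⟨IsCompact.inter_right hφ (isClosed_causalFuture p),
    IsCompact.inter_right hφ (isClosed_causalPast p)⟩

/-- `C^∞_{0,-}(ℝ⁴)`: odd smooth functions of compact support. -/
abbrev TestOdd : Submodule ℝ Smooth := TestFn ⊓ OddFn

/-- `C^∞_{tc,-}(ℝ⁴)`: odd timelike compact smooth functions. -/
abbrev TcOdd : Submodule ℝ Smooth := TimelikeCompact ⊓ OddFn

/-- A test function regarded as a timelike compact function. -/
def testToTc : TestOdd →ₗ[ℝ] TimelikeCompact :=
  Submodule.inclusion (inf_le_left.trans testFn_le_timelikeCompact)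

/-- The subspace `P[V]` of a `P`-invariant space `V` of smooth functions. -/
abbrev imageKG (m : ℝ) (V : Submodule ℝ Smooth) : Submodule ℝ V :=
  (V.map (KG m)).submoduleOf V

/-- The labels of the observables: `C^∞_{0,-}(ℝ⁴) / P[C^∞_{0,-}(ℝ⁴)]`. -/
abbrev Label (m : ℝ) : Type := TestOdd ⧸ imageKG m TestOdd

/-- The configurations: `C^∞_{tc,-}(ℝ⁴) / P[C^∞_{tc,-}(ℝ⁴)]`. -/
abbrev Config (m : ℝ) : Type := TcOdd ⧸ imageKG m TcOdd

/-- The pairing `⟨φ, ψ⟩ = ∫ φ ψ d⁴x`. -/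
def l2Pair (φ ψ : Smooth) : ℝ := ∫ p : Mink, φ p * ψ p

/-! ## Green operators and the causal propagator -/

/-- `G : C^∞_tc(ℝ⁴) → C^∞(ℝ⁴)` is a Green operator (fundamental solution) of `P`, with supports
propagating along `J`: `P ∘ G = id` and `G ∘ P = id` on `C^∞_tc(ℝ⁴)`, and
`supp (G α) ⊆ J (supp α)`. For `J = J⁺` this is `E⁺`, for `J = J⁻` this is `E⁻`. -/
structure IsGreenOperator (m : ℝ) (J : Set Mink → Set Mink)
    (G : TimelikeCompact →ₗ[ℝ] Smooth) : Prop where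
  right_inv : ∀ α : TimelikeCompact, KG m (G α) = α
  left_inv : ∀ α β : TimelikeCompact, (β : Smooth) = KG m α → G β = α
  support : ∀ α : TimelikeCompact, tsupport (G α) ⊆ J (tsupport (α : Smooth))

open Classical in
/-- The causal propagator `E = E⁺ - E⁻`, where `E^±` are the Green operators of `P` for `J^±`
(the value `0` is never used: these operators exist and are unique). -/
def propagator (m : ℝ) : TimelikeCompact →ₗ[ℝ] Smooth :=
  if h : (∃ G, IsGreenOperator m causalFuture G) ∧ (∃ G, IsGreenOperator m causalPast G) then
    h.1.choose - h.2.choose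
  else 0

theorem KG_propagator (m : ℝ) (α : TimelikeCompact) : KG m (propagator m α) = 0 := by
  unfold propagator
  split_ifs with h
  · rw [LinearMap.sub_apply, map_sub, h.1.choose_spec.right_inv, h.2.choose_spec.right_inv, sub_self]
  · simp

theorem propagator_KG (m : ℝ) (α β : TimelikeCompact) (hβ : (β : Smooth) = KG m α) :
    propagator m β = 0 := by
  unfold propagator
  split_ifs with h
  · rw [LinearMap.sub_apply, h.1.choose_spec.left_inv α β hβ, h.2.choose_spec.left_inv α β hβ,
      sub_self]
  · simp

/-- The causal propagator on odd timelike compact functions. -/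
def propagatorOdd (m : ℝ) : TcOdd →ₗ[ℝ] Smooth :=
  propagator m ∘ₗ Submodule.inclusion inf_le_left

theorem propagatorOdd_imageKG (m : ℝ) :
    imageKG m TcOdd ≤ LinearMap.ker (propagatorOdd m) := by
  rintro α ⟨lam, hlam, h⟩
  exact propagator_KG m ⟨lam, hlam.1⟩ _ h.symm

/-- The causal propagator on configurations, `[α] ↦ E(α)`. -/
def propagatorQ (m : ℝ) : Config m →ₗ[ℝ] Smooth :=
  (imageKG m TcOdd).liftQ (propagatorOdd m) (propagatorOdd_imageKG m)

/-- The functional `F_ζ : [α] ↦ ∫ ζ E(α) d⁴x` on configurations. -/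
def obsKG (m : ℝ) (ζ : TestOdd) : Config m → ℂ :=
  fun a => ((l2Pair ζ (propagatorQ m a) : ℝ) : ℂ)

/-- The space `𝒪^KG_-(ℝ⁴)` of observables: the real span of all functionals `F_ζ`. -/
def ObsKG (m : ℝ) : Submodule ℝ (Config m → ℂ) :=
  Submodule.span ℝ (Set.range (obsKG m))

/-- The functional `F_ζ` as an element of `𝒪^KG_-(ℝ⁴)`. -/
def genKG (m : ℝ) (ζ : TestOdd) : ObsKG m :=
  ⟨obsKG m ζ, Submodule.subset_span ⟨ζ, rfl⟩⟩

/-! ## The Casimir-Polder system on the half space -/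

/-- The half space `ℍ⁴ = ℝ³ × [0, ∞)`. -/
abbrev Half : Type := {p : Mink // 0 ≤ p 3}

/-- The half space as a set of points of Minkowski spacetime. -/
abbrev halfSet : Set Mink := {p | 0 ≤ p 3}

/-- `w` is a smooth function on the open set `U ⊇ ℍ⁴` which extends `u`. -/
def IsExt (u : Half → ℝ) (U : Set Mink) (w : Mink → ℝ) : Prop :=
  IsOpen U ∧ halfSet ⊆ U ∧ ContDiffOn ℝ ∞ w U ∧ ∀ p : Half, w p = u p

namespace IsExt

variable {u v : Half → ℝ} {U V : Set Mink} {w w' : Mink → ℝ}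

theorem add (h : IsExt u U w) (h' : IsExt v V w') :
    IsExt (fun p => u p + v p) (U ∩ V) (fun p => w p + w' p) :=
  ⟨h.1.inter h'.1, subset_inter h.2.1 h'.2.1,
    (h.2.2.1.mono inter_subset_left).add (h'.2.2.1.mono inter_subset_right),
    fun p => congrArg₂ (· + ·) (h.2.2.2 p) (h'.2.2.2 p)⟩

theorem smul (c : ℝ) (h : IsExt u U w) : IsExt (fun p => c * u p) U (fun p => c * w p) :=
  ⟨h.1, h.2.1, contDiffOn_const.mul h.2.2.1, fun p => congrArg (c * ·) (h.2.2.2 p)⟩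

theorem const (c : ℝ) : IsExt (fun _ => c) univ (fun _ => c) :=
  ⟨isOpen_univ, subset_univ _, contDiffOn_const, fun _ => rfl⟩

theorem differentiableAt (h : IsExt u U w) (p : Half) : DifferentiableAt ℝ w p :=
  (h.2.2.1.contDiffAt (h.1.mem_nhds (h.2.1 p.2))).differentiableAt (by simp)

end IsExt

/-- `C^∞(ℍ⁴)`: functions on the half space which extend smoothly to an open neighbourhood. -/
@[ext]
structure SmoothH where
  /-- the underlying function -/
  toFun : Half → ℝ
  smooth : ∃ (U : Set Mink) (w : Mink → ℝ), IsExt toFun U w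

namespace SmoothH

instance : CoeFun SmoothH (fun _ => Half → ℝ) := ⟨SmoothH.toFun⟩

instance : Zero SmoothH := ⟨⟨fun _ => 0, _, _, IsExt.const 0⟩⟩

instance : Add SmoothH := ⟨fun u v => ⟨fun p => u p + v p, by
  obtain ⟨U, w, h⟩ := u.smooth
  obtain ⟨V, w', h'⟩ := v.smooth
  exact ⟨_, _, h.add h'⟩⟩⟩

instance : Neg SmoothH := ⟨fun u => ⟨fun p => -u p, by
  obtain ⟨U, w, h⟩ := u.smooth
  refine ⟨U, fun p => -1 * w p, ?_⟩
  have h' := h.smul (-1)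
  simpa only [neg_one_mul] using h'⟩⟩

instance : AddCommGroup SmoothH where
  add_assoc u v w := SmoothH.ext (funext fun p => add_assoc (u p) (v p) (w p))
  zero_add u := SmoothH.ext (funext fun p => zero_add (u p))
  add_zero u := SmoothH.ext (funext fun p => add_zero (u p))
  neg_add_cancel u := SmoothH.ext (funext fun p => neg_add_cancel (u p))
  add_comm u v := SmoothH.ext (funext fun p => add_comm (u p) (v p))
  nsmul := nsmulRec
  zsmul := zsmulRec

instance : Module ℝ SmoothH where
  smul c u := ⟨fun p => c * u p, by
    obtain ⟨U, w, h⟩ := u.smooth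
    exact ⟨_, _, h.smul c⟩⟩
  one_smul u := SmoothH.ext (funext fun p => one_mul (u p))
  mul_smul c d u := SmoothH.ext (funext fun p => mul_assoc c d (u p))
  smul_zero c := SmoothH.ext (funext fun _ => mul_zero c)
  smul_add c u v := SmoothH.ext (funext fun p => mul_add c (u p) (v p))
  add_smul c d u := SmoothH.ext (funext fun p => add_mul c d (u p))
  zero_smul u := SmoothH.ext (funext fun p => zero_mul (u p))

@[simp] theorem zero_apply (p : Half) : (0 : SmoothH) p = 0 := rfl
@[simp] theorem add_apply (u v : SmoothH) (p : Half) : (u + v) p = u p + v p := rfl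
@[simp] theorem smul_apply (c : ℝ) (u : SmoothH) (p : Half) : (c • u) p = c * u p := rfl

end SmoothH

/-- The partial derivative `∂_i u` of a function on the half space, one-sided on the boundary. -/
def derivH (i : Fin 4) (u : Half → ℝ) : Half → ℝ :=
  fun p => fderivWithin ℝ (Function.extend Subtype.val u 0) halfSet p (Pi.single i 1)

theorem uniqueDiffOn_halfSet : UniqueDiffOn ℝ halfSet := by
  apply uniqueDiffOn_convex
  · intro p hp q hq a b ha hb _
    have h1 : 0 ≤ p 3 := hp
    have h2 : 0 ≤ q 3 := hq
    show 0 ≤ (a • p + b • q) 3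
    simp only [Pi.add_apply, Pi.smul_apply, smul_eq_mul]
    positivity
  · refine ⟨fun _ => 1, mem_interior.2 ⟨{p | 0 < p 3}, fun p (hp : 0 < p 3) => hp.le, ?_, ?_⟩⟩
    · exact isOpen_lt continuous_const (continuous_apply 3)
    · simp

/-- Derivatives on the half space may be computed with any smooth extension. -/
theorem derivH_eq {u : Half → ℝ} {U : Set Mink} {w : Mink → ℝ} (h : IsExt u U w) (i : Fin 4)
    (p : Half) : derivH i u p = fderiv ℝ w p (Pi.single i 1) := by
  have h1 : ∀ q ∈ halfSet, Function.extend Subtype.val u 0 q = w q := by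
    intro q hq
    have h2 := Subtype.val_injective.extend_apply u 0 (⟨q, hq⟩ : Half)
    rw [← h.2.2.2 ⟨q, hq⟩] at h2
    exact h2
  unfold derivH
  rw [fderivWithin_congr h1 (h1 p p.2),
    (h.differentiableAt p).fderivWithin (uniqueDiffOn_halfSet p p.2)]

theorem isExt_derivH {u : Half → ℝ} {U : Set Mink} {w : Mink → ℝ} (h : IsExt u U w) (i : Fin 4) :
    IsExt (derivH i u) U (fun p => fderiv ℝ w p (Pi.single i 1)) :=
  ⟨h.1, h.2.1, (h.2.2.1.fderiv_of_isOpen (m := ∞) h.1 (by simp)).clm_apply contDiffOn_const,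
    fun p => (derivH_eq h i p).symm⟩

/-- The partial derivative `∂_i : C^∞(ℍ⁴) → C^∞(ℍ⁴)`. -/
def partialH (i : Fin 4) : SmoothH →ₗ[ℝ] SmoothH where
  toFun u := ⟨derivH i u, by
    obtain ⟨U, w, h⟩ := u.smooth
    exact ⟨_, _, isExt_derivH h i⟩⟩
  map_add' u v := by
    ext p
    obtain ⟨U, w, h⟩ := u.smooth
    obtain ⟨V, w', h'⟩ := v.smooth
    show derivH i (fun p => u p + v p) p = derivH i u p + derivH i v p
    rw [derivH_eq (h.add h'), derivH_eq h, derivH_eq h']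
    exact DFunLike.congr_fun (fderiv_add (h.differentiableAt p) (h'.differentiableAt p)) _
  map_smul' c u := by
    ext p
    obtain ⟨U, w, h⟩ := u.smooth
    show derivH i (fun p => c * u p) p = c * derivH i u p
    rw [derivH_eq (h.smul c), derivH_eq h]
    exact DFunLike.congr_fun (fderiv_const_smul (h.differentiableAt p) c) _

/-- The Klein-Gordon operator `P = □ - m²` on `C^∞(ℍ⁴)`. -/
def KGH (m : ℝ) : SmoothH →ₗ[ℝ] SmoothH :=
  -(partialH 0 ∘ₗ partialH 0) + partialH 1 ∘ₗ partialH 1 + partialH 2 ∘ₗ partialH 2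
    + partialH 3 ∘ₗ partialH 3 - m ^ 2 • LinearMap.id

/-- Smooth functions on the half space which vanish on its boundary `z = 0`. -/
def Dirichlet : Submodule ℝ SmoothH where
  carrier := {u | ∀ p : Half, p.1 3 = 0 → u p = 0}
  add_mem' := by
    intro u v hu hv p hp
    simp [hu p hp, hv p hp]
  zero_mem' := by intro p _; simp
  smul_mem' := by
    intro c u hu p hp
    simp [hu p hp]

/-- `𝒮^CP(ℍ⁴)`: the dynamical configurations, solving `P u = 0` with `u = 0` at `z = 0`. -/
def SolCP (m : ℝ) : Submodule ℝ SmoothH := LinearMap.ker (KGH m) ⊓ Dirichlet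

/-- Restriction to the half space. -/
def restrictH : Smooth →ₗ[ℝ] SmoothH where
  toFun φ := ⟨fun p => φ p, univ, φ, isOpen_univ, subset_univ _, φ.smooth.contDiffOn,
    fun _ => rfl⟩
  map_add' _ _ := rfl
  map_smul' _ _ := rfl

/-- The map `η : C^∞(ℝ⁴) → C^∞(ℍ⁴)`, `η φ = (φ - ι_z φ)/√2` restricted to the half space. -/
def eta : Smooth →ₗ[ℝ] SmoothH :=
  (1 / √2 : ℝ) • restrictH ∘ₗ (LinearMap.id - zRefl)

/-- `𝒞^CP(ℍ⁴)`: the kinematical configurations, vanishing on the boundary and of the form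
`η φ` with `φ` smooth on `ℝ⁴`. -/
def KinCP : Submodule ℝ SmoothH := Dirichlet ⊓ LinearMap.range eta

/-- `𝒞^CP_0(ℍ⁴)`: the kinematical configurations of compact support in `ℍ⁴`. -/
def KinCP0 : Submodule ℝ SmoothH where
  carrier := {u | u ∈ KinCP ∧ HasCompactSupport u}
  add_mem' := fun hf hg => ⟨add_mem hf.1 hg.1, HasCompactSupport.add hf.2 hg.2⟩
  zero_mem' := ⟨zero_mem _, HasCompactSupport.zero⟩
  smul_mem' := fun c _ hf =>
    ⟨Submodule.smul_mem _ c hf.1, HasCompactSupport.mul_left (f := fun _ => c) hf.2⟩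

/-- The subspace `P[𝒞^CP_0(ℍ⁴)]` of the `P`-invariant space `𝒞^CP_0(ℍ⁴)`. -/
abbrev imageKGH (m : ℝ) : Submodule ℝ KinCP0 :=
  (KinCP0.map (KGH m)).submoduleOf KinCP0

/-- The labels of the Casimir-Polder observables: `𝒞^CP_0(ℍ⁴) / P[𝒞^CP_0(ℍ⁴)]`. -/
abbrev LabelCP (m : ℝ) : Type := KinCP0 ⧸ imageKGH m

/-- The pairing `⟨u, v⟩ = ∫_ℍ⁴ u v d⁴x`. -/
def l2PairH (u v : SmoothH) : ℝ := ∫ p : Half, u p * v p ∂(Measure.comap Subtype.val volume)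

/-- The functional `F_f : u ↦ ∫_ℍ⁴ f u d⁴x` on dynamical configurations. -/
def obsCP (m : ℝ) (f : KinCP0) : SolCP m → ℂ :=
  fun u => ((l2PairH f u : ℝ) : ℂ)

/-- The space `𝒪^CP(ℍ⁴)` of observables: the real span of all functionals `F_f`. -/
def ObsCP (m : ℝ) : Submodule ℝ (SolCP m → ℂ) :=
  Submodule.span ℝ (Set.range (obsCP m))

/-- The functional `F_f` as an element of `𝒪^CP(ℍ⁴)`. -/
def genCP (m : ℝ) (f : KinCP0) : ObsCP m :=
  ⟨obsCP m f, Submodule.subset_span ⟨f, rfl⟩⟩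

/-! ## The maps `η†`, the CP-propagator and the pull-back of configurations -/

theorem eta_apply (φ : Smooth) (p : Half) :
    eta φ p = 1 / √2 * (φ p - φ (reflPt p)) := by
  rw [← zRefl_apply, ← Smooth.sub_apply]
  rfl

open Classical in
/-- The integral kernel `(h(x) Θ(z) - h(ι_z x) Θ(-z))/√2` of the distribution `η†(h)`. -/
def etaDaggerFun (h : Half → ℝ) : Mink → ℝ := fun p =>
  if hp : 0 ≤ p 3 then 1 / √2 * h ⟨p, hp⟩
  else -(1 / √2 * h ⟨reflPt p, by rw [reflPt_three]; linarith⟩)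

theorem etaDaggerFun_eta (φ : Smooth) (p : Mink) :
    etaDaggerFun (eta φ) p = 1 / 2 * (φ p - φ (reflPt p)) := by
  have h2 : (1 / √2 : ℝ) * (1 / √2) = 1 / 2 := by
    rw [div_mul_div_comm, Real.mul_self_sqrt (by norm_num)]; norm_num
  by_cases hp : 0 ≤ p 3
  · rw [etaDaggerFun, dif_pos hp, eta_apply, ← mul_assoc, h2]
  · rw [etaDaggerFun, dif_neg hp, eta_apply, ← mul_assoc, h2]
    simp only [reflPt_reflPt]
    ring

theorem etaDaggerFun_hasCompactSupport {h : Half → ℝ} (hh : HasCompactSupport h) :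
    HasCompactSupport (etaDaggerFun h) := by
  have hK : IsCompact (Subtype.val '' tsupport h : Set Mink) :=
    IsCompact.image hh continuous_subtype_val
  refine HasCompactSupport.intro (hK.union (hK.image reflPt.continuous)) fun p hp => ?_
  rw [mem_union, not_or] at hp
  by_cases h3 : 0 ≤ p 3
  · have h0 : h ⟨p, h3⟩ = 0 :=
      image_eq_zero_of_notMem_tsupport fun hc => hp.1 ⟨_, hc, rfl⟩
    rw [etaDaggerFun, dif_pos h3, h0, mul_zero]
  · have h0 : h ⟨reflPt p, by rw [reflPt_three]; linarith⟩ = 0 :=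
      image_eq_zero_of_notMem_tsupport fun hc => hp.2 ⟨_, ⟨_, hc, rfl⟩, reflPt_reflPt p⟩
    rw [etaDaggerFun, dif_neg h3, h0, mul_zero, neg_zero]

/-- The map `η†` on `𝒞^CP_0(ℍ⁴)`, where the distribution `η†(h)` is an odd test function. -/
def etaDagger : KinCP0 →ₗ[ℝ] TestOdd where
  toFun h := ⟨⟨etaDaggerFun (h : SmoothH), by
      obtain ⟨φ, hφ⟩ := h.2.1.2
      rw [← hφ, funext (etaDaggerFun_eta φ)]
      exact contDiff_const.mul (φ.smooth.sub (φ.smooth.comp reflPt.contDiff))⟩,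
    etaDaggerFun_hasCompactSupport h.2.2, by
      obtain ⟨φ, hφ⟩ := h.2.1.2
      intro p
      show etaDaggerFun (h : SmoothH) (reflPt p) = -etaDaggerFun (h : SmoothH) p
      rw [← hφ, etaDaggerFun_eta, etaDaggerFun_eta, reflPt_reflPt]
      ring⟩
  map_add' h k := by
    apply Subtype.ext
    ext p
    show etaDaggerFun (fun q => (h : SmoothH) q + (k : SmoothH) q) p
      = etaDaggerFun (h : SmoothH) p + etaDaggerFun (k : SmoothH) p
    unfold etaDaggerFun
    split_ifs <;> ring
  map_smul' c h := by
    apply Subtype.ext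
    ext p
    show etaDaggerFun (fun q => c * (h : SmoothH) q) p = c * etaDaggerFun (h : SmoothH) p
    unfold etaDaggerFun
    split_ifs <;> ring

theorem measurePreserving_reflPt : MeasurePreserving reflPt volume volume := by
  have h : ∀ i : Fin 4, MeasurePreserving (fun x : ℝ => if i = 3 then -x else x) volume volume := by
    intro i
    by_cases hi : i = 3
    · simpa only [hi, if_true] using Measure.measurePreserving_neg (volume : Measure ℝ)
    · simp only [hi, if_false]
      exact MeasurePreserving.id (volume : Measure ℝ)
  have h' := volume_preserving_pi h
  have h2 : (reflPt : Mink → Mink) = fun a i => if i = 3 then -a i else a i :=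
    funext fun p => funext fun i => reflPt_apply p i
  rw [h2]
  exact h'

/-- `η†` is the transpose of `η`: `⟨η†(h), φ⟩ = ⟨h, η(φ)⟩_ℍ⁴` for all smooth `φ`. -/
theorem etaDagger_transpose (h : KinCP0) (φ : Smooth) :
    l2Pair (etaDagger h : TestOdd) φ = l2PairH h (eta φ) := by
  set K : Smooth := ((etaDagger h : TestOdd) : Smooth) with hK
  have hodd : ∀ p, K (reflPt p) = -K p := (etaDagger h).2.2
  have hcs : HasCompactSupport K := (etaDagger h).2.1
  have hint : ∀ ψ : Smooth, Integrable (fun p => K p * ψ p) := fun ψ =>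
    (K.smooth.continuous.mul ψ.smooth.continuous).integrable_of_hasCompactSupport hcs.mul_right
  have hS : MeasurableSet halfSet := (isClosed_le continuous_const (continuous_apply 3)).measurableSet
  have hpre : reflPt ⁻¹' halfSetᶜ =ᵐ[volume] halfSet := by
    have h0 : (volume : Measure Mink) {p | p 3 = 0} = 0 := Measure.pi_hyperplane _ 3 0
    refine (ae_iff.2 (measure_mono_null ?_ h0) : _)
    intro p hp
    by_contra hne
    apply hp
    have hne' : p 3 ≠ 0 := hne
    apply propext
    show ¬ (0 ≤ reflPt p 3) ↔ 0 ≤ p 3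
    rw [reflPt_three]
    constructor
    · intro h1; linarith
    · intro h1 h2
      exact hne' (le_antisymm (by linarith) h1)
  have hme : MeasurableEmbedding reflPt :=
    (Homeomorph.mk (Equiv.mk reflPt reflPt reflPt_reflPt reflPt_reflPt) reflPt.continuous
      reflPt.continuous).measurableEmbedding
  have h1 : ∫ p in halfSetᶜ, K p * φ p = -∫ p in halfSet, K p * (zRefl φ) p := by
    rw [← measurePreserving_reflPt.setIntegral_preimage_emb hme, setIntegral_congr_set hpre,
      ← integral_neg]
    refine integral_congr_ae (Filter.Eventually.of_forall fun p => ?_)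
    simp only [hodd, zRefl_apply]
    ring
  have h2 : ∫ p, K p * φ p = ∫ p in halfSet, K p * (φ p - φ (reflPt p)) := by
    rw [← integral_add_compl hS (hint φ), h1, ← sub_eq_add_neg,
      ← integral_sub (hint φ).integrableOn (hint (zRefl φ)).integrableOn]
    refine integral_congr_ae (Filter.Eventually.of_forall fun p => ?_)
    simp only [zRefl_apply]
    ring
  unfold l2Pair l2PairH
  rw [h2]
  have h3 := integral_subtype_comap hS (μ := volume)
    (fun p : Mink => K p * (φ p - φ (reflPt p)))
  rw [← h3]
  refine integral_congr_ae (Filter.Eventually.of_forall fun p => ?_)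
  have h4 : K p = 1 / √2 * (h : SmoothH) p := by
    show etaDaggerFun (h : SmoothH) p = _
    have h5 : 0 ≤ p.1 3 := p.2
    rw [etaDaggerFun, dif_pos h5]
    rfl
  simp only [h4, eta_apply]
  ring

theorem partialH_restrictH (i : Fin 4) (φ : Smooth) :
    partialH i (restrictH φ) = restrictH (partialD i φ) := by
  ext p
  exact derivH_eq (u := fun p => φ p) ⟨isOpen_univ, subset_univ _, φ.smooth.contDiffOn,
    fun _ => rfl⟩ i p

theorem partialD_zRefl (i : Fin 4) (φ : Smooth) :
    partialD i (zRefl φ) = (if i = 3 then (-1 : ℝ) else 1) • zRefl (partialD i φ) := by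
  ext p
  have h2 : reflPt (Pi.single i 1) = (if i = 3 then (-1 : ℝ) else 1) • Pi.single i 1 := by
    ext j
    by_cases hj : j = i
    · subst hj; simp [reflPt_apply]
    · simp [reflPt_apply, hj]
  show fderiv ℝ (φ ∘ reflPt) p (Pi.single i 1)
    = (if i = 3 then (-1 : ℝ) else 1) * fderiv ℝ φ (reflPt p) (Pi.single i 1)
  rw [fderiv_comp p (φ.differentiableAt _) reflPt.differentiableAt, ContinuousLinearMap.fderiv,
    ContinuousLinearMap.comp_apply, h2, map_smul, smul_eq_mul]

theorem KG_zRefl (m : ℝ) (φ : Smooth) : KG m (zRefl φ) = zRefl (KG m φ) := by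
  simp [KG, partialD_zRefl]

theorem KGH_restrictH (m : ℝ) (φ : Smooth) : KGH m (restrictH φ) = restrictH (KG m φ) := by
  simp [KG, KGH, partialH_restrictH]

theorem KGH_eta (m : ℝ) (φ : Smooth) : KGH m (eta φ) = eta (KG m φ) := by
  simp only [eta, LinearMap.smul_apply, LinearMap.comp_apply, LinearMap.sub_apply,
    LinearMap.id_apply, map_smul, KGH_restrictH, map_sub, KG_zRefl]

theorem eta_mem_dirichlet (φ : Smooth) : eta φ ∈ Dirichlet := by
  intro p hp
  have h : reflPt p.1 = p.1 := by
    ext i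
    by_cases hi : i = 3
    · subst hi; simp [reflPt_apply, hp]
    · simp [reflPt_apply, hi]
  rw [eta_apply, h, sub_self, mul_zero]

/-- The map `α ↦ η(E(α))` with values in the dynamical configurations. -/
def etaE (m : ℝ) : TimelikeCompact →ₗ[ℝ] SolCP m :=
  (eta ∘ₗ propagator m).codRestrict (SolCP m) fun α =>
    ⟨LinearMap.mem_ker.2 (by
      rw [LinearMap.comp_apply, KGH_eta, KG_propagator, map_zero]), eta_mem_dirichlet _⟩

/-- The CP-propagator `E_{ℍ⁴} = η ∘ E ∘ η†`. -/
def propagatorCP (m : ℝ) : KinCP0 →ₗ[ℝ] SolCP m :=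
  etaE m ∘ₗ testToTc ∘ₗ etaDagger

/-- The map `[α] ↦ η(E(α))` from configurations to Casimir-Polder dynamical configurations. -/
def etaQ (m : ℝ) : Config m →ₗ[ℝ] SolCP m :=
  (eta ∘ₗ propagatorQ m).codRestrict (SolCP m) fun a => by
    induction a using Submodule.Quotient.induction_on with
    | H α => exact (etaE m (Submodule.inclusion inf_le_left α)).2

end

end CasimirPolder

open CasimirPolder

/-!
The theorem rests on the Green operators `E^±` of `P`, which are constructed here explicitly.

**A fundamental solution of `P²`.** In four dimensions the function `J₀(m √s)`, `s = t² - |x|²`,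
restricted to the interior of the future light cone is, up to normalization, a fundamental solution
of `P²` (`setIntegral_bessel_KG_KG`). Unlike the fundamental solution of `P`, which contains a
measure on the light cone, it is a locally integrable function, so that `E^+ α = K ⋆ P α` is a
convolution with a function; the case of `E^-` follows by reversing time. To prove the identity
`∫ K P² g = g 0`, foliate the cone by the hyperboloids `t² - |y|² = s`. An explicit
vector field on the hyperboloid shows that the mean of `□ g` is `-4 s ∂ₛ²` of the mean of `g`
(`hypInt_KG`), integration by parts in `s` (`slabInt_KG`) moves this operator to the Bessel function,
which it annihilates when applied twice, and of the boundary terms at `s = ε` a single one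
survives as `ε → 0`: it concentrates at the apex of the cone and produces `g 0`
(`tendsto_mul_hypInt_five`).

**Green operators.** By causality only a compact part of the source matters near a given point
(`exists_testFn_eq_near`), so the convolution makes sense for timelike compact sources, is smooth,
and inverts `P` on both sides. Uniqueness holds since a solution of `P w = 0` with past compact
support is orthogonal to every test function `φ = P E^- φ` (`eq_zero_of_KG_eq_zero`).

**Observables.** The transpose of `E^±` is `E^∓`, so `E` is antisymmetric (`l2Pair_propagator`). If
`E α = 0`, then `β = E^+ α = E^- α` is supported in `J^+ ∩ J^-` of the support of `α` and solves
`P β = α` (`exists_KG_eq_of_propagator_eq_zero`). Separation, optimality and non-degeneracy are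
consequences of these two facts, since `E` preserves odd functions.

**Half space.** Since `η†` is a bijection onto the odd test functions with inverse `η`, and
intertwines the pairings, the pull-back maps `F_f` to `F_{η† f}` and is therefore onto.
For injectivity, and for the independence of representatives, `F_f` has to vanish if
`f = P g`; this is Green's identity on the half space, whose boundary terms vanish by the Dirichlet
conditions (`setIntegral_KG_mul_eq_zero`). The symplectic form on the half space is the transported
one.
-/

namespace CasimirPolder

noncomputable section

/-! ### Causal geometry -/

/-- The squared spatial length of a vector of Minkowski spacetime. -/
def spaceSq (p : Mink) : ℝ := p 1 ^ 2 + p 2 ^ 2 + p 3 ^ 2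

/-- `q` lies in the closed solid light cone with apex `0` that opens in the time direction `τ`
(to the future for `τ = 1`, to the past for `τ = -1`). -/
def InCone (τ : ℝ) (q : Mink) : Prop := 0 ≤ τ * q 0 ∧ spaceSq q ≤ q 0 ^ 2

/-- The causal future (`τ = 1`) or past (`τ = -1`) of a set of points. -/
def causalSet (τ : ℝ) (A : Set Mink) : Set Mink := {q | ∃ p ∈ A, InCone τ (q - p)}

theorem causalSet_one : causalSet 1 = causalFuture := by
  ext A q; simp [causalSet, causalFuture, InCone, spaceSq]

theorem causalSet_neg_one : causalSet (-1) = causalPast := by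
  ext A q; simp [causalSet, causalPast, InCone, spaceSq]

variable {τ : ℝ}

theorem mem_causalSet_singleton {p q : Mink} : q ∈ causalSet τ {p} ↔ InCone τ (q - p) := by
  simp [causalSet]

theorem inCone_zero : InCone τ 0 := by simp [InCone, spaceSq]

theorem subset_causalSet (A : Set Mink) : A ⊆ causalSet τ A := fun p hp =>
  ⟨p, hp, by rw [sub_self]; exact inCone_zero⟩

theorem causalSet_mono {A B : Set Mink} (h : A ⊆ B) : causalSet τ A ⊆ causalSet τ B :=
  fun _ ⟨p, hp, h'⟩ => ⟨p, h hp, h'⟩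

theorem inCone_neg {q : Mink} : InCone τ (-q) ↔ InCone (-τ) q := by
  simp [InCone, spaceSq]

theorem mem_causalSet_comm {p q : Mink} : q ∈ causalSet τ {p} ↔ p ∈ causalSet (-τ) {q} := by
  rw [mem_causalSet_singleton, mem_causalSet_singleton, ← inCone_neg, neg_sub]

theorem isClosed_inCone : IsClosed {q : Mink | InCone τ q} := by
  refine (isClosed_le (f := fun _ => (0 : ℝ)) (g := fun q : Mink => τ * q 0)
    (by fun_prop) (by fun_prop)).inter
    (isClosed_le (f := spaceSq) (g := fun q : Mink => q 0 ^ 2) ?_ (by fun_prop))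
  unfold spaceSq; fun_prop

/-- The solid light cone is closed under addition, by the Cauchy-Schwarz inequality. -/
theorem InCone.add (hτ : τ = 1 ∨ τ = -1) {p q : Mink} (hp : InCone τ p) (hq : InCone τ q) :
    InCone τ (p + q) := by
  obtain ⟨hp0, hp1⟩ := hp
  obtain ⟨hq0, hq1⟩ := hq
  unfold spaceSq at hp1 hq1
  have hpq : 0 ≤ p 0 * q 0 := by
    rcases hτ with rfl | rfl <;> nlinarith
  refine ⟨by simp only [Pi.add_apply]; linarith, ?_⟩
  unfold spaceSq
  simp only [Pi.add_apply]
  have hcs : (p 1 * q 1 + p 2 * q 2 + p 3 * q 3) ^ 2 ≤ (p 0 * q 0) ^ 2 := by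
    calc (p 1 * q 1 + p 2 * q 2 + p 3 * q 3) ^ 2
        ≤ (p 1 ^ 2 + p 2 ^ 2 + p 3 ^ 2) * (q 1 ^ 2 + q 2 ^ 2 + q 3 ^ 2) := by
          nlinarith [sq_nonneg (p 1 * q 2 - p 2 * q 1), sq_nonneg (p 1 * q 3 - p 3 * q 1),
            sq_nonneg (p 2 * q 3 - p 3 * q 2)]
      _ ≤ (p 0) ^ 2 * (q 0) ^ 2 := by gcongr
      _ = (p 0 * q 0) ^ 2 := by ring
  have := (abs_le.1 (abs_le_of_sq_le_sq hcs hpq)).2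
  nlinarith [this]

theorem causalSet_causalSet (hτ : τ = 1 ∨ τ = -1) (A : Set Mink) :
    causalSet τ (causalSet τ A) ⊆ causalSet τ A := by
  rintro q ⟨p, ⟨a, ha, hpa⟩, hqp⟩
  exact ⟨a, ha, by simpa using hqp.add hτ hpa⟩

theorem causalSet_eq_add (A : Set Mink) : causalSet τ A = Set.image2 (· + ·) A {q | InCone τ q} := by
  ext q
  constructor
  · rintro ⟨p, hp, h⟩
    exact ⟨p, hp, q - p, h, by simp⟩
  · rintro ⟨p, hp, r, hr, rfl⟩
    exact ⟨p, hp, by simpa using hr⟩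

theorem isClosed_causalSet_of_isCompact {A : Set Mink} (hA : IsCompact A) :
    IsClosed (causalSet τ A) := by
  rw [causalSet_eq_add]
  exact isClosed_inCone.add_left_of_isCompact hA

/-- The vector of length `c` in the time direction. -/
def timeVec (c : ℝ) : Mink := Pi.single 0 c

/-- Points near `p` lie in the causal set of a point which is slightly later (earlier) than `p`. -/
theorem eventually_mem_causalSet (hτ : τ = 1 ∨ τ = -1) (p : Mink) :
    ∀ᶠ q in nhds p, q ∈ causalSet (-τ) {p + timeVec τ} := by
  have h1 : ∀ᶠ q : Mink in nhds p, 0 < 1 - τ * (q 0 - p 0) := by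
    refine (ContinuousAt.eventually_lt (f := fun _ : Mink => (0 : ℝ)) (by fun_prop)
      (Continuous.continuousAt (by fun_prop)) (by simp))
  have h2 : ∀ᶠ q : Mink in nhds p, spaceSq (q - p) < (τ - (q 0 - p 0)) ^ 2 := by
    refine (ContinuousAt.eventually_lt (Continuous.continuousAt ?_)
      (Continuous.continuousAt (by fun_prop)) ?_)
    · unfold spaceSq; fun_prop
    · rcases hτ with rfl | rfl <;> simp [spaceSq]
  filter_upwards [h1, h2] with q hq1 hq2
  rw [mem_causalSet_singleton]
  have ht : τ * τ = 1 := by rcases hτ with rfl | rfl <;> norm_num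
  refine ⟨?_, ?_⟩
  · simp [timeVec]; nlinarith
  · have : spaceSq (q - (p + timeVec τ)) = spaceSq (q - p) := by
      simp [spaceSq, timeVec]
    rw [this]
    refine hq2.le.trans (le_of_eq ?_)
    simp [timeVec]; ring

/-- A bounded set lies in the causal set of a single point. -/
theorem exists_subset_causalSet (hτ : τ = 1 ∨ τ = -1) {C : Set Mink} (hC : IsCompact C) :
    ∃ p : Mink, C ⊆ causalSet τ {p} := by
  obtain ⟨R, hR⟩ := hC.isBounded.exists_norm_le
  have hR' : ∀ q ∈ C, ∀ i, |q i| ≤ |R| := fun q hq i =>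
    (norm_le_pi_norm q i).trans ((hR q hq).trans (le_abs_self R))
  -- the distance `4 R` in time leaves `3 R ≥ √3 R` to cover the spatial extent of `C`
  refine ⟨timeVec (-τ * (4 * |R|)), fun q hq => mem_causalSet_singleton.2 ?_⟩
  have h0 := abs_le.1 (hR' q hq 0)
  have hs : ∀ i, q i ^ 2 ≤ R ^ 2 := fun i => by
    have := hR' q hq i
    exact sq_le_sq.2 this
  have hR2 : |R| ^ 2 = R ^ 2 := sq_abs R
  refine ⟨?_, ?_⟩
  · rcases hτ with rfl | rfl <;> simp [timeVec] <;> linarith [h0.1, h0.2, abs_nonneg R]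
  · have h1 : spaceSq (q - timeVec (-τ * (4 * |R|))) = spaceSq q := by
      simp [spaceSq, timeVec]
    rw [h1]
    have h2 : spaceSq q ≤ 3 * R ^ 2 := by
      unfold spaceSq; linarith [hs 1, hs 2, hs 3]
    refine h2.trans ?_
    rcases hτ with rfl | rfl <;> simp [timeVec] <;> nlinarith [h0.1, h0.2, abs_nonneg R]

/-- Double cones are compact. -/
theorem isCompact_doubleCone (hτ : τ = 1 ∨ τ = -1) (p q : Mink) :
    IsCompact (causalSet τ {p} ∩ causalSet (-τ) {q}) := by
  refine Metric.isCompact_of_isClosed_isBounded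
    ((isClosed_causalSet_of_isCompact isCompact_singleton).inter
      (isClosed_causalSet_of_isCompact isCompact_singleton)) ?_
  refine (Metric.isBounded_closedBall (x := p) (r := |q 0 - p 0|)).subset ?_
  rintro r ⟨h1, h2⟩
  rw [mem_causalSet_singleton] at h1 h2
  obtain ⟨h1, h1'⟩ := h1
  obtain ⟨h2, -⟩ := h2
  simp only [Pi.sub_apply] at h1 h1' h2
  have ht : |r 0 - p 0| ≤ |q 0 - p 0| := by
    rcases hτ with rfl | rfl
    · rw [abs_of_nonneg (by linarith), abs_of_nonneg (by linarith)]; linarith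
    · rw [abs_of_nonpos (by linarith), abs_of_nonpos (by linarith)]; linarith
  rw [mem_closedBall_iff_norm]
  refine (pi_norm_le_iff_of_nonneg (abs_nonneg _)).2 fun i => ?_
  rw [Real.norm_eq_abs]
  unfold spaceSq at h1'
  simp only [Pi.sub_apply] at h1' ⊢
  have key : (r i - p i) ^ 2 ≤ (r 0 - p 0) ^ 2 := by
    fin_cases i <;> simp <;>
      nlinarith [sq_nonneg (r 1 - p 1), sq_nonneg (r 2 - p 2), sq_nonneg (r 3 - p 3)]
  exact (sq_le_sq.1 key).trans ht

/-- A set whose intersection with the causal set `causalSet (-τ) {p}` of every point is compact: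
"past compact" for `τ = 1`, "future compact" for `τ = -1`. -/
def ConeCompact (τ : ℝ) (A : Set Mink) : Prop := ∀ p, IsCompact (A ∩ causalSet (-τ) {p})

theorem coneCompact_of_isCompact {A : Set Mink} (hA : IsCompact A) : ConeCompact τ A := fun _ =>
  hA.inter_right (isClosed_causalSet_of_isCompact isCompact_singleton)

theorem causalSet_inter_subset (hτ : τ = 1 ∨ τ = -1) (A : Set Mink) (p : Mink) :
    causalSet τ A ∩ causalSet (-τ) {p} ⊆ causalSet τ (A ∩ causalSet (-τ) {p}) := by
  rintro q ⟨⟨a, ha, hqa⟩, hqp⟩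
  refine ⟨a, ⟨ha, ?_⟩, hqa⟩
  have hτ' : -τ = 1 ∨ -τ = -1 := by rcases hτ with rfl | rfl <;> simp
  refine causalSet_causalSet hτ' {p} ⟨q, hqp, ?_⟩
  rw [← inCone_neg, neg_sub]; exact hqa

theorem ConeCompact.isClosed_causalSet (hτ : τ = 1 ∨ τ = -1) {A : Set Mink}
    (hA : ConeCompact τ A) : IsClosed (causalSet τ A) := by
  refine isClosed_of_closure_subset fun p hp => ?_
  set p1 := p + timeVec τ
  -- near `p`, only the compact part of `A` in the causal past of `p1` contributes
  have hcl : IsClosed (causalSet τ (A ∩ causalSet (-τ) {p1})) :=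
    isClosed_causalSet_of_isCompact (hA p1)
  have h1 : p ∈ closure (causalSet τ A ∩ causalSet (-τ) {p1}) := by
    rw [mem_closure_iff_nhds] at hp ⊢
    intro U hU
    obtain ⟨q, ⟨hq1, hq2⟩, hq3⟩ := hp _ (Filter.inter_mem hU (eventually_mem_causalSet hτ p))
    exact ⟨q, hq1, hq3, hq2⟩
  exact causalSet_mono inter_subset_left
    (closure_minimal (causalSet_inter_subset hτ A p1) hcl h1)

/-- If `A` is past compact, then so is its causal future. -/
theorem ConeCompact.causalSet (hτ : τ = 1 ∨ τ = -1) {A : Set Mink} (hA : ConeCompact τ A) :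
    ConeCompact τ (causalSet τ A) := by
  intro p
  obtain ⟨p0, hp0⟩ := exists_subset_causalSet hτ (hA p)
  refine (isCompact_doubleCone hτ p0 p).of_isClosed_subset
    ((hA.isClosed_causalSet hτ).inter (isClosed_causalSet_of_isCompact isCompact_singleton)) ?_
  intro q hq
  refine ⟨?_, hq.2⟩
  exact causalSet_causalSet hτ _ (causalSet_mono hp0 (causalSet_inter_subset hτ A p hq))

/-- The causal future of a past compact set and the causal past of a compact set have compact
intersection. -/
theorem ConeCompact.inter_causalSet (hτ : τ = 1 ∨ τ = -1) {A C : Set Mink}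
    (hA : ConeCompact τ A) (hC : IsCompact C) :
    IsCompact (CasimirPolder.causalSet τ A ∩ CasimirPolder.causalSet (-τ) C) := by
  have hτ' : -τ = 1 ∨ -τ = -1 := by rcases hτ with rfl | rfl <;> simp
  obtain ⟨p, hp⟩ := exists_subset_causalSet hτ' hC
  refine (hA.causalSet hτ p).of_isClosed_subset
    ((hA.isClosed_causalSet hτ).inter (isClosed_causalSet_of_isCompact hC)) ?_
  exact inter_subset_inter_right _
    ((causalSet_mono hp).trans (causalSet_causalSet hτ' _))

theorem timelikeCompact_iff {φ : Smooth} : φ ∈ TimelikeCompact ↔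
    ConeCompact 1 (tsupport φ) ∧ ConeCompact (-1) (tsupport φ) := by
  rw [ConeCompact, ConeCompact, neg_neg, causalSet_one, causalSet_neg_one, ← forall_and]
  exact forall_congr' fun p => and_comm

theorem TimelikeCompact.coneCompact (hτ : τ = 1 ∨ τ = -1) {φ : Smooth} (hφ : φ ∈ TimelikeCompact) :
    ConeCompact τ (tsupport φ) := by
  rcases hτ with rfl | rfl
  exacts [(timelikeCompact_iff.1 hφ).1, (timelikeCompact_iff.1 hφ).2]

end

noncomputable section

/-! ### The Klein-Gordon operator: locality and symmetry -/

theorem Smooth.continuous (φ : Smooth) : Continuous φ := φ.smooth.continuous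

@[simp] theorem Smooth.neg_apply (φ : Smooth) (p : Mink) : (-φ) p = -φ p := rfl

theorem partialD_apply (i : Fin 4) (φ : Smooth) (p : Mink) :
    partialD i φ p = fderiv ℝ φ p (Pi.single i 1) := rfl

theorem KG_apply (m : ℝ) (φ : Smooth) (p : Mink) :
    KG m φ p = -partialD 0 (partialD 0 φ) p + partialD 1 (partialD 1 φ) p
      + partialD 2 (partialD 2 φ) p + partialD 3 (partialD 3 φ) p - m ^ 2 * φ p := by
  simp [KG]

theorem partialD_congr {φ ψ : Smooth} {p : Mink} (i : Fin 4) (h : ⇑φ =ᶠ[nhds p] ψ) :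
    ⇑(partialD i φ) =ᶠ[nhds p] partialD i ψ := by
  filter_upwards [h.fderiv (𝕜 := ℝ)] with q hq
  rw [partialD_apply, partialD_apply, hq]

theorem KG_congr (m : ℝ) {φ ψ : Smooth} {p : Mink} (h : ⇑φ =ᶠ[nhds p] ψ) :
    ⇑(KG m φ) =ᶠ[nhds p] KG m ψ := by
  filter_upwards [h, partialD_congr 0 (partialD_congr 0 h), partialD_congr 1 (partialD_congr 1 h),
    partialD_congr 2 (partialD_congr 2 h), partialD_congr 3 (partialD_congr 3 h)]
    with q h h0 h1 h2 h3
  rw [KG_apply, KG_apply, h, h0, h1, h2, h3]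

theorem tsupport_partialD (i : Fin 4) (φ : Smooth) : tsupport (partialD i φ) ⊆ tsupport φ := by
  refine (closure_mono fun p hp => ?_).trans (tsupport_fderiv_subset ℝ (f := φ))
  intro h
  rw [Function.mem_support, partialD_apply, h] at hp
  exact hp rfl

theorem tsupport_KG (m : ℝ) (φ : Smooth) : tsupport (KG m φ) ⊆ tsupport φ := by
  intro p hp
  by_contra hn
  have h : ⇑φ =ᶠ[nhds p] (0 : Smooth) := notMem_tsupport_iff_eventuallyEq.1 hn
  have h' := KG_congr m h
  rw [map_zero] at h'
  exact notMem_tsupport_iff_eventuallyEq.2 h' hp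

theorem partialD_mem_testFn (i : Fin 4) {φ : Smooth} (h : φ ∈ TestFn) : partialD i φ ∈ TestFn :=
  IsCompact.of_isClosed_subset h (isClosed_tsupport _) (tsupport_partialD i φ)

theorem KG_mem_testFn (m : ℝ) {φ : Smooth} (h : φ ∈ TestFn) : KG m φ ∈ TestFn :=
  IsCompact.of_isClosed_subset h (isClosed_tsupport _) (tsupport_KG m φ)

theorem integrable_mul_of_isCompact {φ ψ : Smooth} (h : IsCompact (tsupport φ ∩ tsupport ψ)) :
    Integrable (fun p => φ p * ψ p) := by
  refine (φ.continuous.mul ψ.continuous).integrable_of_hasCompactSupport ?_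
  refine HasCompactSupport.intro h fun p hp => ?_
  rw [mem_inter_iff, not_and_or] at hp
  rcases hp with hp | hp <;> simp [image_eq_zero_of_notMem_tsupport hp]

theorem l2Pair_partialD {φ ψ : Smooth} (h : IsCompact (tsupport φ ∩ tsupport ψ)) (i : Fin 4) :
    l2Pair (partialD i φ) ψ = -l2Pair φ (partialD i ψ) := by
  have h1 : IsCompact (tsupport (partialD i φ) ∩ tsupport ψ) := h.of_isClosed_subset
    ((isClosed_tsupport _).inter (isClosed_tsupport _))
    (inter_subset_inter_left _ (tsupport_partialD i φ))
  have h2 : IsCompact (tsupport φ ∩ tsupport (partialD i ψ)) := h.of_isClosed_subset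
    ((isClosed_tsupport _).inter (isClosed_tsupport _))
    (inter_subset_inter_right _ (tsupport_partialD i ψ))
  have := integral_mul_fderiv_eq_neg_fderiv_mul_of_integrable (μ := (volume : Measure Mink))
    (f := φ) (g := ψ) (v := Pi.single i 1) (integrable_mul_of_isCompact h1)
    (integrable_mul_of_isCompact h2) (integrable_mul_of_isCompact h)
    (fun p _ => φ.differentiableAt p) (fun p _ => ψ.differentiableAt p)
  unfold l2Pair
  simp only [partialD_apply]
  rw [this, neg_neg]

theorem l2Pair_partialD_partialD {φ ψ : Smooth} (h : IsCompact (tsupport φ ∩ tsupport ψ))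
    (i : Fin 4) : l2Pair (partialD i (partialD i φ)) ψ = l2Pair φ (partialD i (partialD i ψ)) := by
  rw [l2Pair_partialD, l2Pair_partialD, neg_neg]
  · exact h.of_isClosed_subset ((isClosed_tsupport _).inter (isClosed_tsupport _))
      (inter_subset_inter_right _ (tsupport_partialD i ψ))
  · exact h.of_isClosed_subset ((isClosed_tsupport _).inter (isClosed_tsupport _))
      (inter_subset_inter_left _ (tsupport_partialD i φ))

theorem l2Pair_comm (φ ψ : Smooth) : l2Pair φ ψ = l2Pair ψ φ := by
  simp only [l2Pair, mul_comm]

theorem l2Pair_KG_left (m : ℝ) {φ ψ : Smooth} (h : IsCompact (tsupport φ ∩ tsupport ψ)) :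
    l2Pair (KG m φ) ψ = -l2Pair (partialD 0 (partialD 0 φ)) ψ + l2Pair (partialD 1 (partialD 1 φ)) ψ
      + l2Pair (partialD 2 (partialD 2 φ)) ψ + l2Pair (partialD 3 (partialD 3 φ)) ψ
      - m ^ 2 * l2Pair φ ψ := by
  have hi : ∀ i, Integrable (fun p => partialD i (partialD i φ) p * ψ p) := fun i =>
    integrable_mul_of_isCompact (h.of_isClosed_subset
      ((isClosed_tsupport _).inter (isClosed_tsupport _))
      (inter_subset_inter_left _ ((tsupport_partialD i _).trans (tsupport_partialD i φ))))
  have h0 := integrable_mul_of_isCompact h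
  have h1 : (fun p => KG m φ p * ψ p)
      = -(fun p => partialD 0 (partialD 0 φ) p * ψ p) + (fun p => partialD 1 (partialD 1 φ) p * ψ p)
        + (fun p => partialD 2 (partialD 2 φ) p * ψ p)
        + (fun p => partialD 3 (partialD 3 φ) p * ψ p) - (fun p => m ^ 2 * (φ p * ψ p)) := by
    funext p
    simp only [KG_apply, Pi.add_apply, Pi.neg_apply, Pi.sub_apply]
    ring
  unfold l2Pair
  rw [h1, integral_sub' ((((hi 0).neg.add (hi 1)).add (hi 2)).add (hi 3)) (h0.const_mul _),
    integral_add' (((hi 0).neg.add (hi 1)).add (hi 2)) (hi 3),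
    integral_add' ((hi 0).neg.add (hi 1)) (hi 2), integral_add' (hi 0).neg (hi 1), integral_neg',
    integral_const_mul]

/-- The Klein-Gordon operator is formally self-adjoint. -/
theorem l2Pair_KG (m : ℝ) {φ ψ : Smooth} (h : IsCompact (tsupport φ ∩ tsupport ψ)) :
    l2Pair (KG m φ) ψ = l2Pair φ (KG m ψ) := by
  rw [l2Pair_KG_left m h, l2Pair_comm φ (KG m ψ), l2Pair_KG_left m (by rwa [inter_comm])]
  simp only [l2Pair_partialD_partialD h, l2Pair_comm φ]

theorem l2Pair_zero_left (φ : Smooth) : l2Pair 0 φ = 0 := by simp [l2Pair]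

theorem l2Pair_zero_right (φ : Smooth) : l2Pair φ 0 = 0 := by simp [l2Pair]

/-- A smooth function which is orthogonal to all test functions vanishes. -/
theorem eq_zero_of_l2Pair_eq_zero {w : Smooth} (h : ∀ φ ∈ TestFn, l2Pair w φ = 0) : w = 0 := by
  have h1 : ∀ᵐ p : Mink, w p = 0 := by
    refine ae_eq_zero_of_integral_contDiff_smul_eq_zero w.continuous.locallyIntegrable ?_
    intro g hg hgc
    have h2 := h ⟨g, hg⟩ hgc
    rw [l2Pair_comm] at h2
    exact h2
  ext p
  exact congrFun (w.continuous.ae_eq_iff_eq volume continuous_zero |>.1 h1) p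

theorem sub_zRefl_mem_oddFn (φ : Smooth) : φ - zRefl φ ∈ OddFn := by
  intro p
  simp [reflPt_reflPt]

theorem zRefl_mem_testFn {φ : Smooth} (h : φ ∈ TestFn) : zRefl φ ∈ TestFn := by
  refine HasCompactSupport.intro (IsCompact.image h reflPt.continuous) fun p hp => ?_
  exact image_eq_zero_of_notMem_tsupport (f := φ) fun hc => hp ⟨_, hc, reflPt_reflPt p⟩

theorem l2Pair_zRefl (φ ψ : Smooth) : l2Pair (zRefl φ) (zRefl ψ) = l2Pair φ ψ := by
  have hme : MeasurableEmbedding reflPt :=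
    (Homeomorph.mk (Equiv.mk reflPt reflPt reflPt_reflPt reflPt_reflPt) reflPt.continuous
      reflPt.continuous).measurableEmbedding
  exact measurePreserving_reflPt.integral_comp hme (fun p => φ p * ψ p)

/-- An odd function which is orthogonal to all odd test functions vanishes. -/
theorem eq_zero_of_l2Pair_odd {w : Smooth} (hw : w ∈ OddFn) (h : ∀ φ ∈ TestOdd, l2Pair w φ = 0) :
    w = 0 := by
  refine eq_zero_of_l2Pair_eq_zero fun φ hφ => ?_
  have h1 := h (φ - zRefl φ) ⟨sub_mem hφ (zRefl_mem_testFn hφ), sub_zRefl_mem_oddFn φ⟩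
  have hi : ∀ ψ ∈ TestFn, Integrable fun p => w p * ψ p := fun ψ hψ =>
    integrable_mul_of_isCompact (IsCompact.inter_left hψ (isClosed_tsupport _))
  have h2 : l2Pair w (φ - zRefl φ) = l2Pair w φ - l2Pair w (zRefl φ) := by
    unfold l2Pair
    rw [← integral_sub (hi φ hφ) (hi _ (zRefl_mem_testFn hφ))]
    simp only [Smooth.sub_apply, mul_sub]
  have hw' : zRefl w = -w := by ext p; exact hw p
  have h3 : l2Pair w (zRefl φ) = -l2Pair w φ := by
    rw [← l2Pair_zRefl w φ, hw']
    simp [l2Pair, integral_neg]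
  linarith

end

noncomputable section

/-! ### The Bessel-Clifford functions -/

/-- The entire function `∑ₖ cᵏ sᵏ / (k! (k + n)!)`. For `n = 0` and `c = -m² / 4` it is
`s ↦ J₀(m √s)`. -/
def clifford (c : ℝ) (n : ℕ) (s : ℝ) : ℝ :=
  ∑' k : ℕ, (c * s) ^ k / (k.factorial * (k + n).factorial)

theorem one_le_factorial_cast (k : ℕ) : (1 : ℝ) ≤ (k.factorial : ℝ) := by
  exact_mod_cast k.factorial_pos

theorem norm_pow_div_factorial_mul_le (x : ℝ) (k l : ℕ) :
    ‖x ^ k / (k.factorial * l.factorial)‖ ≤ |x| ^ k / k.factorial := by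
  rw [norm_div, norm_pow, Real.norm_eq_abs, norm_mul, Real.norm_natCast, Real.norm_natCast]
  have h1 := one_le_factorial_cast k
  have h2 := one_le_factorial_cast l
  gcongr
  nlinarith

theorem summable_clifford (c : ℝ) (n : ℕ) (s : ℝ) :
    Summable fun k : ℕ => (c * s) ^ k / (k.factorial * (k + n).factorial : ℝ) :=
  Summable.of_norm_bounded (Real.summable_pow_div_factorial |c * s|)
    fun k => norm_pow_div_factorial_mul_le _ k (k + n)

theorem hasDerivAt_clifford (c : ℝ) (n : ℕ) (s : ℝ) :
    HasDerivAt (clifford c n) (c * clifford c (n + 1) s) s := by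
  set R := |s| + 1 with hR
  have hR1 : 1 ≤ R := by have := abs_nonneg s; linarith
  have h := hasDerivAt_tsum_of_isPreconnected
    (g := fun k (x : ℝ) => (c * x) ^ k / (k.factorial * (k + n).factorial : ℝ))
    (g' := fun k x => (k * (c * x) ^ (k - 1) * (c * 1)) / (k.factorial * (k + n).factorial : ℝ))
    (t := Metric.ball 0 R) (y₀ := 0) (y := s) (𝕜 := ℝ) (F := ℝ)
    -- the factor `k` from differentiation is absorbed by `2 ^ k`
    (u := fun k => ((|c| + 1) * (2 * R)) ^ k / k.factorial)
    (Real.summable_pow_div_factorial _) Metric.isOpen_ball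
    (convex_ball 0 R).isPreconnected
    (fun k x _ => (((hasDerivAt_id x).const_mul c).pow k).div_const _)
    ?_ (Metric.mem_ball_self (by linarith)) (summable_clifford c n 0) (by simp [hR])
  · refine h.congr_deriv ?_
    have hs : Summable fun k : ℕ =>
        (k * (c * s) ^ (k - 1) * (c * 1)) / (k.factorial * (k + n).factorial : ℝ) := by
      refine (summable_nat_add_iff 1).1 ((summable_clifford c (n + 1) s).mul_left c |>.congr ?_)
      intro k
      have h1 : ((k + 1).factorial : ℝ) = (k + 1) * k.factorial := by
        rw [Nat.factorial_succ]; push_cast; ring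
      have h2 : k + 1 + n = k + (n + 1) := by ring
      have h3 := one_le_factorial_cast k
      have h4 := one_le_factorial_cast (k + (n + 1))
      rw [h1, h2]
      simp only [Nat.add_sub_cancel]
      push_cast
      field_simp
    rw [hs.tsum_eq_zero_add, clifford, ← tsum_mul_left]
    simp only [Nat.cast_zero, zero_mul, zero_div, zero_add]
    refine tsum_congr fun k => ?_
    have h1 : ((k + 1).factorial : ℝ) = (k + 1) * k.factorial := by
      rw [Nat.factorial_succ]; push_cast; ring
    have h2 : k + 1 + n = k + (n + 1) := by ring
    have h3 := one_le_factorial_cast k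
    have h4 := one_le_factorial_cast (k + (n + 1))
    rw [h1, h2]
    simp only [Nat.add_sub_cancel]
    push_cast
    field_simp
  · intro k x hx
    have hx : |x| ≤ R := by simpa using (Metric.mem_ball.1 hx).le
    rcases k with _ | k
    · simp
    rw [norm_div, norm_mul, norm_mul, norm_pow, norm_mul ((k + 1).factorial : ℝ),
      Real.norm_natCast, Real.norm_natCast, Real.norm_natCast, mul_one, Nat.add_sub_cancel,
      norm_mul c x, Real.norm_eq_abs x, Real.norm_eq_abs c]
    have h1 := one_le_factorial_cast (k + 1)
    have h2 := one_le_factorial_cast (k + 1 + n)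
    have h3 : ((k + 1 : ℕ) : ℝ) ≤ 2 ^ (k + 1) := by exact_mod_cast (Nat.lt_two_pow_self).le
    have h4 : (|c| * |x|) ^ k * |c| ≤ ((|c| + 1) * R) ^ (k + 1) := by
      rw [pow_succ]
      have hc : |c| ≤ (|c| + 1) * R := by
        nlinarith [abs_nonneg c]
      gcongr
      linarith
    have h5 : (((k + 1 : ℕ) : ℝ) * (|c| * |x|) ^ k * |c|) ≤ ((|c| + 1) * (2 * R)) ^ (k + 1) := by
      calc (((k + 1 : ℕ) : ℝ) * (|c| * |x|) ^ k * |c|)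
          = ((k + 1 : ℕ) : ℝ) * ((|c| * |x|) ^ k * |c|) := by ring
        _ ≤ 2 ^ (k + 1) * ((|c| + 1) * R) ^ (k + 1) := by gcongr
        _ = _ := by rw [← mul_pow]; congr 1; ring
    gcongr
    nlinarith

theorem continuous_clifford (c : ℝ) (n : ℕ) : Continuous (clifford c n) :=
  continuous_iff_continuousAt.2 fun s => (hasDerivAt_clifford c n s).continuousAt

theorem clifford_zero_zero (c : ℝ) : clifford c 0 0 = 1 := by
  rw [clifford, tsum_eq_single 0]
  · simp
  · intro k hk; simp [hk]

/-- The recurrence relation, which amounts to Bessel's differential equation. -/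
theorem clifford_recurrence (c : ℝ) (s : ℝ) :
    c * s * clifford c 2 s + clifford c 1 s = clifford c 0 s := by
  unfold clifford
  have h2 : Summable fun k : ℕ => (k : ℝ) * ((c * s) ^ k / (k.factorial * (k + 1).factorial : ℝ)) := by
    refine (summable_nat_add_iff 1).1 ((summable_clifford c 2 s).mul_left (c * s) |>.congr ?_)
    intro k
    have h1 : ((k + 1).factorial : ℝ) = (k + 1) * k.factorial := by
      rw [Nat.factorial_succ]; push_cast; ring
    have h3 := one_le_factorial_cast k
    have h4 := one_le_factorial_cast (k + 1 + 1)
    rw [h1, pow_succ]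
    push_cast
    field_simp
  have e2 : c * s * ∑' k : ℕ, (c * s) ^ k / (k.factorial * (k + 2).factorial : ℝ)
      = ∑' k : ℕ, (k : ℝ) * ((c * s) ^ k / (k.factorial * (k + 1).factorial : ℝ)) := by
    rw [h2.tsum_eq_zero_add, ← tsum_mul_left]
    simp only [Nat.cast_zero, zero_mul, zero_add]
    refine tsum_congr fun k => ?_
    have h1 : ((k + 1).factorial : ℝ) = (k + 1) * k.factorial := by
      rw [Nat.factorial_succ]; push_cast; ring
    have h3 := one_le_factorial_cast k
    have h4 := one_le_factorial_cast (k + 1 + 1)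
    rw [h1, pow_succ]
    push_cast
    field_simp
  rw [e2, ← h2.tsum_add (summable_clifford c 1 s)]
  refine tsum_congr fun k => ?_
  have h1 : ((k + 1).factorial : ℝ) = (k + 1) * k.factorial := by
    rw [Nat.factorial_succ]; push_cast; ring
  have h3 := one_le_factorial_cast k
  rw [h1, add_zero]
  field_simp

end

noncomputable section

/-! ### Integrals over hyperboloids -/

/-- The squared Euclidean length in `ℝ³`. -/
def nsq (y : Fin 3 → ℝ) : ℝ := y 0 ^ 2 + y 1 ^ 2 + y 2 ^ 2

theorem nsq_nonneg (y : Fin 3 → ℝ) : 0 ≤ nsq y := by unfold nsq; positivity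

theorem continuous_nsq : Continuous nsq := by unfold nsq; fun_prop

/-- The time `√(|y|² + s)` at which the hyperboloid `t² - |y|² = s` lies over `y`. -/
def rho (s : ℝ) (y : Fin 3 → ℝ) : ℝ := √(nsq y + s)

/-- The parametrization `y ↦ (√(|y|² + s), y)` of the future hyperboloid `t² - |y|² = s`. -/
def hyp (s : ℝ) (y : Fin 3 → ℝ) : Mink := Fin.cons (rho s y) y

theorem rho_pos {s : ℝ} (hs : 0 < s) (y : Fin 3 → ℝ) : 0 < rho s y :=
  Real.sqrt_pos.2 (by linarith [nsq_nonneg y])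

theorem rho_sq {s : ℝ} (hs : 0 ≤ s) (y : Fin 3 → ℝ) : rho s y ^ 2 = nsq y + s :=
  Real.sq_sqrt (by linarith [nsq_nonneg y])

theorem continuous_rho : Continuous fun x : ℝ × (Fin 3 → ℝ) => rho x.1 x.2 :=
  ((continuous_nsq.comp continuous_snd).add continuous_fst).sqrt

theorem continuous_hyp : Continuous fun x : ℝ × (Fin 3 → ℝ) => hyp x.1 x.2 := by
  refine continuous_pi fun i => ?_
  refine Fin.cases ?_ (fun j => ?_) i
  · exact continuous_rho
  · exact (continuous_apply j).comp continuous_snd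

theorem norm_le_norm_hyp (s : ℝ) (y : Fin 3 → ℝ) : ‖y‖ ≤ ‖hyp s y‖ :=
  (pi_norm_le_iff_of_nonneg (norm_nonneg _)).2 fun i => norm_le_pi_norm (hyp s y) i.succ

theorem rho_le_norm_hyp (s : ℝ) (y : Fin 3 → ℝ) : rho s y ≤ ‖hyp s y‖ :=
  (le_abs_self _).trans (norm_le_pi_norm (hyp s y) 0)

/-- The chain rule along curves. -/
theorem Smooth.hasDerivAt_comp (φ : Smooth) {c : ℝ → Mink} {c' : Mink} {x : ℝ}
    (hc : HasDerivAt c c' x) :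
    HasDerivAt (fun t => φ (c t)) (∑ i, c' i * partialD i φ (c x)) x := by
  refine ((φ.differentiableAt (c x)).hasFDerivAt.comp_hasDerivAt x hc).congr_deriv ?_
  have h := LinearMap.pi_apply_eq_sum_univ (fderiv ℝ φ (c x)).toLinearMap c'
  refine h.trans (Finset.sum_congr rfl fun i _ => ?_)
  have hi : (fun j => if i = j then (1 : ℝ) else 0) = (Pi.single i 1 : Mink) := by
    ext j
    simp [Pi.single_apply, eq_comm]
  rw [partialD_apply, smul_eq_mul, ← hi]
  rfl

theorem hasDerivAt_rho {s : ℝ} (hs : 0 < s) (y : Fin 3 → ℝ) :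
    HasDerivAt (fun s => rho s y) (1 / (2 * rho s y)) s :=
  ((hasDerivAt_id s).const_add (nsq y)).sqrt (by have := nsq_nonneg y; simp; linarith)

theorem hasDerivAt_hyp (φ : Smooth) {s : ℝ} (hs : 0 < s) (y : Fin 3 → ℝ) :
    HasDerivAt (fun s => φ (hyp s y)) (partialD 0 φ (hyp s y) / (2 * rho s y)) s := by
  have hc : HasDerivAt (fun s => hyp s y) (Fin.cons (1 / (2 * rho s y)) 0 : Mink) s := by
    refine hasDerivAt_pi.2 fun i => ?_
    refine Fin.cases ?_ (fun j => ?_) i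
    · exact hasDerivAt_rho hs y
    · exact hasDerivAt_const _ _
  refine (φ.hasDerivAt_comp hc).congr_deriv ?_
  rw [Fin.sum_univ_succ]
  simp
  ring

theorem hasDerivAt_line (y : Fin 3 → ℝ) (i j : Fin 3) :
    HasDerivAt (fun t : ℝ => (y + t • Pi.single i (1 : ℝ) : Fin 3 → ℝ) j)
      (Pi.single (M := fun _ => ℝ) i (1 : ℝ) j) 0 := by
  simpa using ((hasDerivAt_id (0 : ℝ)).mul_const (Pi.single (M := fun _ => ℝ) i (1 : ℝ) j)).const_add
    (y j)

theorem hasDerivAt_rho_line {s : ℝ} (hs : 0 < s) (y : Fin 3 → ℝ) (i : Fin 3) :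
    HasDerivAt (fun t : ℝ => rho s (y + t • Pi.single i 1)) (y i / rho s y) 0 := by
  have h : HasDerivAt (fun t : ℝ => nsq (y + t • Pi.single i (1 : ℝ)) + s) (2 * y i) 0 := by
    have h0 := ((hasDerivAt_line y i 0).pow 2).add ((hasDerivAt_line y i 1).pow 2)
    refine ((h0.add ((hasDerivAt_line y i 2).pow 2)).add_const s).congr_deriv ?_
    fin_cases i <;> simp
  refine (h.sqrt (by have := nsq_nonneg y; simp; linarith)).congr_deriv ?_
  simp only [zero_smul, add_zero, rho]
  have := rho_pos hs y
  unfold rho at this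
  field_simp

theorem hasDerivAt_hyp_line (φ : Smooth) {s : ℝ} (hs : 0 < s) (y : Fin 3 → ℝ) (i : Fin 3) :
    HasDerivAt (fun t : ℝ => φ (hyp s (y + t • Pi.single i 1)))
      (y i / rho s y * partialD 0 φ (hyp s y) + partialD i.succ φ (hyp s y)) 0 := by
  have hc : HasDerivAt (fun t : ℝ => hyp s (y + t • Pi.single i 1))
      (Fin.cons (y i / rho s y) (Pi.single i 1) : Mink) 0 := by
    refine hasDerivAt_pi.2 fun k => ?_
    refine Fin.cases ?_ (fun j => ?_) k
    · exact hasDerivAt_rho_line hs y i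
    · exact hasDerivAt_line y i j
  refine (φ.hasDerivAt_comp hc).congr_deriv ?_
  rw [Fin.sum_univ_succ]
  simp [Pi.single_apply]

theorem contDiff_rho {s : ℝ} (hs : 0 < s) : ContDiff ℝ ∞ (rho s) := by
  refine ContDiff.sqrt ?_ fun y => by have := nsq_nonneg y; linarith
  unfold nsq
  fun_prop

theorem contDiff_hyp (φ : Smooth) {s : ℝ} (hs : 0 < s) : ContDiff ℝ ∞ fun y => φ (hyp s y) := by
  refine φ.smooth.comp (contDiff_pi.2 fun k => ?_)
  refine Fin.cases ?_ (fun j => ?_) k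
  · exact contDiff_rho hs
  · exact contDiff_apply ℝ ℝ j

/-- The functions `φ / ρᵇ` on the hyperboloid. -/
def hypFun (b : ℕ) (φ : Smooth) (s : ℝ) (y : Fin 3 → ℝ) : ℝ := φ (hyp s y) / rho s y ^ b

/-- The weighted integral of a function over the hyperboloid `t² - |y|² = s`. -/
def hypInt (b : ℕ) (φ : Smooth) (s : ℝ) : ℝ := ∫ y, hypFun b φ s y

variable {R : ℝ} {φ g : Smooth}

theorem hyp_eq_zero_of_norm (hφ : tsupport φ ⊆ Metric.closedBall 0 R) {s : ℝ} {y : Fin 3 → ℝ}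
    (h : R < ‖y‖) : φ (hyp s y) = 0 := by
  refine image_eq_zero_of_notMem_tsupport fun hc => ?_
  have h1 := mem_closedBall_zero_iff.1 (hφ hc)
  linarith [norm_le_norm_hyp s y]

theorem hyp_eq_zero_of_rho (hφ : tsupport φ ⊆ Metric.closedBall 0 R) {s : ℝ} {y : Fin 3 → ℝ}
    (h : R < rho s y) : φ (hyp s y) = 0 := by
  refine image_eq_zero_of_notMem_tsupport fun hc => ?_
  have h1 := mem_closedBall_zero_iff.1 (hφ hc)
  linarith [rho_le_norm_hyp s y]

theorem hyp_eq_zero_of_sq_lt (hφ : tsupport φ ⊆ Metric.closedBall 0 R) {s : ℝ} {y : Fin 3 → ℝ}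
    (h : R ^ 2 < s) : φ (hyp s y) = 0 := by
  refine hyp_eq_zero_of_rho hφ ?_
  refine Real.lt_sqrt_of_sq_lt ?_
  linarith [nsq_nonneg y]

theorem contDiff_hypFun (b : ℕ) (φ : Smooth) {s : ℝ} (hs : 0 < s) :
    ContDiff ℝ ∞ (hypFun b φ s) :=
  (contDiff_hyp φ hs).div ((contDiff_rho hs).pow b) fun y => (pow_pos (rho_pos hs y) b).ne'

theorem hasCompactSupport_hypFun (hφ : tsupport φ ⊆ Metric.closedBall 0 R) (b : ℕ) (s : ℝ) :
    HasCompactSupport (hypFun b φ s) := by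
  refine HasCompactSupport.intro (isCompact_closedBall 0 R) fun y hy => ?_
  have : R < ‖y‖ := by simpa using hy
  rw [hypFun, hyp_eq_zero_of_norm hφ this, zero_div]

theorem integrable_hypFun (hφ : tsupport φ ⊆ Metric.closedBall 0 R) (b : ℕ) {s : ℝ} (hs : 0 < s) :
    Integrable (hypFun b φ s) :=
  (contDiff_hypFun b φ hs).continuous.integrable_of_hasCompactSupport
    (hasCompactSupport_hypFun hφ b s)

/-- The integral of a partial derivative of a compactly supported function vanishes. -/
theorem integral_eq_zero_of_hasDerivAt_line {V V' : (Fin 3 → ℝ) → ℝ} (hV : ContDiff ℝ ∞ V)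
    (hc : HasCompactSupport V) (i : Fin 3)
    (h : ∀ y, HasDerivAt (fun t : ℝ => V (y + t • Pi.single i 1)) (V' y) 0) :
    Integrable V' ∧ ∫ y, V' y = 0 := by
  have h1 : ∀ y, V' y = fderiv ℝ V y (Pi.single i 1) := fun y => by
    have h2 := ((hV.differentiable (by simp)).differentiableAt (x := y)).hasFDerivAt.hasLineDerivAt
      (Pi.single i (1 : ℝ))
    exact (h y).unique h2
  have hcont : Continuous fun y => fderiv ℝ V y (Pi.single i (1 : ℝ)) :=
    (hV.continuous_fderiv (by simp)).clm_apply continuous_const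
  have hint : Integrable fun y => fderiv ℝ V y (Pi.single i (1 : ℝ)) :=
    hcont.integrable_of_hasCompactSupport (hc.fderiv_apply (𝕜 := ℝ) _)
  -- integrate by parts against the constant function `1`
  have h3 := integral_mul_fderiv_eq_neg_fderiv_mul_of_integrable (f := fun _ : Fin 3 → ℝ => (1 : ℝ))
    (g := V) (v := Pi.single i 1) (μ := volume) (by simp) (by simpa using hint)
    (by simpa using hV.continuous.integrable_of_hasCompactSupport hc)
    (fun y _ => differentiableAt_const _) (fun y _ => (hV.differentiable (by simp)).differentiableAt)
  rw [funext h1]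
  exact ⟨hint, by simpa using h3⟩

/-- The components `(∂ᵢg) / ρ - yᵢ (∂ₜg) / ρ² + yᵢ g / ρ³` of a vector field on the hyperboloid
whose divergence converts `□g / ρ` into terms that concentrate at the apex of the light cone. -/
def hypField (g : Smooth) (s : ℝ) (i : Fin 3) (y : Fin 3 → ℝ) : ℝ :=
  hypFun 1 (partialD i.succ g) s y - y i * hypFun 2 (partialD 0 g) s y + y i * hypFun 3 g s y

/-- The derivative of `hypField` in its own direction. -/
def hypFieldDeriv (g : Smooth) (s : ℝ) (i : Fin 3) (y : Fin 3 → ℝ) : ℝ :=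
  (y i / rho s y * partialD 0 (partialD i.succ g) (hyp s y)
      + partialD i.succ (partialD i.succ g) (hyp s y)) / rho s y
    - partialD i.succ g (hyp s y) * y i / rho s y ^ 3
    - partialD 0 g (hyp s y) / rho s y ^ 2
    - y i * (y i / rho s y * partialD 0 (partialD 0 g) (hyp s y)
      + partialD i.succ (partialD 0 g) (hyp s y)) / rho s y ^ 2
    + 2 * y i ^ 2 * partialD 0 g (hyp s y) / rho s y ^ 4
    + g (hyp s y) / rho s y ^ 3
    + y i * (y i / rho s y * partialD 0 g (hyp s y) + partialD i.succ g (hyp s y)) / rho s y ^ 3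
    - 3 * y i ^ 2 * g (hyp s y) / rho s y ^ 5

theorem hasDerivAt_hypField (g : Smooth) {s : ℝ} (hs : 0 < s) (i : Fin 3) (y : Fin 3 → ℝ) :
    HasDerivAt (fun t : ℝ => hypField g s i (y + t • Pi.single i 1)) (hypFieldDeriv g s i y) 0 := by
  have hr := hasDerivAt_rho_line hs y i
  have hρ := rho_pos hs y
  have hne : ∀ b : ℕ, rho s (y + (0 : ℝ) • Pi.single i 1) ^ b ≠ 0 := fun b =>
    (pow_pos (rho_pos hs _) b).ne'
  have hl := hasDerivAt_line y i i
  have h1 := (hasDerivAt_hyp_line (partialD i.succ g) hs y i).div (hr.pow 1) (hne 1)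
  have h2 := (hasDerivAt_hyp_line (partialD 0 g) hs y i).div (hr.pow 2) (hne 2)
  have h3 := (hasDerivAt_hyp_line g hs y i).div (hr.pow 3) (hne 3)
  refine ((h1.sub (hl.mul h2)).add (hl.mul h3)).congr_deriv ?_
  simp only [zero_smul, add_zero, Pi.pow_apply, Pi.single_eq_same, hypFieldDeriv,
    Pi.div_apply]
  field_simp
  push_cast
  ring

theorem partialD_comm (i j : Fin 4) (φ : Smooth) :
    partialD i (partialD j φ) = partialD j (partialD i φ) := by
  ext p
  have h2 : ∀ v w : Mink, fderiv ℝ (fun q => fderiv ℝ φ q v) p w = fderiv ℝ (fderiv ℝ φ) p w v := by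
    intro v w
    have hd : DifferentiableAt ℝ (fderiv ℝ φ) p :=
      ((φ.smooth.fderiv_right (m := ∞) (by simp)).differentiable (by simp)).differentiableAt
    rw [fderiv_clm_apply hd (differentiableAt_const _)]
    simp
  have hs : IsSymmSndFDerivAt ℝ φ p :=
    (φ.smooth.contDiffAt).isSymmSndFDerivAt <| by
      rw [minSmoothness_of_isRCLikeNormedField]
      exact WithTop.coe_le_coe.2 (le_top : (2 : ℕ∞) ≤ ⊤)
  show fderiv ℝ (fun q => fderiv ℝ φ q (Pi.single j 1)) p (Pi.single i 1)
    = fderiv ℝ (fun q => fderiv ℝ φ q (Pi.single i 1)) p (Pi.single j 1)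
  rw [h2, h2]
  exact hs _ _

/-- The divergence of `hypField`. The terms other than `P g / ρ` are `m² g / ρ + 4 s ∂ₛ²(g / ρ)`. -/
theorem sum_hypFieldDeriv (m : ℝ) (g : Smooth) {s : ℝ} (hs : 0 < s) (y : Fin 3 → ℝ) :
    ∑ i, hypFieldDeriv g s i y = hypFun 1 (KG m g) s y + m ^ 2 * hypFun 1 g s y
      + s * hypFun 3 (partialD 0 (partialD 0 g)) s y - 3 * s * hypFun 4 (partialD 0 g) s y
      + 3 * s * hypFun 5 g s y := by
  have hρ := rho_pos hs y
  have hs' : s = rho s y ^ 2 - (y 0 ^ 2 + y 1 ^ 2 + y 2 ^ 2) := by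
    rw [rho_sq hs.le]; unfold nsq; ring
  have e0 : (0 : Fin 3).succ = 1 := rfl
  have e1 : (1 : Fin 3).succ = 2 := rfl
  have e2 : (2 : Fin 3).succ = 3 := rfl
  simp only [Fin.sum_univ_three, hypFieldDeriv, hypFun, e0, e1, e2, KG_apply,
    partialD_comm 1 0, partialD_comm 2 0, partialD_comm 3 0]
  generalize hrr : rho s y = r at *
  have hs2 : ∀ a : ℝ, s * a = (r ^ 2 - (y 0 ^ 2 + y 1 ^ 2 + y 2 ^ 2)) * a := fun a => by rw [← hs']
  rw [mul_assoc 3 s, mul_assoc 3 s, hs2, hs2, hs2]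
  field_simp
  ring

/-- The mean of `P g` over a hyperboloid: up to the mass term, this is the radial part
`-4 s ∂ₛ²` of the wave operator in hyperbolic coordinates. -/
theorem hypInt_KG (m : ℝ) (hg : tsupport g ⊆ Metric.closedBall 0 R) {s : ℝ} (hs : 0 < s) :
    hypInt 1 (KG m g) s = -m ^ 2 * hypInt 1 g s
      - s * hypInt 3 (partialD 0 (partialD 0 g)) s + 3 * s * hypInt 4 (partialD 0 g) s
      - 3 * s * hypInt 5 g s := by
  have hV : ∀ i, Integrable (hypFieldDeriv g s i) ∧ ∫ y, hypFieldDeriv g s i y = 0 := by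
    intro i
    refine integral_eq_zero_of_hasDerivAt_line (V := hypField g s i) ?_ ?_ i
      (hasDerivAt_hypField g hs i)
    · exact ((contDiff_hypFun 1 _ hs).sub ((contDiff_apply ℝ ℝ i).mul (contDiff_hypFun 2 _ hs))).add
        ((contDiff_apply ℝ ℝ i).mul (contDiff_hypFun 3 _ hs))
    · exact ((hasCompactSupport_hypFun ((tsupport_partialD _ _).trans hg) 1 s).sub
        (hasCompactSupport_hypFun ((tsupport_partialD _ _).trans hg) 2 s).mul_left).add
        (hasCompactSupport_hypFun hg 3 s).mul_left
  have h1 : ∫ y, ∑ i, hypFieldDeriv g s i y = 0 := by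
    rw [integral_finsetSum _ fun i _ => (hV i).1]
    exact Finset.sum_eq_zero fun i _ => (hV i).2
  have hg0 := (tsupport_partialD 0 g).trans hg
  have i1 := integrable_hypFun ((tsupport_KG m g).trans hg) 1 hs
  have i2 := (integrable_hypFun hg 1 hs).const_mul (m ^ 2)
  have i3 := (integrable_hypFun ((tsupport_partialD 0 _).trans hg0) 3 hs).const_mul s
  have i4 := (integrable_hypFun hg0 4 hs).const_mul (3 * s)
  have i5 := (integrable_hypFun hg 5 hs).const_mul (3 * s)
  simp only [sum_hypFieldDeriv m g hs] at h1
  have h2 := integral_add' (((i1.add i2).add i3).sub i4) i5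
  rw [integral_sub' ((i1.add i2).add i3) i4, integral_add' (i1.add i2) i3, integral_add' i1 i2,
    integral_const_mul, integral_const_mul, integral_const_mul, integral_const_mul] at h2
  have h3 := h2.symm.trans h1
  unfold hypInt
  linarith

end

noncomputable section

/-! ### The limit of the hyperboloid integrals at the light cone -/

variable {R : ℝ} {φ g : Smooth}

/-- The scaling behaviour of the hyperboloids. -/
theorem rho_smul {s : ℝ} (hs : 0 ≤ s) (w : Fin 3 → ℝ) : rho s (√s • w) = √s * rho 1 w := by
  rw [rho, rho, ← Real.sqrt_mul hs]
  congr 1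
  have h : √s ^ 2 = s := Real.sq_sqrt hs
  simp only [nsq, Pi.smul_apply, smul_eq_mul, mul_pow, h]
  ring

theorem one_add_norm_le (w : Fin 3 → ℝ) : 1 + ‖w‖ ≤ 2 * rho 1 w := by
  have h1 : 1 ≤ rho 1 w := Real.one_le_sqrt.2 (by linarith [nsq_nonneg w])
  have h2 : ‖w‖ ≤ rho 1 w := by
    refine (pi_norm_le_iff_of_nonneg (by linarith)).2 fun i => ?_
    refine Real.abs_le_sqrt ?_
    unfold nsq
    fin_cases i <;> simp <;> nlinarith [sq_nonneg (w 0), sq_nonneg (w 1), sq_nonneg (w 2)]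
  linarith

theorem one_le_rho_one (w : Fin 3 → ℝ) : 1 ≤ rho 1 w :=
  Real.one_le_sqrt.2 (by linarith [nsq_nonneg w])

theorem continuous_rho_right (s : ℝ) : Continuous (rho s) :=
  continuous_rho.comp (Continuous.prodMk_right s)

theorem integrable_inv_rho_one {b : ℕ} (hb : 4 ≤ b) :
    Integrable fun w : Fin 3 → ℝ => 1 / rho 1 w ^ b := by
  have h : Integrable fun w : Fin 3 → ℝ => 16 * (1 + ‖w‖) ^ (-(4 : ℝ)) :=
    (integrable_one_add_norm (by simp; norm_num)).const_mul 16
  refine h.mono' ?_ (Filter.Eventually.of_forall fun w => ?_)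
  · exact (continuous_const.div ((continuous_rho_right 1).pow b) fun w =>
      (pow_pos (rho_pos one_pos w) b).ne').aestronglyMeasurable
  · have h1 := one_le_rho_one w
    have h2 := one_add_norm_le w
    have h3 : 0 < 1 + ‖w‖ := by positivity
    rw [Real.norm_of_nonneg (by positivity), Real.rpow_neg h3.le]
    norm_cast
    have h4 : (1 + ‖w‖) ^ 4 ≤ 16 * rho 1 w ^ b := by
      calc (1 + ‖w‖) ^ 4 ≤ (2 * rho 1 w) ^ 4 := by gcongr
        _ = 16 * rho 1 w ^ 4 := by ring
        _ ≤ 16 * rho 1 w ^ b := by gcongr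
    rw [div_le_iff₀ (by positivity)]
    have : 16 * ((1 + ‖w‖) ^ 4)⁻¹ * rho 1 w ^ b = 16 * rho 1 w ^ b / (1 + ‖w‖) ^ 4 := by ring
    rw [this, le_div_iff₀ (by positivity), one_mul]
    exact h4

/-- The substitution `y = √s w`. -/
theorem integral_comp_sqrt_smul (f : (Fin 3 → ℝ) → ℝ) {s : ℝ} (hs : 0 < s) :
    ∫ y, f y = √s ^ 3 * ∫ w, f (√s • w) := by
  rw [Measure.integral_comp_smul]
  have : 0 < √s := Real.sqrt_pos.2 hs
  simp only [Module.finrank_fintype_fun_eq_card, Fintype.card_fin, smul_eq_mul]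
  rw [abs_of_pos (by positivity)]
  field_simp

theorem exists_bound (φ : Smooth) (hφ : tsupport φ ⊆ Metric.closedBall 0 R) :
    ∃ C, 0 ≤ C ∧ ∀ p, |φ p| ≤ C := by
  have hc : HasCompactSupport φ :=
    (isCompact_closedBall 0 R).of_isClosed_subset (isClosed_tsupport _) hφ
  obtain ⟨C, hC⟩ := hc.exists_bound_of_continuous φ.continuous
  exact ⟨C, (norm_nonneg _).trans (hC 0), hC⟩

/-- For `b ≤ 4` the integrals `hypInt b φ s` are `O(s^(-1/2))` at the light cone. -/
theorem tendsto_mul_hypInt (hφ : tsupport φ ⊆ Metric.closedBall 0 R) {b : ℕ} (hb : b ≤ 4) :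
    Filter.Tendsto (fun s => s * hypInt b φ s) (nhdsWithin 0 (Ioi 0)) (nhds 0) := by
  obtain ⟨C, hC0, hC⟩ := exists_bound φ hφ
  set D := C * |R| ^ (4 - b) * ∫ w : Fin 3 → ℝ, 1 / rho 1 w ^ 4
  have key : ∀ s : ℝ, 0 < s → |s * hypInt b φ s| ≤ √s * D := by
    intro s hs
    have hq : 0 < √s := Real.sqrt_pos.2 hs
    have hss : √s * √s = s := Real.mul_self_sqrt hs.le
    -- on the support `ρ ≤ R`, so that `1 / ρᵇ ≤ R^(4 - b) / ρ⁴`, which is integrable on `ℝ³`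
    have h1 : |hypInt b φ s| ≤ ∫ y, C * |R| ^ (4 - b) * (1 / rho s y ^ 4) := by
      refine (abs_integral_le_integral_abs).trans (integral_mono_of_nonneg
        (Filter.Eventually.of_forall fun _ => abs_nonneg _) ?_
        (Filter.Eventually.of_forall fun y => ?_))
      · have h2 : Integrable fun y : Fin 3 → ℝ => 1 / rho s y ^ 4 := by
          rw [← integrable_comp_smul_iff volume _ hq.ne']
          refine ((integrable_inv_rho_one le_rfl).const_mul (1 / √s ^ 4)).congr
            (Filter.Eventually.of_forall fun w => ?_)
          simp only [rho_smul hs.le, mul_pow]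
          have := rho_pos one_pos w
          field_simp
        exact h2.const_mul _
      · have hr := rho_pos hs y
        simp only [hypFun]
        by_cases hR : R < rho s y
        · rw [hyp_eq_zero_of_rho hφ hR]; simp; positivity
        · rw [not_lt] at hR
          have hR' : rho s y ≤ |R| := hR.trans (le_abs_self R)
          rw [abs_div, abs_of_pos (pow_pos hr b), mul_one_div, div_le_div_iff₀ (by positivity)
            (by positivity)]
          have h4 : rho s y ^ 4 = rho s y ^ (4 - b) * rho s y ^ b := by
            rw [← pow_add]; congr 1; omega
          calc |φ (hyp s y)| * rho s y ^ 4
              = |φ (hyp s y)| * rho s y ^ (4 - b) * rho s y ^ b := by rw [h4]; ring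
            _ ≤ C * |R| ^ (4 - b) * rho s y ^ b := by
              gcongr
              exact hC _
    rw [integral_const_mul, integral_comp_sqrt_smul _ hs] at h1
    have h2 : ∫ w : Fin 3 → ℝ, 1 / rho s (√s • w) ^ 4
        = 1 / √s ^ 4 * ∫ w : Fin 3 → ℝ, 1 / rho 1 w ^ 4 := by
      rw [← integral_const_mul]
      refine integral_congr_ae (Filter.Eventually.of_forall fun w => ?_)
      simp only [rho_smul hs.le, mul_pow]
      have := rho_pos one_pos w
      field_simp
    rw [h2] at h1
    rw [abs_mul, abs_of_pos hs]
    calc s * |hypInt b φ s| ≤ s * _ := mul_le_mul_of_nonneg_left h1 hs.le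
      _ = (√s * √s) * (C * |R| ^ (4 - b) * (√s ^ 3 * (1 / √s ^ 4 *
            ∫ w : Fin 3 → ℝ, 1 / rho 1 w ^ 4))) := by rw [hss]
      _ = √s * D := by simp only [D]; field_simp
  refine squeeze_zero_norm' (a := fun s => √s * D) ?_ ?_
  · filter_upwards [self_mem_nhdsWithin] with s hs using key s hs
  · have : Filter.Tendsto (fun s => √s * D) (nhds 0) (nhds (√0 * D)) :=
      (Real.continuous_sqrt.mul continuous_const).tendsto 0
    rw [Real.sqrt_zero, zero_mul] at this
    exact this.mono_left nhdsWithin_le_nhds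

/-- The integral `∫ (1 + |w|²)^(-5/2) d³w`, which equals `4π/3`. -/
def coneConst : ℝ := ∫ w : Fin 3 → ℝ, 1 / rho 1 w ^ 5

theorem coneConst_pos : 0 < coneConst := by
  refine (integral_pos_iff_support_of_nonneg (fun w => ?_) (integrable_inv_rho_one (by norm_num))).2
    ?_
  · have := rho_pos one_pos w
    simp only [Pi.zero_apply]
    positivity
  · have : Function.support (fun w : Fin 3 → ℝ => 1 / rho 1 w ^ 5) = univ := by
      ext w
      have := rho_pos one_pos w
      simp [this.ne']
    rw [this]
    simp

/-- The value at the apex of the light cone emerges in the limit. -/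
theorem tendsto_mul_hypInt_five (hφ : tsupport φ ⊆ Metric.closedBall 0 R) :
    Filter.Tendsto (fun s => s * hypInt 5 φ s) (nhdsWithin 0 (Ioi 0)) (nhds (φ 0 * coneConst)) := by
  obtain ⟨C, hC0, hC⟩ := exists_bound φ hφ
  have h1 : ∀ s : ℝ, 0 < s → s * hypInt 5 φ s = ∫ w, φ (√s • hyp 1 w) * (1 / rho 1 w ^ 5) := by
    intro s hs
    have hq : 0 < √s := Real.sqrt_pos.2 hs
    have hss : √s * √s = s := Real.mul_self_sqrt hs.le
    rw [hypInt, integral_comp_sqrt_smul _ hs, ← mul_assoc, ← integral_const_mul]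
    refine integral_congr_ae (Filter.Eventually.of_forall fun w => ?_)
    have h2 : hyp s (√s • w) = √s • hyp 1 w := by
      ext i
      refine Fin.cases ?_ (fun j => ?_) i
      · exact rho_smul hs.le w
      · rfl
    simp only [hypFun, h2, rho_smul hs.le]
    nth_rewrite 1 [← hss]
    have := rho_pos one_pos w
    field_simp
  have h3 : Filter.Tendsto (fun s => ∫ w, φ (√s • hyp 1 w) * (1 / rho 1 w ^ 5))
      (nhdsWithin 0 (Ioi 0)) (nhds (∫ w : Fin 3 → ℝ, φ 0 * (1 / rho 1 w ^ 5))) := by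
    refine tendsto_integral_filter_of_dominated_convergence
      (fun w => C * (1 / rho 1 w ^ 5)) ?_ ?_ ((integrable_inv_rho_one (by norm_num)).const_mul _) ?_
    · refine Filter.Eventually.of_forall fun s => Continuous.aestronglyMeasurable ?_
      refine (φ.continuous.comp ((continuous_hyp.comp (Continuous.prodMk_right (1 : ℝ))).const_smul
        (√s))).mul ?_
      exact continuous_const.div ((continuous_rho_right 1).pow 5) fun w =>
        (pow_pos (rho_pos one_pos w) 5).ne'
    · refine Filter.Eventually.of_forall fun s => Filter.Eventually.of_forall fun w => ?_
      have := rho_pos one_pos w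
      rw [norm_mul, Real.norm_of_nonneg (show 0 ≤ 1 / rho 1 w ^ 5 by positivity)]
      gcongr
      exact hC _
    · refine Filter.Eventually.of_forall fun w => ?_
      refine Filter.Tendsto.mul_const _ ?_
      have h4 : Continuous fun s : ℝ => φ (√s • hyp 1 w) :=
        φ.continuous.comp (Real.continuous_sqrt.smul continuous_const)
      have h5 := h4.tendsto 0
      simp only [Real.sqrt_zero, zero_smul] at h5
      exact h5.mono_left nhdsWithin_le_nhds
  rw [integral_const_mul] at h3
  refine h3.congr' ?_
  filter_upwards [self_mem_nhdsWithin] with s hs using (h1 s hs).symm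

end

noncomputable section

/-! ### The fundamental identity -/

variable {R ε S : ℝ} {φ g h : Smooth} {f f₁ f₂ : ℝ → ℝ}

/-- Lebesgue measure on `ℝ³ × (ε, S]`, for integrals over a family of hyperboloids. -/
def slabMeasure (ε S : ℝ) : Measure ((Fin 3 → ℝ) × ℝ) :=
  (volume : Measure (Fin 3 → ℝ)).prod (volume.restrict (Ioc ε S))

/-- The integral of `f(s) φ / ρᵇ` over the hyperboloids with parameter `s ∈ (ε, S]`. -/
def slabInt (ε S : ℝ) (b : ℕ) (φ : Smooth) (f : ℝ → ℝ) : ℝ :=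
  ∫ x, f x.2 * hypFun b φ x.2 x.1 ∂slabMeasure ε S

theorem continuousOn_hypFun (b : ℕ) (φ : Smooth) :
    ContinuousOn (fun x : (Fin 3 → ℝ) × ℝ => hypFun b φ x.2 x.1) {x | 0 < x.2} := by
  refine ContinuousOn.div ?_ ?_ fun x hx => (pow_pos (rho_pos hx x.1) b).ne'
  · exact (φ.continuous.comp (continuous_hyp.comp continuous_swap)).continuousOn
  · exact ((continuous_rho.comp continuous_swap).pow b).continuousOn

theorem continuousAt_hypFun (b : ℕ) (φ : Smooth) {s : ℝ} (hs : 0 < s) (y : Fin 3 → ℝ) :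
    ContinuousAt (fun s => hypFun b φ s y) s :=
  (hasDerivAt_hyp φ hs y).continuousAt.div ((hasDerivAt_rho hs y).continuousAt.pow b)
    (pow_pos (rho_pos hs y) b).ne'

theorem integrable_slab (hφ : tsupport φ ⊆ Metric.closedBall 0 R) (b : ℕ) (hf : Continuous f)
    (hε : 0 < ε) :
    Integrable (fun x => f x.2 * hypFun b φ x.2 x.1) (slabMeasure ε S) := by
  have h1 : IntegrableOn (fun x : (Fin 3 → ℝ) × ℝ => f x.2 * hypFun b φ x.2 x.1)
      (Metric.closedBall 0 R ×ˢ Icc ε S) := by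
    refine ContinuousOn.integrableOn_compact ((isCompact_closedBall 0 R).prod isCompact_Icc) ?_
    exact ((hf.comp continuous_snd).continuousOn).mul ((continuousOn_hypFun b φ).mono
      fun x hx => hε.trans_le hx.2.1)
  have h2 : IntegrableOn (fun x : (Fin 3 → ℝ) × ℝ => f x.2 * hypFun b φ x.2 x.1)
      (univ ×ˢ Ioc ε S) := by
    refine h1.of_forall_sdiff_eq_zero (MeasurableSet.univ.prod measurableSet_Ioc) fun x hx => ?_
    have h3 : R < ‖x.1‖ := by
      by_contra hn
      exact hx.2 ⟨by simpa using hn, Ioc_subset_Icc_self hx.1.2⟩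
    rw [hypFun, hyp_eq_zero_of_norm hφ h3, zero_div, mul_zero]
  rw [IntegrableOn, Measure.volume_eq_prod, ← Measure.prod_restrict, Measure.restrict_univ] at h2
  exact h2

/-- The derivative of `φ / ρ` along the family of hyperboloids. -/
theorem hasDerivAt_hypFun_one (φ : Smooth) {s : ℝ} (hs : 0 < s) (y : Fin 3 → ℝ) :
    HasDerivAt (fun s => hypFun 1 φ s y)
      (hypFun 2 (partialD 0 φ) s y / 2 - hypFun 3 φ s y / 2) s := by
  have hρ := rho_pos hs y
  refine ((hasDerivAt_hyp φ hs y).div ((hasDerivAt_rho hs y).pow 1)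
    (pow_pos hρ 1).ne').congr_deriv ?_
  simp only [hypFun, Pi.pow_apply]
  field_simp
  simp

theorem hasDerivAt_hypFun_two (φ : Smooth) {s : ℝ} (hs : 0 < s) (y : Fin 3 → ℝ) :
    HasDerivAt (fun s => hypFun 2 φ s y)
      (hypFun 3 (partialD 0 φ) s y / 2 - hypFun 4 φ s y) s := by
  have hρ := rho_pos hs y
  refine ((hasDerivAt_hyp φ hs y).div ((hasDerivAt_rho hs y).pow 2)
    (pow_pos hρ 2).ne').congr_deriv ?_
  simp only [hypFun, Pi.pow_apply]
  field_simp
  push_cast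
  ring

theorem hasDerivAt_hypFun_three (φ : Smooth) {s : ℝ} (hs : 0 < s) (y : Fin 3 → ℝ) :
    HasDerivAt (fun s => hypFun 3 φ s y)
      (hypFun 4 (partialD 0 φ) s y / 2 - 3 / 2 * hypFun 5 φ s y) s := by
  have hρ := rho_pos hs y
  refine ((hasDerivAt_hyp φ hs y).div ((hasDerivAt_rho hs y).pow 3)
    (pow_pos hρ 3).ne').congr_deriv ?_
  simp only [hypFun, Pi.pow_apply]
  field_simp
  push_cast
  ring

/-- The integral over the family of hyperboloids can be computed with the radial part of `P`. -/
theorem slabInt_KG_eq (m : ℝ) (hh : tsupport h ⊆ Metric.closedBall 0 R) (hf : Continuous f)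
    (hε : 0 < ε) :
    slabInt ε S 1 (KG m h) f = ∫ x, f x.2 * (-m ^ 2 * hypFun 1 h x.2 x.1
      - x.2 * hypFun 3 (partialD 0 (partialD 0 h)) x.2 x.1
      + 3 * x.2 * hypFun 4 (partialD 0 h) x.2 x.1 - 3 * x.2 * hypFun 5 h x.2 x.1)
      ∂slabMeasure ε S := by
  have hh0 := (tsupport_partialD 0 h).trans hh
  have hh00 := (tsupport_partialD 0 _).trans hh0
  have hi1 := integrable_slab (S := S) ((tsupport_KG m h).trans hh) 1 hf hε
  have hi2 : Integrable (fun x : (Fin 3 → ℝ) × ℝ => f x.2 * (-m ^ 2 * hypFun 1 h x.2 x.1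
      - x.2 * hypFun 3 (partialD 0 (partialD 0 h)) x.2 x.1
      + 3 * x.2 * hypFun 4 (partialD 0 h) x.2 x.1 - 3 * x.2 * hypFun 5 h x.2 x.1))
      (slabMeasure ε S) := by
    refine (((integrable_slab (f := fun s => f s * -m ^ 2) hh 1 (by fun_prop) hε).sub
      (integrable_slab (f := fun s => f s * s) hh00 3 (by fun_prop) hε)).add
      (integrable_slab (f := fun s => f s * (3 * s)) hh0 4 (by fun_prop) hε)).sub
      (integrable_slab (f := fun s => f s * (3 * s)) hh 5 (by fun_prop) hε) |>.congr ?_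
    refine Filter.Eventually.of_forall fun x => ?_
    simp only [Pi.sub_apply, Pi.add_apply]
    ring
  rw [slabInt, slabMeasure, integral_prod_symm _ hi1, integral_prod_symm _ hi2]
  refine setIntegral_congr_fun measurableSet_Ioc fun s hs => ?_
  have hs0 : 0 < s := hε.trans hs.1
  simp only
  rw [integral_const_mul, integral_const_mul]
  congr 1
  have i1 := (integrable_hypFun hh 1 hs0).const_mul (-m ^ 2)
  have i3 := (integrable_hypFun hh00 3 hs0).const_mul s
  have i4 := (integrable_hypFun hh0 4 hs0).const_mul (3 * s)
  have i5 := (integrable_hypFun hh 5 hs0).const_mul (3 * s)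
  have e := integral_sub' ((i1.sub i3).add i4) i5
  rw [integral_add' (i1.sub i3) i4, integral_sub' i1 i3,
    integral_const_mul, integral_const_mul, integral_const_mul, integral_const_mul] at e
  exact (hypInt_KG m hh hs0).trans e.symm

theorem hasDerivAt_boundaryTerm {a b : ℝ → ℝ} {s f' f₁' a' b' : ℝ} (hf : HasDerivAt f f' s)
    (hf₁ : HasDerivAt f₁ f₁' s) (ha : HasDerivAt a a' s) (hb : HasDerivAt b b' s) :
    HasDerivAt (fun s => 4 * (f s + s * f₁ s) * a s - 2 * (s * f s) * b s)
      (4 * (f' + (f₁ s + s * f₁')) * a s + 4 * (f s + s * f₁ s) * a'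
        - (2 * (f s + s * f') * b s + 2 * (s * f s) * b')) s := by
  have d1 := ((hf.fun_add ((hasDerivAt_id' s).fun_mul hf₁)).const_mul 4).fun_mul ha
  have d2 := (((hasDerivAt_id' s).fun_mul hf).const_mul 2).fun_mul hb
  refine (d1.fun_sub d2).congr_deriv ?_
  ring

/-- Integration by parts in the parameter of the hyperboloids, over a fixed point of `ℝ³`. -/
theorem setIntegral_radialPart {y : Fin 3 → ℝ} (hh : tsupport h ⊆ Metric.closedBall 0 R)
    (hf : ∀ s, HasDerivAt f (f₁ s) s) (hf₁ : ∀ s, HasDerivAt f₁ (f₂ s) s) (hf₂ : Continuous f₂)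
    (hε : 0 < ε) (hεS : ε ≤ S) (hS : R ^ 2 < S) :
    ∫ s in Ioc ε S, (f s * (- s * hypFun 3 (partialD 0 (partialD 0 h)) s y
        + 3 * s * hypFun 4 (partialD 0 h) s y - 3 * s * hypFun 5 h s y)
        + (4 * s * f₂ s + 8 * f₁ s) * hypFun 1 h s y)
      = 2 * ε * f ε * (hypFun 2 (partialD 0 h) ε y - hypFun 3 h ε y)
        - 4 * (f ε + ε * f₁ ε) * hypFun 1 h ε y := by
  have hfc : Continuous f := continuous_iff_continuousAt.2 fun s => (hf s).continuousAt
  have hfc₁ : Continuous f₁ := continuous_iff_continuousAt.2 fun s => (hf₁ s).continuousAt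
  have hh0 := (tsupport_partialD 0 h).trans hh
  -- `B = 4 (s f)' a - 4 s f a'` for `a = h / ρ`, whose derivative is `4 (s f)'' a - 4 s f a''`
  set B : ℝ → ℝ := fun s => 4 * (f s + s * f₁ s) * hypFun 1 h s y
    - 2 * (s * f s) * (hypFun 2 (partialD 0 h) s y - hypFun 3 h s y) with hB
  have hBS : B S = 0 := by
    simp only [hB, hypFun, hyp_eq_zero_of_sq_lt hh hS, hyp_eq_zero_of_sq_lt hh0 hS]
    simp
  have hd : ∀ s ∈ uIcc ε S, HasDerivAt B (f s * (- s * hypFun 3 (partialD 0 (partialD 0 h)) s y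
        + 3 * s * hypFun 4 (partialD 0 h) s y - 3 * s * hypFun 5 h s y)
        + (4 * s * f₂ s + 8 * f₁ s) * hypFun 1 h s y) s := by
    intro s hs
    rw [uIcc_of_le hεS] at hs
    have hs0 : 0 < s := hε.trans_le hs.1
    have d := hasDerivAt_boundaryTerm (a := fun s => hypFun 1 h s y)
      (b := fun s => hypFun 2 (partialD 0 h) s y - hypFun 3 h s y) (hf s) (hf₁ s)
      (hasDerivAt_hypFun_one h hs0 y)
      ((hasDerivAt_hypFun_two (partialD 0 h) hs0 y).fun_sub (hasDerivAt_hypFun_three h hs0 y))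
    refine HasDerivAt.congr_deriv d ?_
    ring
  have hc : ∀ (b : ℕ) (ψ : Smooth), ContinuousOn (fun s => hypFun b ψ s y) (uIcc ε S) := by
    intro b ψ
    rw [uIcc_of_le hεS]
    exact fun s hs => (continuousAt_hypFun b ψ (hε.trans_le hs.1) y).continuousWithinAt
  have hi : ContinuousOn (fun s => f s * (- s * hypFun 3 (partialD 0 (partialD 0 h)) s y
        + 3 * s * hypFun 4 (partialD 0 h) s y - 3 * s * hypFun 5 h s y)
        + (4 * s * f₂ s + 8 * f₁ s) * hypFun 1 h s y) (uIcc ε S) :=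
    (hfc.continuousOn.mul (((continuousOn_id.neg.mul (hc 3 _)).add
      ((continuousOn_const.mul continuousOn_id).mul (hc 4 _))).sub
      ((continuousOn_const.mul continuousOn_id).mul (hc 5 _)))).add
      ((((continuous_const.mul continuous_id).mul hf₂).add
        (continuous_const.mul hfc₁)).continuousOn.mul (hc 1 _))
  rw [← intervalIntegral.integral_of_le hεS,
    intervalIntegral.integral_eq_sub_of_hasDerivAt hd hi.intervalIntegrable, hBS]
  simp only [hB]
  ring

/-- Integration by parts in the parameter of the hyperboloids. -/
theorem slabInt_KG (m : ℝ) (hh : tsupport h ⊆ Metric.closedBall 0 R)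
    (hf : ∀ s, HasDerivAt f (f₁ s) s) (hf₁ : ∀ s, HasDerivAt f₁ (f₂ s) s) (hf₂ : Continuous f₂)
    (hε : 0 < ε) (hεS : ε ≤ S) (hS : R ^ 2 < S) :
    slabInt ε S 1 (KG m h) f
      = 2 * ε * f ε * (hypInt 2 (partialD 0 h) ε - hypInt 3 h ε)
        - 4 * (f ε + ε * f₁ ε) * hypInt 1 h ε
        + slabInt ε S 1 h (fun s => -4 * s * f₂ s - 8 * f₁ s - m ^ 2 * f s) := by
  have hfc : Continuous f := continuous_iff_continuousAt.2 fun s => (hf s).continuousAt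
  have hfc₁ : Continuous f₁ := continuous_iff_continuousAt.2 fun s => (hf₁ s).continuousAt
  have hh0 := (tsupport_partialD 0 h).trans hh
  have hh00 := (tsupport_partialD 0 _).trans hh0
  have hi : Integrable (fun x : (Fin 3 → ℝ) × ℝ => f x.2 * (
      - x.2 * hypFun 3 (partialD 0 (partialD 0 h)) x.2 x.1
      + 3 * x.2 * hypFun 4 (partialD 0 h) x.2 x.1 - 3 * x.2 * hypFun 5 h x.2 x.1)
      + (4 * x.2 * f₂ x.2 + 8 * f₁ x.2) * hypFun 1 h x.2 x.1)
      (slabMeasure ε S) := by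
    refine ((((integrable_slab (f := fun s => f s * -s) hh00 3 (by fun_prop) hε)).add
      (integrable_slab (f := fun s => f s * (3 * s)) hh0 4 (by fun_prop) hε)).sub
      (integrable_slab (f := fun s => f s * (3 * s)) hh 5 (by fun_prop) hε)).add
      (integrable_slab (f := fun s => 4 * s * f₂ s + 8 * f₁ s) hh 1 (by fun_prop) hε) |>.congr ?_
    refine Filter.Eventually.of_forall fun x => ?_
    simp only [Pi.sub_apply, Pi.add_apply]
    ring
  have hi2 := integrable_slab (f := fun s => -4 * s * f₂ s - 8 * f₁ s - m ^ 2 * f s) (S := S) hh 1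
    (by fun_prop) hε
  have hbd : ∫ x, f x.2 * (
      - x.2 * hypFun 3 (partialD 0 (partialD 0 h)) x.2 x.1
      + 3 * x.2 * hypFun 4 (partialD 0 h) x.2 x.1 - 3 * x.2 * hypFun 5 h x.2 x.1)
      + (4 * x.2 * f₂ x.2 + 8 * f₁ x.2) * hypFun 1 h x.2 x.1 ∂slabMeasure ε S
      = 2 * ε * f ε * (hypInt 2 (partialD 0 h) ε - hypInt 3 h ε)
        - 4 * (f ε + ε * f₁ ε) * hypInt 1 h ε := by
    rw [slabMeasure, integral_prod _ hi]
    have hy := fun y => setIntegral_radialPart (y := y) hh hf hf₁ hf₂ hε hεS hS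
    simp only [hy]
    have i1 := integrable_hypFun hh 1 hε
    have i2 := integrable_hypFun hh0 2 hε
    have i3 := integrable_hypFun hh 3 hε
    have i23 : Integrable fun y => hypFun 2 (partialD 0 h) ε y - hypFun 3 h ε y := i2.sub i3
    rw [integral_sub (i23.const_mul _) (i1.const_mul _), integral_const_mul,
      integral_const_mul, integral_sub i2 i3]
    rfl
  rw [slabInt_KG_eq m hh hfc hε, ← hbd, slabInt, ← integral_add hi hi2]
  refine integral_congr_ae (Filter.Eventually.of_forall fun x => ?_)
  simp only
  ring

/-- The Lorentz square `t² - x² - y² - z²`. -/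
def lorentzSq (q : Mink) : ℝ := q 0 ^ 2 - spaceSq q

/-- The set of future timelike vectors whose Lorentz square exceeds `ε`. -/
def futureSet (ε : ℝ) : Set Mink := {q | 0 < q 0 ∧ ε < lorentzSq q}

theorem continuous_lorentzSq : Continuous lorentzSq := by
  unfold lorentzSq spaceSq; fun_prop

theorem isOpen_futureSet (ε : ℝ) : IsOpen (futureSet ε) :=
  (isOpen_lt continuous_const (continuous_apply 0)).inter
    (isOpen_lt continuous_const continuous_lorentzSq)

theorem lorentzSq_cons (t : ℝ) (y : Fin 3 → ℝ) : lorentzSq (Fin.cons t y) = t ^ 2 - nsq y := rfl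

theorem integrable_comp_lorentzSq_mul (hφ : tsupport φ ⊆ Metric.closedBall 0 R)
    (hf : Continuous f) : Integrable fun q => f (lorentzSq q) * φ q := by
  have hc : HasCompactSupport φ :=
    (isCompact_closedBall 0 R).of_isClosed_subset (isClosed_tsupport _) hφ
  exact ((hf.comp continuous_lorentzSq).mul φ.continuous).integrable_of_hasCompactSupport
    hc.mul_left

/-- The future light cone is foliated by hyperboloids. -/
theorem setIntegral_futureSet (hφ : tsupport φ ⊆ Metric.closedBall 0 R) (hf : Continuous f)
    (hε : 0 < ε) (hεS : ε ≤ S) (hS : R ^ 2 < S) :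
    ∫ q in futureSet ε, f (lorentzSq q) * φ q = slabInt ε S 1 φ f / 2 := by
  have hmp := (volume_preserving_piFinSuccAbove (fun _ : Fin 4 => ℝ) 0).symm
  set e := (MeasurableEquiv.piFinSuccAbove (fun _ : Fin 4 => ℝ) 0).symm with he
  have he' : ∀ x : ℝ × (Fin 3 → ℝ), e x = (Fin.cons x.1 x.2 : Mink) := fun x => by
    rw [he]
    simp [MeasurableEquiv.piFinSuccAbove, Fin.insertNthEquiv]
  set F : Mink → ℝ := (futureSet ε).indicator fun q => f (lorentzSq q) * φ q with hF
  have hFi : Integrable F :=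
    (integrable_comp_lorentzSq_mul hφ hf).indicator (isOpen_futureSet ε).measurableSet
  have hFe : Integrable (fun x => F (e x)) :=
    (hmp.integrable_comp_emb e.measurableEmbedding).2 hFi
  rw [← integral_indicator (isOpen_futureSet ε).measurableSet, ← hF,
    ← hmp.integral_comp e.measurableEmbedding F, Measure.volume_eq_prod, integral_prod_symm _ hFe,
    slabInt, slabMeasure, integral_prod _ (integrable_slab hφ 1 hf hε), ← integral_div]
  refine integral_congr_ae (Filter.Eventually.of_forall fun y => ?_)
  simp only [he']
  have hn := nsq_nonneg y
  set G : ℝ → ℝ := fun t => f (t ^ 2 - nsq y) * φ (Fin.cons t y) with hG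
  have hGc : Continuous G := by
    refine (hf.comp (by fun_prop)).mul (φ.continuous.comp (continuous_pi fun i => ?_))
    refine Fin.cases ?_ (fun j => ?_) i
    · exact continuous_id
    · exact continuous_const
  have h1 : (fun t => F (Fin.cons t y)) = (Ioi (rho ε y)).indicator G := by
    funext t
    by_cases ht : t ∈ Ioi (rho ε y)
    · have ht' : rho ε y < t := ht
      have h0 : 0 < t := (rho_pos hε y).trans ht'
      have h2 : nsq y + ε < t ^ 2 := by
        rw [← rho_sq hε.le]
        exact pow_lt_pow_left₀ ht' (rho_pos hε y).le (by norm_num)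
      have hm : (Fin.cons t y : Mink) ∈ futureSet ε :=
        ⟨h0, by rw [lorentzSq_cons]; linarith⟩
      rw [hF, indicator_of_mem hm, indicator_of_mem ht, lorentzSq_cons]
    · have hm : (Fin.cons t y : Mink) ∉ futureSet ε := by
        rintro ⟨h0, h2⟩
        rw [lorentzSq_cons] at h2
        have h0' : 0 < t := h0
        exact ht ((Real.sqrt_lt' h0').2 (by linarith))
      rw [hF, indicator_of_notMem hm, indicator_of_notMem ht]
  rw [h1, integral_indicator measurableSet_Ioi]
  have hle : rho ε y ≤ rho S y := Real.sqrt_le_sqrt (by linarith)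
  have h2 : ∫ t in Ioi (rho ε y), G t = ∫ t in Ioc (rho ε y) (rho S y), G t := by
    refine setIntegral_eq_of_subset_of_forall_sdiff_eq_zero measurableSet_Ioi
      (fun t ht => ht.1) fun t ht => ?_
    have ht1 : rho ε y < t := ht.1
    have ht2 : rho S y < t := not_le.1 fun hn => ht.2 ⟨ht.1, hn⟩
    have hz : φ (Fin.cons t y : Mink) = 0 := by
      refine image_eq_zero_of_notMem_tsupport fun hc => ?_
      have h3 := mem_closedBall_zero_iff.1 (hφ hc)
      have h4 : |t| ≤ ‖(Fin.cons t y : Mink)‖ := norm_le_pi_norm (Fin.cons t y : Mink) 0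
      have h5 : R < rho S y := Real.lt_sqrt_of_sq_lt (by linarith)
      linarith [le_abs_self t]
    simp only [hG, hz, mul_zero]
  rw [h2, ← intervalIntegral.integral_of_le hle, ← intervalIntegral.integral_of_le hεS,
    ← intervalIntegral.integral_comp_mul_deriv' (f := fun s => rho s y)
      (f' := fun s => 1 / (2 * rho s y)) (g := G) (a := ε) (b := S),
    ← intervalIntegral.integral_div]
  · refine intervalIntegral.integral_congr fun s hs => ?_
    rw [uIcc_of_le hεS] at hs
    have hs0 : 0 < s := hε.trans_le hs.1
    simp only [Function.comp, hG, rho_sq hs0.le, hypFun, pow_one, add_sub_cancel_left]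
    have := rho_pos hs0 y
    rw [show (Fin.cons (rho s y) y : Mink) = hyp s y from rfl]
    field_simp
  · intro s hs
    rw [uIcc_of_le hεS] at hs
    exact hasDerivAt_rho (hε.trans_le hs.1) y
  · rw [uIcc_of_le hεS]
    refine continuousOn_const.div (continuousOn_const.mul
      (continuous_rho.comp (Continuous.prodMk_left y)).continuousOn) fun s hs => ?_
    have := rho_pos (hε.trans_le hs.1) y
    positivity
  · exact hGc.continuousOn

/-- The function `s ↦ J₀(m √s)`. -/
def bessel (m : ℝ) : ℝ → ℝ := clifford (-(m ^ 2 / 4)) 0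

/-- The function `J₀(m √s)`, restricted to the interior of the future light cone, is a fundamental
solution of `P²` up to normalization. -/
theorem setIntegral_bessel_KG_KG (m : ℝ) (hg : g ∈ TestFn) :
    ∫ q in futureSet 0, bessel m (lorentzSq q) * KG m (KG m g) q = 6 * coneConst * g 0 := by
  obtain ⟨R, hR⟩ := (IsCompact.isBounded hg).subset_closedBall (0 : Mink)
  have hP := (tsupport_KG m g).trans hR
  have hPP := (tsupport_KG m _).trans hP
  have hg0 := (tsupport_partialD 0 g).trans hR
  have hg00 := (tsupport_partialD 0 _).trans hg0
  have hP0 := (tsupport_partialD 0 _).trans hP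
  set c : ℝ := -(m ^ 2 / 4) with hc
  have hm : m ^ 2 = -4 * c := by rw [hc]; ring
  set j : ℝ → ℝ := clifford c 0 with hj
  set j₁ : ℝ → ℝ := fun s => c * clifford c 1 s with hj₁
  set j₂ : ℝ → ℝ := fun s => c * (c * clifford c 2 s) with hj₂
  set j₃ : ℝ → ℝ := fun s => c * (c * (c * clifford c 3 s)) with hj₃
  have d0 : ∀ s, HasDerivAt j (j₁ s) s := fun s => hasDerivAt_clifford c 0 s
  have d1 : ∀ s, HasDerivAt j₁ (j₂ s) s := fun s => (hasDerivAt_clifford c 1 s).const_mul c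
  have d2 : ∀ s, HasDerivAt j₂ (j₃ s) s := fun s =>
    ((hasDerivAt_clifford c 2 s).const_mul c).const_mul c
  have cj : Continuous j := continuous_clifford c 0
  have cj₁ : Continuous j₁ := continuous_const.mul (continuous_clifford c 1)
  have cj₂ : Continuous j₂ := continuous_const.mul (continuous_const.mul (continuous_clifford c 2))
  have cj₃ : Continuous j₃ :=
    continuous_const.mul (continuous_const.mul (continuous_const.mul (continuous_clifford c 3)))
  have ode : ∀ s, s * j₂ s + j₁ s - c * j s = 0 := fun s => by
    have := clifford_recurrence c s
    simp only [hj₂, hj₁, hj, ← this]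
    ring
  -- differentiating Bessel's equation gives the equation of the derivative `j₁`
  have ode' : ∀ s, s * j₃ s + 2 * j₂ s - c * j₁ s = 0 := fun s => by
    have h1 := (((hasDerivAt_id s).mul (d2 s)).add (d1 s)).sub ((d0 s).const_mul c)
    have h2 : (id * j₂ + j₁ - fun s => c * j s) = fun _ => (0 : ℝ) := funext ode
    rw [h2] at h1
    have h3 := h1.unique (hasDerivAt_const s (0 : ℝ))
    simp only [id] at h3
    linarith
  -- the hyperboloids with parameter beyond `R ^ 2` do not meet the support of `g`
  set S := R ^ 2 + 1 with hS
  have hS' : R ^ 2 < S := by linarith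
  -- two integrations by parts leave boundary terms only; in all of them but the last a bounded
  -- factor multiplies `ε` times an integral of order `ε^(-1/2)`
  have key : ∀ ε : ℝ, 0 < ε → ε ≤ S → ∫ q in futureSet ε, j (lorentzSq q) * KG m (KG m g) q
      = j ε * (ε * hypInt 2 (partialD 0 (KG m g)) ε - ε * hypInt 3 (KG m g) ε)
        + 2 * (j ε + ε * j₁ ε) * (ε * hypInt 3 (partialD 0 (partialD 0 g)) ε
          - 3 * (ε * hypInt 4 (partialD 0 g) ε))
        + 2 * m ^ 2 * j₁ ε * (ε * hypInt 1 g ε)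
        - 4 * j₁ ε * (ε * hypInt 2 (partialD 0 g) ε - ε * hypInt 3 g ε)
        + 6 * (j ε + ε * j₁ ε) * (ε * hypInt 5 g ε) := by
    intro ε hε hεS
    have e1 := slabInt_KG m hP d0 d1 cj₂ hε hεS hS'
    have e2 := slabInt_KG m hR d1 d2 cj₃ hε hεS hS'
    have e3 : (fun s => -4 * s * j₂ s - 8 * j₁ s - m ^ 2 * j s) = fun s => -4 * j₁ s := by
      funext s
      have := ode s
      rw [hm]; linarith
    have e4 : (fun s => -4 * s * j₃ s - 8 * j₂ s - m ^ 2 * j₁ s) = fun _ => 0 := by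
      funext s
      have := ode' s
      rw [hm]; linarith
    have e5 : slabInt ε S 1 (KG m g) (fun s => -4 * j₁ s) = -4 * slabInt ε S 1 (KG m g) j₁ := by
      simp only [slabInt, mul_assoc, integral_const_mul]
    have e6 : slabInt ε S 1 g (fun _ => 0) = 0 := by simp [slabInt]
    rw [setIntegral_futureSet hPP cj hε hεS hS', e1, e3, e5, e2, e4, e6, hypInt_KG m hR hε]
    -- by Bessel's equation the coefficient of `hypInt 1 g ε` is of order `ε`
    have e7 := ode ε
    have e8 : ε * j₂ ε = c * j ε - j₁ ε := by linarith
    have e9 : (j₁ ε + ε * j₂ ε) = c * j ε := by linarith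
    rw [e9, hm]
    ring
  have hlim : Filter.Tendsto (fun ε => j ε * (ε * hypInt 2 (partialD 0 (KG m g)) ε
          - ε * hypInt 3 (KG m g) ε)
        + 2 * (j ε + ε * j₁ ε) * (ε * hypInt 3 (partialD 0 (partialD 0 g)) ε
          - 3 * (ε * hypInt 4 (partialD 0 g) ε))
        + 2 * m ^ 2 * j₁ ε * (ε * hypInt 1 g ε)
        - 4 * j₁ ε * (ε * hypInt 2 (partialD 0 g) ε - ε * hypInt 3 g ε)
        + 6 * (j ε + ε * j₁ ε) * (ε * hypInt 5 g ε)) (nhdsWithin 0 (Ioi 0))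
      (nhds (j 0 * (0 - 0) + 2 * (j 0 + 0 * j₁ 0) * (0 - 3 * 0) + 2 * m ^ 2 * j₁ 0 * 0
        - 4 * j₁ 0 * (0 - 0) + 6 * (j 0 + 0 * j₁ 0) * (g 0 * coneConst))) := by
    have t0 : Filter.Tendsto j (nhdsWithin 0 (Ioi 0)) (nhds (j 0)) :=
      (cj.tendsto 0).mono_left nhdsWithin_le_nhds
    have t1 : Filter.Tendsto j₁ (nhdsWithin 0 (Ioi 0)) (nhds (j₁ 0)) :=
      (cj₁.tendsto 0).mono_left nhdsWithin_le_nhds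
    have ti : Filter.Tendsto (fun s : ℝ => s) (nhdsWithin 0 (Ioi 0)) (nhds 0) :=
      nhdsWithin_le_nhds
    have tj := t0.add (ti.mul t1)
    exact ((((t0.mul ((tendsto_mul_hypInt hP0 (by norm_num)).sub
      (tendsto_mul_hypInt hP (by norm_num)))).add
      ((tj.const_mul 2).mul ((tendsto_mul_hypInt hg00 (by norm_num)).sub
        ((tendsto_mul_hypInt hg0 (by norm_num)).const_mul 3)))).add
      ((t1.const_mul _).mul (tendsto_mul_hypInt hR (by norm_num)))).sub
      ((t1.const_mul 4).mul ((tendsto_mul_hypInt hg0 (by norm_num)).sub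
        (tendsto_mul_hypInt hR (by norm_num))))).add
      ((tj.const_mul 6).mul (tendsto_mul_hypInt_five hR))
  have hj0 : j 0 = 1 := clifford_zero_zero c
  have hv : (j 0 * (0 - 0) + 2 * (j 0 + 0 * j₁ 0) * (0 - 3 * 0) + 2 * m ^ 2 * j₁ 0 * 0
        - 4 * j₁ 0 * (0 - 0) + 6 * (j 0 + 0 * j₁ 0) * (g 0 * coneConst))
        = 6 * coneConst * g 0 := by
    rw [hj0]; ring
  rw [hv] at hlim
  have hu : Filter.Tendsto (fun n : ℕ => 1 / ((n : ℝ) + 1)) Filter.atTop (nhdsWithin 0 (Ioi 0)) :=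
    tendsto_nhdsWithin_iff.2 ⟨tendsto_one_div_add_atTop_nhds_zero_nat,
      Filter.Eventually.of_forall fun n => by
        show (0 : ℝ) < 1 / ((n : ℝ) + 1)
        positivity⟩
  have hl1 := hlim.comp hu
  have hun : (⋃ n : ℕ, futureSet (1 / ((n : ℝ) + 1))) = futureSet 0 := by
    ext q
    simp only [mem_iUnion]
    constructor
    · rintro ⟨n, h1, h2⟩
      exact ⟨h1, lt_trans (by positivity) h2⟩
    · rintro ⟨h1, h2⟩
      obtain ⟨n, hn⟩ := exists_nat_one_div_lt h2
      exact ⟨n, h1, hn⟩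
  have hl2 := tendsto_setIntegral_of_monotone (μ := volume)
    (s := fun n : ℕ => futureSet (1 / ((n : ℝ) + 1)))
    (f := fun q => j (lorentzSq q) * KG m (KG m g) q)
    (fun n => (isOpen_futureSet _).measurableSet)
    (fun n k hnk q hq => ⟨hq.1, lt_of_le_of_lt (one_div_le_one_div_of_le (by positivity)
      (by simpa using hnk)) hq.2⟩)
    (integrable_comp_lorentzSq_mul hPP cj).integrableOn
  rw [hun] at hl2
  refine tendsto_nhds_unique hl2 (hl1.congr fun n => ?_)
  refine (key _ (by positivity) ?_).symm
  rw [hS]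
  have : 1 / ((n : ℝ) + 1) ≤ 1 := by
    rw [div_le_one (by positivity)]; linarith [n.cast_nonneg (α := ℝ)]
  nlinarith [sq_nonneg R]

end

noncomputable section

/-! ### Existence of the Green operators -/

variable {τ : ℝ}

/-- The fundamental solution of `P²` supported in the causal future (`τ = 1`) or in the causal past
(`τ = -1`) of the origin. -/
def greenKernel (m τ : ℝ) : Mink → ℝ :=
  {q | τ • q ∈ futureSet 0}.indicator fun q => bessel m (lorentzSq (τ • q)) / (6 * coneConst)

/-- Convolution with the fundamental solution of `P²`. -/
def greenConv (m τ : ℝ) (φ : Mink → ℝ) : Mink → ℝ :=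
  convolution (greenKernel m τ) φ (ContinuousLinearMap.mul ℝ ℝ) volume

theorem greenConv_apply (m τ : ℝ) (φ : Mink → ℝ) (p : Mink) :
    greenConv m τ φ p = ∫ q, greenKernel m τ q * φ (p - q) := rfl

theorem locallyIntegrable_greenKernel (m τ : ℝ) : LocallyIntegrable (greenKernel m τ) := by
  have hc : Continuous fun q : Mink => τ • q := continuous_const_smul τ
  refine LocallyIntegrable.indicator (Continuous.locallyIntegrable ?_)
    ((isOpen_futureSet 0).preimage hc).measurableSet
  exact ((continuous_clifford _ 0).comp (continuous_lorentzSq.comp hc)).div_const _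

theorem inCone_of_greenKernel_ne_zero (hτ : τ = 1 ∨ τ = -1) {m : ℝ} {q : Mink}
    (h : greenKernel m τ q ≠ 0) : InCone τ q := by
  have h1 : τ • q ∈ futureSet 0 := by
    by_contra hn
    exact h (indicator_of_notMem (s := {q | τ • q ∈ futureSet 0}) hn _)
  obtain ⟨h2, h3⟩ := h1
  refine ⟨h2.le, ?_⟩
  rcases hτ with rfl | rfl <;> simp [lorentzSq, spaceSq] at h3 ⊢ <;> linarith

theorem greenConv_congr (hτ : τ = 1 ∨ τ = -1) {m : ℝ} {φ ψ : Mink → ℝ} {p : Mink}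
    (h : ∀ q ∈ causalSet (-τ) {p}, φ q = ψ q) : greenConv m τ φ p = greenConv m τ ψ p := by
  rw [greenConv_apply, greenConv_apply]
  refine integral_congr_ae (Filter.Eventually.of_forall fun q => ?_)
  by_cases hq : greenKernel m τ q = 0
  · simp [hq]
  · have h1 : p - q ∈ causalSet (-τ) {p} := by
      rw [mem_causalSet_singleton, sub_sub_cancel_left, inCone_neg, neg_neg]
      exact inCone_of_greenKernel_ne_zero hτ hq
    simp only [h _ h1]

theorem integrable_greenConv (m τ : ℝ) {φ : Smooth} (hφ : φ ∈ TestFn) (p : Mink) :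
    Integrable fun q => greenKernel m τ q * φ (p - q) :=
  HasCompactSupport.convolutionExists_right (ContinuousLinearMap.mul ℝ ℝ) hφ
    (locallyIntegrable_greenKernel m τ) φ.continuous p

/-- The convolution of the fundamental solution with a test function is smooth. -/
def greenTest (m τ : ℝ) (φ : Smooth) (hφ : φ ∈ TestFn) : Smooth :=
  ⟨greenConv m τ φ, HasCompactSupport.contDiff_convolution_right _ hφ
    (locallyIntegrable_greenKernel m τ) φ.smooth⟩

theorem partialD_greenTest (m τ : ℝ) (i : Fin 4) {φ : Smooth} (hφ : φ ∈ TestFn) :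
    partialD i (greenTest m τ φ hφ) = greenTest m τ (partialD i φ) (partialD_mem_testFn i hφ) := by
  ext p
  have h1 := HasCompactSupport.hasFDerivAt_convolution_right (ContinuousLinearMap.mul ℝ ℝ)
    (show HasCompactSupport φ from hφ) (locallyIntegrable_greenKernel m τ)
    (φ.smooth.of_le (by simp)) p
  rw [partialD_apply]
  have h2 : fderiv ℝ (greenTest m τ φ hφ) p = _ := h1.fderiv
  rw [h2, convolution_precompR_apply _ (locallyIntegrable_greenKernel m τ)
    ((show HasCompactSupport φ from hφ).fderiv (𝕜 := ℝ))
    ((φ.smooth.continuous_fderiv (by simp)))]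
  rfl

theorem KG_greenTest (m τ : ℝ) {φ : Smooth} (hφ : φ ∈ TestFn) :
    KG m (greenTest m τ φ hφ) = greenTest m τ (KG m φ) (KG_mem_testFn m hφ) := by
  ext p
  have hi : ∀ i, Integrable fun q => greenKernel m τ q * partialD i (partialD i φ) (p - q) :=
    fun i => integrable_greenConv m τ (partialD_mem_testFn i (partialD_mem_testFn i hφ)) p
  have h0 := (integrable_greenConv m τ hφ p).const_mul (m ^ 2)
  simp only [KG_apply, partialD_greenTest]
  have e := integral_sub' ((((hi 0).neg.add (hi 1)).add (hi 2)).add (hi 3)) h0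
  rw [integral_add' (((hi 0).neg.add (hi 1)).add (hi 2)) (hi 3),
    integral_add' ((hi 0).neg.add (hi 1)) (hi 2), integral_add' (hi 0).neg (hi 1), integral_neg',
    integral_const_mul] at e
  refine e.symm.trans ?_
  refine integral_congr_ae (Filter.Eventually.of_forall fun q => ?_)
  simp only [Pi.sub_apply, Pi.add_apply, Pi.neg_apply, KG_apply, ContinuousLinearMap.mul_apply']
  ring

/-- The function `q ↦ φ (p - τ q)`. -/
def pullAffine (τ : ℝ) (p : Mink) (φ : Smooth) : Smooth :=
  ⟨fun q => φ (p - τ • q), φ.smooth.comp (contDiff_const.sub (contDiff_id.const_smul τ))⟩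

theorem partialD_pullAffine (τ : ℝ) (p : Mink) (φ : Smooth) (i : Fin 4) :
    partialD i (pullAffine τ p φ) = (-τ) • pullAffine τ p (partialD i φ) := by
  ext q
  have h1 : HasFDerivAt (fun q : Mink => p - τ • q) (-(τ • ContinuousLinearMap.id ℝ Mink)) q :=
    ((hasFDerivAt_id q).const_smul τ).const_sub p
  have h2 := ((φ.differentiableAt (p - τ • q)).hasFDerivAt.comp q h1).fderiv
  rw [partialD_apply]
  have h3 : fderiv ℝ (pullAffine τ p φ) q = _ := h2
  rw [h3]
  simp [pullAffine, partialD_apply]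

theorem KG_pullAffine (hτ : τ = 1 ∨ τ = -1) (m : ℝ) (p : Mink) (φ : Smooth) :
    KG m (pullAffine τ p φ) = pullAffine τ p (KG m φ) := by
  have ht : τ * τ = 1 := by rcases hτ with rfl | rfl <;> norm_num
  ext q
  rw [KG_apply]
  simp only [partialD_pullAffine, map_smul, smul_smul, neg_mul_neg, ht, one_smul]
  simp only [pullAffine, KG_apply]

theorem pullAffine_mem_testFn (hτ : τ = 1 ∨ τ = -1) (p : Mink) {φ : Smooth} (hφ : φ ∈ TestFn) :
    pullAffine τ p φ ∈ TestFn := by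
  have ht : τ * τ = 1 := by rcases hτ with rfl | rfl <;> norm_num
  have hc : Continuous fun r : Mink => τ • (p - r) := by fun_prop
  refine HasCompactSupport.intro (IsCompact.image hφ hc) fun q hq => ?_
  refine image_eq_zero_of_notMem_tsupport (f := φ) fun hn => hq ⟨_, hn, ?_⟩
  simp [smul_smul, ht]

/-- Convolution with the kernel inverts `P²` on test functions. -/
theorem greenConv_KG_KG (hτ : τ = 1 ∨ τ = -1) (m : ℝ) {φ : Smooth} (hφ : φ ∈ TestFn) (p : Mink) :
    greenConv m τ (KG m (KG m φ)) p = φ p := by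
  have ht : τ * τ = 1 := by rcases hτ with rfl | rfl <;> norm_num
  have hc := coneConst_pos
  have h1 := setIntegral_bessel_KG_KG m (pullAffine_mem_testFn hτ p hφ)
  rw [KG_pullAffine hτ, KG_pullAffine hτ] at h1
  have h2 : pullAffine τ p φ 0 = φ p := by simp [pullAffine]
  rw [h2, ← integral_indicator (isOpen_futureSet 0).measurableSet] at h1
  set f : Mink → ℝ := fun q => (futureSet 0).indicator
    (fun q => bessel m (lorentzSq q) * pullAffine τ p (KG m (KG m φ)) q) q with hf
  have h3 : ∫ q, f q = ∫ q, f (τ • q) := by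
    rcases hτ with rfl | rfl
    · simp
    · simpa using (integral_neg_eq_self f volume).symm
  have h4 : ∀ q, greenKernel m τ q * KG m (KG m φ) (p - q) = f (τ • q) / (6 * coneConst) := by
    intro q
    by_cases hq : τ • q ∈ futureSet 0
    · simp only [hf, greenKernel]
      rw [indicator_of_mem hq, indicator_of_mem (s := {q | τ • q ∈ futureSet 0}) hq]
      simp only [pullAffine, smul_smul, ht, one_smul]
      ring
    · simp only [hf, greenKernel]
      rw [indicator_of_notMem hq, indicator_of_notMem (s := {q | τ • q ∈ futureSet 0}) hq]
      simp
  rw [greenConv_apply]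
  simp only [h4]
  rw [integral_div, ← h3, h1]
  field_simp

theorem exists_smooth_eq_one_near {K : Set Mink} (hK : IsCompact K) :
    ∃ χ : Smooth, χ ∈ TestFn ∧ ∀ p ∈ K, ∀ᶠ q in nhds p, χ q = 1 := by
  obtain ⟨L, hL, hKL⟩ := exists_compact_superset hK
  obtain ⟨f, h1, h0, -⟩ := exists_contMDiffMap_one_nhds_of_subset_interior
    (modelWithCornersSelf ℝ Mink) (n := ⊤) hK.isClosed hKL
  refine ⟨⟨f, f.contMDiff.contDiff⟩, HasCompactSupport.intro hL h0, fun p hp => ?_⟩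
  exact Filter.eventually_iff_exists_mem.2 ⟨_, mem_nhdsSet_iff_forall.1 h1 p hp, fun q hq => hq⟩

/-- Near a point, only the part of a past compact function in a compact set matters for the
retarded solution. -/
theorem exists_testFn_eq_near (hτ : τ = 1 ∨ τ = -1) {α : Smooth} (hα : ConeCompact τ (tsupport α))
    (p₀ : Mink) : ∃ β ∈ TestFn, ∀ᶠ p in nhds p₀, ∀ q ∈ causalSet (-τ) {p}, ⇑β =ᶠ[nhds q] α := by
  have hτ' : -τ = 1 ∨ -τ = -1 := by rcases hτ with rfl | rfl <;> simp
  obtain ⟨χ, hχ, h1⟩ := exists_smooth_eq_one_near (hα (p₀ + timeVec τ))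
  refine ⟨⟨fun p => χ p * α p, χ.smooth.mul α.smooth⟩, HasCompactSupport.mul_right hχ, ?_⟩
  filter_upwards [eventually_mem_causalSet hτ p₀] with p hp q hq
  by_cases hs : q ∈ tsupport α
  · have h2 : q ∈ causalSet (-τ) {p₀ + timeVec τ} := by
      obtain ⟨p', hp', h⟩ := hq
      rw [mem_singleton_iff.1 hp'] at h
      exact causalSet_causalSet hτ' _ ⟨p, hp, h⟩
    filter_upwards [h1 q ⟨hs, h2⟩] with r hr
    simp [hr]
  · filter_upwards [notMem_tsupport_iff_eventuallyEq.1 hs] with r hr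
    have hr' : α r = 0 := hr
    simp [hr']

theorem greenConv_KG_eventuallyEq (hτ : τ = 1 ∨ τ = -1) (m : ℝ) {α : Smooth}
    (hα : ConeCompact τ (tsupport α)) (p₀ : Mink) :
    ∃ β, ∃ hβ : β ∈ TestFn, (∀ q ∈ causalSet (-τ) {p₀}, ⇑β =ᶠ[nhds q] α) ∧
      greenConv m τ (KG m α) =ᶠ[nhds p₀] greenTest m τ (KG m β) (KG_mem_testFn m hβ) := by
  obtain ⟨β, hβ, h⟩ := exists_testFn_eq_near hτ hα p₀
  refine ⟨β, hβ, h.self_of_nhds, ?_⟩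
  filter_upwards [h] with p hp
  exact greenConv_congr hτ fun q hq => (KG_congr m (hp q hq)).self_of_nhds.symm

theorem self_mem_causalSet (p : Mink) : p ∈ causalSet τ {p} := subset_causalSet _ rfl

/-- The Green operator `E^± α = K^± ⋆ P α`, where `K^±` is the fundamental solution of `P²`. -/
def greenSmooth (hτ : τ = 1 ∨ τ = -1) (m : ℝ) (α : Smooth) (hα : ConeCompact τ (tsupport α)) :
    Smooth :=
  ⟨greenConv m τ (KG m α), contDiff_iff_contDiffAt.2 fun p => by
    obtain ⟨β, hβ, -, h⟩ := greenConv_KG_eventuallyEq hτ m hα p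
    exact ((greenTest m τ (KG m β) (KG_mem_testFn m hβ)).smooth.contDiffAt).congr_of_eventuallyEq h⟩

theorem KG_greenSmooth (hτ : τ = 1 ∨ τ = -1) (m : ℝ) (α : Smooth)
    (hα : ConeCompact τ (tsupport α)) : KG m (greenSmooth hτ m α hα) = α := by
  ext p
  obtain ⟨β, hβ, h1, h2⟩ := greenConv_KG_eventuallyEq hτ m hα p
  have h3 : KG m (greenSmooth hτ m α hα) p = KG m (greenTest m τ (KG m β) (KG_mem_testFn m hβ)) p :=
    (KG_congr m (φ := greenSmooth hτ m α hα) h2).self_of_nhds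
  rw [h3, KG_greenTest]
  refine (greenConv_KG_KG hτ m hβ p).trans ?_
  exact (h1 p (self_mem_causalSet p)).self_of_nhds

theorem greenConv_KG_KG_of_coneCompact (hτ : τ = 1 ∨ τ = -1) (m : ℝ) (α : Smooth)
    (hα : ConeCompact τ (tsupport α)) (p : Mink) : greenConv m τ (KG m (KG m α)) p = α p := by
  obtain ⟨β, hβ, h1, -⟩ := greenConv_KG_eventuallyEq hτ m hα p
  rw [greenConv_congr hτ (ψ := KG m (KG m β)) fun q hq =>
    (KG_congr m (KG_congr m (h1 q hq))).self_of_nhds.symm, greenConv_KG_KG hτ m hβ]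
  exact (h1 p (self_mem_causalSet p)).self_of_nhds

theorem tsupport_greenSmooth (hτ : τ = 1 ∨ τ = -1) (m : ℝ) (α : Smooth)
    (hα : ConeCompact τ (tsupport α)) :
    tsupport (greenSmooth hτ m α hα) ⊆ causalSet τ (tsupport α) := by
  refine closure_minimal (fun p hp => ?_) (hα.isClosed_causalSet hτ)
  by_contra hn
  apply hp
  have h1 : greenConv m τ (KG m α) p = greenConv m τ (fun _ => 0) p := by
    refine greenConv_congr hτ fun q hq => ?_
    refine image_eq_zero_of_notMem_tsupport fun hc => hn ⟨q, tsupport_KG m α hc, ?_⟩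
    rw [mem_causalSet_comm, neg_neg, mem_causalSet_singleton] at hq
    exact hq
  refine h1.trans ?_
  simp [greenConv_apply]

theorem integrable_greenKernel_mul (hτ : τ = 1 ∨ τ = -1) (m : ℝ) {α : Smooth}
    (hα : ConeCompact τ (tsupport α)) (p : Mink) :
    Integrable fun q => greenKernel m τ q * KG m α (p - q) := by
  obtain ⟨β, hβ, h1, -⟩ := greenConv_KG_eventuallyEq hτ m hα p
  refine (integrable_greenConv m τ (KG_mem_testFn m hβ) p).congr
    (Filter.Eventually.of_forall fun q => ?_)
  by_cases hq : greenKernel m τ q = 0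
  · simp [hq]
  · have h2 : p - q ∈ causalSet (-τ) {p} := by
      rw [mem_causalSet_singleton, sub_sub_cancel_left, inCone_neg, neg_neg]
      exact inCone_of_greenKernel_ne_zero hτ hq
    simp only [(KG_congr m (h1 _ h2)).self_of_nhds]

/-- The Green operators as linear maps. -/
def greenOp (hτ : τ = 1 ∨ τ = -1) (m : ℝ) : TimelikeCompact →ₗ[ℝ] Smooth where
  toFun α := greenSmooth hτ m α (TimelikeCompact.coneCompact hτ α.2)
  map_add' α β := by
    ext p
    have h := integral_add (integrable_greenKernel_mul hτ m (TimelikeCompact.coneCompact hτ α.2) p)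
      (integrable_greenKernel_mul hτ m (TimelikeCompact.coneCompact hτ β.2) p)
    refine Eq.trans ?_ h
    refine integral_congr_ae (Filter.Eventually.of_forall fun q => ?_)
    simp [mul_add]
  map_smul' c α := by
    ext p
    refine Eq.trans ?_ (integral_const_mul c _)
    refine integral_congr_ae (Filter.Eventually.of_forall fun q => ?_)
    simp [mul_left_comm]

theorem isGreenOperator_greenOp (hτ : τ = 1 ∨ τ = -1) (m : ℝ) :
    IsGreenOperator m (causalSet τ) (greenOp hτ m) where
  right_inv α := KG_greenSmooth hτ m α (TimelikeCompact.coneCompact hτ α.2)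
  left_inv α β h := by
    ext p
    show greenConv m τ (KG m (β : Smooth)) p = (α : Smooth) p
    rw [h]
    exact greenConv_KG_KG_of_coneCompact hτ m α (TimelikeCompact.coneCompact hτ α.2) p
  support α := tsupport_greenSmooth hτ m α (TimelikeCompact.coneCompact hτ α.2)

end

noncomputable section

/-! ### Uniqueness of the Green operators and the causal propagator -/

variable {τ : ℝ}

theorem l2Pair_add_left {φ ψ : Smooth} (hφ : φ ∈ TestFn) (hψ : ψ ∈ TestFn) (χ : Smooth) :
    l2Pair (φ + ψ) χ = l2Pair φ χ + l2Pair ψ χ := by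
  have hi : ∀ φ ∈ TestFn, Integrable fun p => φ p * χ p := fun φ hφ =>
    integrable_mul_of_isCompact (IsCompact.inter_right hφ (isClosed_tsupport _))
  unfold l2Pair
  rw [← integral_add (hi φ hφ) (hi ψ hψ)]
  simp only [Smooth.add_apply, add_mul]

theorem l2Pair_smul_left (c : ℝ) (φ χ : Smooth) : l2Pair (c • φ) χ = c * l2Pair φ χ := by
  unfold l2Pair
  rw [← integral_const_mul]
  simp only [Smooth.smul_apply, mul_assoc]

theorem l2Pair_sub_right {φ ψ χ : Smooth} (hψ : IsCompact (tsupport φ ∩ tsupport ψ))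
    (hχ : IsCompact (tsupport φ ∩ tsupport χ)) :
    l2Pair φ (ψ - χ) = l2Pair φ ψ - l2Pair φ χ := by
  unfold l2Pair
  rw [← integral_sub (integrable_mul_of_isCompact hψ) (integrable_mul_of_isCompact hχ)]
  simp only [Smooth.sub_apply, mul_sub]

theorem neg_orientation (hτ : τ = 1 ∨ τ = -1) : -τ = 1 ∨ -τ = -1 := by
  rcases hτ with rfl | rfl <;> simp

theorem isCompact_inter_tsupport (hτ : τ = 1 ∨ τ = -1) {φ ψ : Smooth} {A C : Set Mink}
    (hA : ConeCompact τ A) (hC : IsCompact C) (hφ : tsupport φ ⊆ causalSet τ A)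
    (hψ : tsupport ψ ⊆ causalSet (-τ) C) : IsCompact (tsupport φ ∩ tsupport ψ) :=
  (hA.inter_causalSet hτ hC).of_isClosed_subset ((isClosed_tsupport _).inter (isClosed_tsupport _))
    (inter_subset_inter hφ hψ)

/-- A solution of the Klein-Gordon equation with past compact support vanishes, because it is
orthogonal to `P E^∓ φ = φ` for all test functions `φ`. -/
theorem eq_zero_of_KG_eq_zero (hτ : τ = 1 ∨ τ = -1) (m : ℝ) {A : Set Mink} (hA : ConeCompact τ A)
    {w : Smooth} (hw : tsupport w ⊆ causalSet τ A) (h : KG m w = 0) : w = 0 := by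
  refine eq_zero_of_l2Pair_eq_zero fun φ hφ => ?_
  have hτ' := neg_orientation hτ
  have hc : ConeCompact (-τ) (tsupport φ) := coneCompact_of_isCompact hφ
  rw [← KG_greenSmooth hτ' m φ hc, ← l2Pair_KG, h, l2Pair_zero_left]
  exact isCompact_inter_tsupport hτ hA hφ hw (tsupport_greenSmooth hτ' m φ hc)

theorem IsGreenOperator.eq_greenOp (hτ : τ = 1 ∨ τ = -1) {m : ℝ}
    {G : TimelikeCompact →ₗ[ℝ] Smooth} (hG : IsGreenOperator m (causalSet τ) G) :
    G = greenOp hτ m := by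
  refine LinearMap.ext fun α => sub_eq_zero.1 ?_
  refine eq_zero_of_KG_eq_zero hτ m (TimelikeCompact.coneCompact hτ α.2) ?_ ?_
  · have hcl := (TimelikeCompact.coneCompact hτ α.2).isClosed_causalSet hτ
    refine closure_minimal (fun p hp => ?_) hcl
    by_contra hn
    apply hp
    have h1 := image_eq_zero_of_notMem_tsupport fun hc => hn (hG.support α hc)
    have h2 := image_eq_zero_of_notMem_tsupport fun hc =>
      hn ((isGreenOperator_greenOp hτ m).support α hc)
    simp [h1, h2]
  · rw [map_sub, hG.right_inv, (isGreenOperator_greenOp hτ m).right_inv, sub_self]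

theorem existsUnique_isGreenOperator (hτ : τ = 1 ∨ τ = -1) (m : ℝ) :
    ∃! G : TimelikeCompact →ₗ[ℝ] Smooth, IsGreenOperator m (causalSet τ) G :=
  ⟨greenOp hτ m, isGreenOperator_greenOp hτ m, fun _ hG => hG.eq_greenOp hτ⟩

theorem propagator_eq (m : ℝ) :
    propagator m = greenOp (.inl rfl) m - greenOp (.inr rfl) m := by
  have h : (∃ G, IsGreenOperator m causalFuture G) ∧ (∃ G, IsGreenOperator m causalPast G) := by
    rw [← causalSet_one, ← causalSet_neg_one]
    exact ⟨⟨_, isGreenOperator_greenOp (.inl rfl) m⟩, ⟨_, isGreenOperator_greenOp (.inr rfl) m⟩⟩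
  rw [propagator, dif_pos h]
  congr 1
  · exact IsGreenOperator.eq_greenOp (.inl rfl) 
      ((congrArg (fun J => IsGreenOperator m J h.1.choose) causalSet_one).mpr h.1.choose_spec)
  · exact IsGreenOperator.eq_greenOp (.inr rfl) 
      ((congrArg (fun J => IsGreenOperator m J h.2.choose) causalSet_neg_one).mpr h.2.choose_spec)

theorem tsupport_zRefl_subset (φ : Smooth) : tsupport (zRefl φ) ⊆ reflPt ⁻¹' tsupport φ :=
  closure_minimal (fun _ hp => subset_tsupport _ hp)
    ((isClosed_tsupport _).preimage reflPt.continuous)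

theorem inCone_reflPt {q : Mink} : InCone τ (reflPt q) ↔ InCone τ q := by
  simp [InCone, spaceSq, reflPt_apply]

theorem zRefl_eq_neg {φ : Smooth} (hφ : φ ∈ OddFn) : zRefl φ = -φ := by
  ext p; exact hφ p

theorem tsupport_neg (φ : Smooth) : tsupport (-φ : Smooth) = tsupport φ := by
  have : Function.support (-φ : Smooth).toFun = Function.support φ.toFun := by
    ext p; simp
  rw [tsupport, this]; rfl

/-- The Green operators preserve odd functions, by uniqueness. -/
theorem greenOp_mem_oddFn (hτ : τ = 1 ∨ τ = -1) (m : ℝ) (α : TimelikeCompact)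
    (hα : (α : Smooth) ∈ OddFn) : greenOp hτ m α ∈ OddFn := by
  have hG := isGreenOperator_greenOp hτ m
  have hcl := (TimelikeCompact.coneCompact hτ α.2).isClosed_causalSet hτ
  have h0 : zRefl (greenOp hτ m α) + greenOp hτ m α = 0 := by
    refine eq_zero_of_KG_eq_zero hτ m (TimelikeCompact.coneCompact hτ α.2) ?_ ?_
    · refine closure_minimal (fun p hp => ?_) hcl
      by_contra hn
      apply hp
      have h1 := image_eq_zero_of_notMem_tsupport fun hc => hn (hG.support α hc)
      have h2 : zRefl (greenOp hτ m α) p = 0 := by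
        refine image_eq_zero_of_notMem_tsupport fun hc => hn ?_
        obtain ⟨a, ha, hpa⟩ := hG.support α (tsupport_zRefl_subset _ hc)
        refine ⟨reflPt a, ?_, ?_⟩
        · refine tsupport_zRefl_subset (α : Smooth) ?_
          rw [zRefl_eq_neg hα, tsupport_neg]
          exact ha
        · have h3 : p - reflPt a = reflPt (reflPt p - a) := by rw [map_sub, reflPt_reflPt]
          rw [h3]
          exact inCone_reflPt.2 hpa
      simp only [Smooth.add_apply, h1, h2, add_zero]
    · rw [map_add, KG_zRefl, hG.right_inv, zRefl_eq_neg hα, neg_add_cancel]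
  intro p
  have h1 := congrArg (fun φ : Smooth => φ p) h0
  simp only [Smooth.add_apply, zRefl_apply, Smooth.zero_apply] at h1
  linarith

theorem propagator_mem_oddFn (m : ℝ) (α : TimelikeCompact) (hα : (α : Smooth) ∈ OddFn) :
    propagator m α ∈ OddFn := by
  rw [propagator_eq]
  exact sub_mem (greenOp_mem_oddFn _ m α hα) (greenOp_mem_oddFn _ m α hα)

/-- The transpose of `E^±` is `E^∓`. -/
theorem l2Pair_greenOp (hτ : τ = 1 ∨ τ = -1) (hτ' : -τ = 1 ∨ -τ = -1) (m : ℝ)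
    (ζ α : TimelikeCompact) (hζ : (ζ : Smooth) ∈ TestFn) :
    l2Pair ζ (greenOp hτ m α) = l2Pair (greenOp hτ' m ζ) α := by
  have hG := isGreenOperator_greenOp hτ m
  have hG' := isGreenOperator_greenOp hτ' m
  have h : IsCompact (tsupport (greenOp hτ' m ζ) ∩ tsupport (greenOp hτ m α)) := by
    rw [inter_comm]
    exact isCompact_inter_tsupport hτ (TimelikeCompact.coneCompact hτ α.2) hζ (hG.support α)
      (hG'.support ζ)
  have h1 := l2Pair_KG m h
  rwa [hG.right_inv, hG'.right_inv] at h1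

theorem greenOp_congr {τ' : ℝ} (h : τ = τ') (hτ : τ = 1 ∨ τ = -1) (hτ' : τ' = 1 ∨ τ' = -1) (m : ℝ) :
    greenOp hτ m = greenOp hτ' m := by subst h; rfl

/-- The causal propagator is antisymmetric. -/
theorem l2Pair_propagator (m : ℝ) (ζ α : TimelikeCompact) (hζ : (ζ : Smooth) ∈ TestFn) :
    l2Pair ζ (propagator m α) = -l2Pair α (propagator m ζ) := by
  have hc : ∀ ψ : Smooth, IsCompact (tsupport (ζ : Smooth) ∩ tsupport ψ) := fun ψ =>
    IsCompact.inter_right hζ (isClosed_tsupport _)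
  have hd : ∀ {τ : ℝ} (hτ : τ = 1 ∨ τ = -1),
      IsCompact (tsupport (α : Smooth) ∩ tsupport (greenOp hτ m ζ)) := by
    intro τ hτ
    have hτ' := neg_orientation hτ
    refine isCompact_inter_tsupport hτ' (TimelikeCompact.coneCompact hτ' α.2) hζ
      (subset_causalSet _) ?_
    rw [neg_neg]
    exact (isGreenOperator_greenOp hτ m).support ζ
  have h1 := l2Pair_greenOp (.inl rfl) (.inr rfl) m ζ α hζ
  have h2 := l2Pair_greenOp (τ := -1) (.inr rfl) (.inl (neg_neg 1)) m ζ α hζ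
  rw [greenOp_congr (neg_neg 1) _ (.inl rfl)] at h2
  rw [propagator_eq, LinearMap.sub_apply, LinearMap.sub_apply, l2Pair_sub_right (hc _) (hc _),
    l2Pair_sub_right (hd _) (hd _), h1, h2, l2Pair_comm, l2Pair_comm _ (α : Smooth)]
  ring

/-- If `E α = 0`, then `E⁺ α = E⁻ α` is a timelike compact solution `β` of `P β = α`. -/
theorem exists_KG_eq_of_propagator_eq_zero (m : ℝ) (α : TimelikeCompact)
    (hα : (α : Smooth) ∈ OddFn) (h : propagator m α = 0) :
    ∃ β ∈ TcOdd, KG m β = α ∧ ((α : Smooth) ∈ TestFn → β ∈ TestFn) := by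
  have hG := isGreenOperator_greenOp (τ := 1) (.inl rfl) m
  have hG' := isGreenOperator_greenOp (τ := -1) (.inr rfl) m
  have heq : greenOp (.inl rfl) m α = greenOp (.inr rfl) m α := by
    rw [propagator_eq, LinearMap.sub_apply] at h
    exact sub_eq_zero.1 h
  have hs := hG.support α
  have hs' := hG'.support α
  rw [← heq] at hs'
  have hmem : ∀ {τ : ℝ} (hτ : τ = 1 ∨ τ = -1),
      tsupport (greenOp (.inl rfl) m α) ⊆ causalSet τ (tsupport (α : Smooth)) →
      ConeCompact τ (tsupport (greenOp (.inl rfl) m α)) := fun hτ hsub p =>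
    ((TimelikeCompact.coneCompact hτ α.2).causalSet hτ p).of_isClosed_subset
      ((isClosed_tsupport _).inter (isClosed_causalSet_of_isCompact isCompact_singleton))
      (inter_subset_inter_left _ hsub)
  refine ⟨greenOp (.inl rfl) m α, ⟨timelikeCompact_iff.2 ⟨hmem (.inl rfl) hs, hmem (.inr rfl) hs'⟩,
    greenOp_mem_oddFn _ m α hα⟩, hG.right_inv α, fun ht => ?_⟩
  have hc := isCompact_inter_tsupport (.inl rfl) (TimelikeCompact.coneCompact (.inl rfl) α.2) ht
    hs hs'
  rwa [inter_self] at hc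

end

noncomputable section

/-! ### The half space -/

theorem sqrt_two_inv_sq : (1 / √2 : ℝ) * (1 / √2) = 1 / 2 := by
  rw [div_mul_div_comm, Real.mul_self_sqrt (by norm_num)]; norm_num

theorem eta_apply_of_odd {φ : Smooth} (hφ : φ ∈ OddFn) (p : Half) :
    eta φ p = 1 / √2 * (2 * φ p) := by
  rw [eta_apply, hφ p]; ring

theorem eta_etaDagger (f : KinCP0) : eta (etaDagger f : TestOdd) = f := by
  ext p
  have h3 : 0 ≤ p.1 3 := p.2
  rw [eta_apply_of_odd (etaDagger f).2.2]
  have h1 : ((etaDagger f : TestOdd) : Smooth) p = 1 / √2 * (f : SmoothH) p := by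
    show etaDaggerFun (f : SmoothH) p = _
    rw [etaDaggerFun, dif_pos h3]
  rw [h1]
  linear_combination 2 * (f : SmoothH) p * sqrt_two_inv_sq

theorem eta_mem_kinCP0 {ζ : Smooth} (hζ : ζ ∈ TestOdd) : eta ζ ∈ KinCP0 := by
  refine ⟨⟨eta_mem_dirichlet ζ, ζ, rfl⟩, ?_⟩
  have hK : IsCompact (Subtype.val ⁻¹' tsupport ζ : Set Half) :=
    (isClosed_le continuous_const (continuous_apply 3)).isClosedEmbedding_subtypeVal.isCompact_preimage
      hζ.1
  refine HasCompactSupport.intro hK fun p hp => ?_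
  have h0 : ζ p = 0 := image_eq_zero_of_notMem_tsupport hp
  rw [eta_apply_of_odd hζ.2, h0]
  ring

theorem etaDagger_eta (ζ : TestOdd) : etaDagger ⟨eta ζ, eta_mem_kinCP0 ζ.2⟩ = ζ := by
  refine Subtype.ext (Smooth.ext (funext fun p => ?_))
  show etaDaggerFun (eta ζ) p = (ζ : Smooth) p
  rw [etaDaggerFun_eta, ζ.2.2 p]
  ring

theorem KGH_apply (m : ℝ) (u : SmoothH) (p : Half) :
    KGH m u p = -partialH 0 (partialH 0 u) p + partialH 1 (partialH 1 u) p
      + partialH 2 (partialH 2 u) p + partialH 3 (partialH 3 u) p - m ^ 2 * u p := by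
  simp only [KGH, LinearMap.sub_apply, LinearMap.add_apply, LinearMap.neg_apply,
    LinearMap.comp_apply, LinearMap.smul_apply, LinearMap.id_apply]
  rw [sub_eq_add_neg]
  show -partialH 0 (partialH 0 u) p + partialH 1 (partialH 1 u) p
      + partialH 2 (partialH 2 u) p + partialH 3 (partialH 3 u) p + -(m ^ 2 * u p) = _
  ring

theorem partialH_partialH_eq {u : SmoothH} {U : Set Mink} {w : Mink → ℝ} (h : IsExt u U w)
    (i : Fin 4) (p : Half) : partialH i (partialH i u) p
      = fderiv ℝ (fun q => fderiv ℝ w q (Pi.single i 1)) p (Pi.single i 1) :=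
  derivH_eq (isExt_derivH h i) i p

/-- Green's identity on the half space: the boundary terms vanish since both functions satisfy
Dirichlet boundary conditions. -/
theorem setIntegral_KG_mul_eq_zero (m : ℝ) {ψ : Smooth} (hψ : ψ ∈ TestOdd) {u : SmoothH}
    (hu : u ∈ SolCP m) {U : Set Mink} {w : Mink → ℝ} (h : IsExt u U w) :
    ∫ p in halfSet, KG m ψ p * w p = 0 := by
  obtain ⟨R, hR⟩ := (IsCompact.isBounded hψ.1).subset_closedBall (0 : Mink)
  set S : ℝ := |R| + 1 with hS
  have hS0 : 0 < S := by positivity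
  have hRS : R < S := by linarith [le_abs_self R]
  set a : Mink := fun i => if i = 3 then 0 else -S with ha
  set b : Mink := fun _ => S with hb
  have hab : a ≤ b := fun i => by
    by_cases hi : i = 3 <;> simp [ha, hb, hi] <;> linarith
  have ha3 : a 3 = 0 := by simp [ha]
  have hsub : Icc a b ⊆ halfSet := fun p hp => by
    have := hp.1 3
    rw [ha3] at this
    exact this
  have hU : Icc a b ⊆ U := hsub.trans h.2.1
  have hzero : ∀ p : Mink, S ≤ ‖p‖ → p ∉ tsupport ψ := fun p hp hc => by
    have := mem_closedBall_zero_iff.1 (hR hc)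
    linarith
  -- the divergence of `V i = ± (∂ᵢψ w - ψ ∂ᵢw)` is `(P ψ) w - ψ (P w)`
  set sg : Fin 4 → ℝ := fun i => if i = 0 then -1 else 1 with hsg
  set dw : Fin 4 → Mink → ℝ := fun i q => fderiv ℝ w q (Pi.single i 1) with hdw
  have hwd : ∀ p ∈ U, DifferentiableAt ℝ w p := fun p hp =>
    (h.2.2.1.contDiffAt (h.1.mem_nhds hp)).differentiableAt (by simp)
  have hdwc : ∀ i, ContDiffOn ℝ ∞ (dw i) U := fun i => (isExt_derivH h i).2.2.1
  have hdwd : ∀ i, ∀ p ∈ U, DifferentiableAt ℝ (dw i) p := fun i p hp =>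
    ((hdwc i).contDiffAt (h.1.mem_nhds hp)).differentiableAt (by simp)
  set V : Fin 4 → Mink → ℝ := fun i p => sg i * (partialD i ψ p * w p - ψ p * dw i p) with hV
  set V' : Fin 4 → Mink → Mink →L[ℝ] ℝ := fun i p =>
    sg i • ((partialD i ψ p • fderiv ℝ w p + w p • fderiv ℝ (partialD i ψ) p)
      - (ψ p • fderiv ℝ (dw i) p + dw i p • fderiv ℝ ψ p)) with hV'
  have hVd : ∀ i, ∀ p ∈ U, HasFDerivAt (V i) (V' i p) p := fun i p hp =>
    ((((partialD i ψ).differentiableAt p).hasFDerivAt.mul (hwd p hp).hasFDerivAt).sub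
      ((ψ.differentiableAt p).hasFDerivAt.mul (hdwd i p hp).hasFDerivAt)).const_mul (sg i)
  have hdiv : ∀ p ∈ Icc a b, ∑ i, V' i p (Pi.single i 1) = KG m ψ p * w p := by
    intro p hp
    have h1 : KGH m u ⟨p, hsub hp⟩ = 0 := by
      rw [LinearMap.mem_ker.1 hu.1]; rfl
    rw [KGH_apply, partialH_partialH_eq h, partialH_partialH_eq h, partialH_partialH_eq h,
      partialH_partialH_eq h, ← h.2.2.2] at h1
    simp only [hV', smul_apply, sub_apply, add_apply, smul_eq_mul, ← partialD_apply, Fin.sum_univ_four]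
    have s0 : sg 0 = -1 := if_pos rfl
    have s1 : sg 1 = 1 := if_neg (by decide)
    have s2 : sg 2 = 1 := if_neg (by decide)
    have s3 : sg 3 = 1 := if_neg (by decide)
    rw [KG_apply, s0, s1, s2, s3]
    simp only [hdw]
    linear_combination -ψ p * h1
  have hcont : ContinuousOn (fun p => KG m ψ p * w p) (Icc a b) :=
    (KG m ψ).continuous.continuousOn.mul (h.2.2.1.continuousOn.mono hU)
  have hdt := integral_divergence_of_hasFDerivAt_off_countable' a b hab V V' ∅ countable_empty
    (fun i p hp => ((hVd i p (hU hp)).continuousAt).continuousWithinAt)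
    (fun p hp i => hVd i p (hU ⟨fun j => (hp.1 j trivial).1.le, fun j => (hp.1 j trivial).2.le⟩))
    ((hcont.integrableOn_compact isCompact_Icc).congr_fun (fun p hp => (hdiv p hp).symm)
      measurableSet_Icc)
  have hVz : ∀ i p, p ∉ tsupport ψ → V i p = 0 := fun i p hp => by
    have h1 : ψ p = 0 := image_eq_zero_of_notMem_tsupport hp
    have h2 : partialD i ψ p = 0 :=
      image_eq_zero_of_notMem_tsupport fun hc => hp (tsupport_partialD i ψ hc)
    simp [hV, h1, h2]
  have hVz3 : ∀ p : Mink, p 3 = 0 → V 3 p = 0 := fun p hp => by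
    have h1 : ψ p = 0 := by
      have h2 : reflPt p = p := by
        ext i
        by_cases hi : i = 3
        · subst hi; simp [reflPt_apply, hp]
        · simp [reflPt_apply, hi]
      have h3 := hψ.2 p
      rw [h2] at h3
      linarith
    have h2 : w p = 0 := by
      rw [h.2.2.2 ⟨p, hp.ge⟩]
      exact hu.2 _ hp
    simp [hV, h1, h2]
  rw [setIntegral_congr_fun measurableSet_Icc hdiv] at hdt
  rw [setIntegral_eq_of_subset_of_forall_sdiff_eq_zero
    (isClosed_le continuous_const (continuous_apply 3)).measurableSet hsub, hdt]
  · refine Finset.sum_eq_zero fun i _ => ?_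
    have hup : ∀ x, V i (i.insertNth (b i) x) = 0 := fun x => by
      refine hVz i _ (hzero _ ?_)
      have := norm_le_pi_norm (i.insertNth (b i) x : Mink) i
      rw [Fin.insertNth_apply_same, Real.norm_eq_abs] at this
      exact (le_abs_self S).trans this
    have hlo : ∀ x, V i (i.insertNth (a i) x) = 0 := fun x => by
      by_cases hi : i = 3
      · subst hi
        refine hVz3 _ ?_
        rw [Fin.insertNth_apply_same, ha3]
      · refine hVz i _ (hzero _ ?_)
        have := norm_le_pi_norm (i.insertNth (a i) x : Mink) i
        rw [Fin.insertNth_apply_same, Real.norm_eq_abs] at this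
        have h2 : a i = -S := by simp [ha, hi]
        rw [h2, abs_neg] at this
        exact (le_abs_self S).trans (by rw [h2]; exact this)
    simp only [hup, hlo, integral_zero, sub_self]
  · intro p hp
    have h1 : p ∉ tsupport ψ := by
      refine fun hc => hp.2 ⟨fun i => ?_, fun i => ?_⟩
      · by_cases hi : i = 3
        · subst hi
          rw [ha3]; exact hp.1
        · have h2 : a i = -S := by simp [ha, hi]
          have h3 := (norm_le_pi_norm p i).trans (mem_closedBall_zero_iff.1 (hR hc))
          rw [Real.norm_eq_abs] at h3
          rw [h2]; linarith [neg_abs_le (p i)]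
      · have h3 := (norm_le_pi_norm p i).trans (mem_closedBall_zero_iff.1 (hR hc))
        rw [Real.norm_eq_abs] at h3
        exact (le_abs_self _).trans (h3.trans hRS.le)
    have h2 : KG m ψ p = 0 :=
      image_eq_zero_of_notMem_tsupport fun hc => h1 (tsupport_KG m ψ hc)
    simp only [h2, zero_mul]

theorem l2PairH_eta_KG (m : ℝ) {ψ : Smooth} (hψ : ψ ∈ TestOdd) {u : SmoothH} (hu : u ∈ SolCP m) :
    l2PairH (eta (KG m ψ)) u = 0 := by
  obtain ⟨U, w, h⟩ := u.smooth
  have hodd : KG m ψ ∈ OddFn := fun p => by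
    have h1 := congrArg (fun φ : Smooth => φ p) (KG_zRefl m ψ)
    rw [zRefl_eq_neg hψ.2, map_neg] at h1
    exact h1.symm
  have hS : MeasurableSet halfSet :=
    (isClosed_le continuous_const (continuous_apply 3)).measurableSet
  have h3 := integral_subtype_comap hS (μ := volume)
    (fun p : Mink => (1 / √2 * 2) * (KG m ψ p * w p))
  rw [integral_const_mul _ (fun p : Mink => KG m ψ p * w p),
    setIntegral_KG_mul_eq_zero m hψ hu h, mul_zero] at h3
  rw [← h3, l2PairH]
  refine integral_congr_ae (Filter.Eventually.of_forall fun p => ?_)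
  simp only [eta_apply_of_odd hodd, ← h.2.2.2 p]
  ring

end

noncomputable section

/-! ### The observables -/

theorem l2Pair_testOdd_add (ζ ζ' : TestOdd) (χ : Smooth) :
    l2Pair (ζ + ζ' : TestOdd) χ = l2Pair ζ χ + l2Pair ζ' χ :=
  l2Pair_add_left ζ.2.1 ζ'.2.1 χ

theorem l2Pair_testOdd_smul (c : ℝ) (ζ : TestOdd) (χ : Smooth) :
    l2Pair (c • ζ : TestOdd) χ = c * l2Pair ζ χ :=
  l2Pair_smul_left c ζ χ

/-- The map `ζ ↦ F_ζ` is linear. -/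
def genKGLin (m : ℝ) : TestOdd →ₗ[ℝ] ObsKG m where
  toFun := genKG m
  map_add' ζ ζ' := Subtype.ext (funext fun a => by
    show ((l2Pair (ζ + ζ' : TestOdd) _ : ℝ) : ℂ) = (l2Pair ζ _ : ℝ) + (l2Pair ζ' _ : ℝ)
    rw [l2Pair_testOdd_add]; push_cast; rfl)
  map_smul' c ζ := Subtype.ext (funext fun a => by
    show ((l2Pair (c • ζ : TestOdd) _ : ℝ) : ℂ) = c • ((l2Pair ζ _ : ℝ) : ℂ)
    rw [l2Pair_testOdd_smul]; simp)

theorem genKG_surjective (m : ℝ) : Function.Surjective (genKG m) := by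
  rintro ⟨G, hG⟩
  have h1 : Submodule.span ℝ (Set.range (obsKG m))
      ≤ LinearMap.range ((ObsKG m).subtype ∘ₗ genKGLin m) :=
    Submodule.span_le.2 (by rintro _ ⟨ζ, rfl⟩; exact ⟨ζ, rfl⟩)
  obtain ⟨ζ, hζ⟩ := h1 hG
  exact ⟨ζ, Subtype.ext hζ⟩

theorem genKG_apply_mk (m : ℝ) (ζ : TestOdd) (α : TcOdd) :
    (genKG m ζ).1 (Submodule.Quotient.mk α)
      = ((l2Pair ζ (propagator m (Submodule.inclusion inf_le_left α)) : ℝ) : ℂ) := rfl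

theorem l2Pair_testToTc (m : ℝ) (ζ : TestOdd) (α : TimelikeCompact) :
    l2Pair ζ (propagator m α) = -l2Pair α (propagator m (testToTc ζ)) :=
  l2Pair_propagator m (testToTc ζ) α ζ.2.1

theorem l2Pair_testToTc_comm (m : ℝ) (ζ ζ' : TestOdd) :
    l2Pair ζ (propagator m (testToTc ζ')) = -l2Pair ζ' (propagator m (testToTc ζ)) :=
  l2Pair_testToTc m ζ (testToTc ζ')

theorem propagator_testToTc_eq_zero (m : ℝ) {ζ : TestOdd}
    (h : ∀ ζ' : TestOdd, l2Pair ζ (propagator m (testToTc ζ')) = 0) :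
    propagator m (testToTc ζ) = 0 := by
  refine eq_zero_of_l2Pair_odd (propagator_mem_oddFn m _ ζ.2.2) fun φ hφ => ?_
  have h1 := h ⟨φ, hφ⟩
  rw [l2Pair_testToTc_comm, neg_eq_zero] at h1
  rw [l2Pair_comm]
  exact h1

/-- A label whose observable vanishes on the test functions belongs to `P[C^∞_{0,-}]`. -/
theorem exists_KG_eq_of_l2Pair_eq_zero (m : ℝ) {ζ : TestOdd}
    (h : ∀ ζ' : TestOdd, l2Pair ζ (propagator m (testToTc ζ')) = 0) :
    ∃ β ∈ TestOdd, KG m β = ζ := by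
  obtain ⟨β, hβ, h1, h2⟩ := exists_KG_eq_of_propagator_eq_zero m (testToTc ζ) ζ.2.2
    (propagator_testToTc_eq_zero m h)
  exact ⟨β, ⟨h2 ζ.2.1, hβ.2⟩, h1⟩

theorem l2Pair_eq_of_genKG_eq (m : ℝ) {ζ₁ ζ₂ : TestOdd} (h : genKG m ζ₁ = genKG m ζ₂)
    (ζ' : TestOdd) : l2Pair ζ₁ (propagator m (testToTc ζ')) = l2Pair ζ₂ (propagator m (testToTc ζ'))
    := by
  have h1 := congrArg (fun G : ObsKG m => G.1 (Submodule.Quotient.mk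
    (Submodule.inclusion (inf_le_inf_right _ testFn_le_timelikeCompact) ζ'))) h
  exact Complex.ofReal_injective h1

theorem genKG_eq_zero (m : ℝ) {ζ : TestOdd}
    (h : ∀ ζ' : TestOdd, l2Pair ζ (propagator m (testToTc ζ')) = 0) : genKG m ζ = 0 := by
  refine Subtype.ext (funext fun a => ?_)
  induction a using Submodule.Quotient.induction_on with
  | H α =>
    rw [genKG_apply_mk, l2Pair_testToTc, propagator_testToTc_eq_zero m h, l2Pair_zero_right]
    simp

theorem genKG_of_mem_imageKG (m : ℝ) {ζ : TestOdd} (h : ζ ∈ imageKG m TestOdd) :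
    genKG m ζ = 0 := by
  obtain ⟨β, hβ, h1⟩ := h
  refine Subtype.ext (funext fun a => ?_)
  induction a using Submodule.Quotient.induction_on with
  | H α =>
    have h2 : (ζ : Smooth) = KG m β := h1.symm
    rw [genKG_apply_mk, h2, l2Pair_KG m (IsCompact.inter_right hβ.1 (isClosed_tsupport _)),
      KG_propagator, l2Pair_zero_right]
    simp

/-- The linear map `[ζ] ↦ F_[ζ]`. -/
def labelMap (m : ℝ) : Label m →ₗ[ℝ] ObsKG m :=
  (imageKG m TestOdd).liftQ (genKGLin m) fun _ h => genKG_of_mem_imageKG m h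

theorem separating (m : ℝ) {a a' : Config m} (h : a ≠ a') :
    ∃ z : Label m, (labelMap m z).1 a ≠ (labelMap m z).1 a' := by
  by_contra! hn
  apply h
  induction a using Submodule.Quotient.induction_on with | H α => ?_
  induction a' using Submodule.Quotient.induction_on with | H α' => ?_
  set γ : TimelikeCompact := Submodule.inclusion inf_le_left (α - α') with hγ
  have hodd : propagator m γ ∈ OddFn := propagator_mem_oddFn m γ (α - α').2.2
  have h0 : propagator m γ = 0 := by
    refine eq_zero_of_l2Pair_odd hodd fun φ hφ => ?_
    have h1 := hn (Submodule.Quotient.mk ⟨φ, hφ⟩)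
    have h2 : l2Pair φ (propagator m (Submodule.inclusion inf_le_left α))
        = l2Pair φ (propagator m (Submodule.inclusion inf_le_left α')) :=
      Complex.ofReal_injective h1
    have hc : ∀ ψ : Smooth, IsCompact (tsupport φ ∩ tsupport ψ) := fun ψ =>
      IsCompact.inter_right hφ.1 (isClosed_tsupport _)
    rw [l2Pair_comm, hγ, map_sub, map_sub, l2Pair_sub_right (hc _) (hc _), h2, sub_self]
  obtain ⟨β, hβ, h1, -⟩ := exists_KG_eq_of_propagator_eq_zero m γ (α - α').2.2 h0
  exact (Submodule.Quotient.eq _).2 ⟨β, hβ, h1⟩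

theorem labelMap_injective (m : ℝ) : Function.Injective (labelMap m) := by
  rw [injective_iff_map_eq_zero]
  intro z hz
  induction z using Submodule.Quotient.induction_on with | H ζ => ?_
  have h1 : genKG m ζ = genKG m 0 := hz.trans (map_zero (genKGLin m)).symm
  obtain ⟨β, hβ, h2⟩ := exists_KG_eq_of_l2Pair_eq_zero m (ζ := ζ) fun ζ' =>
    (l2Pair_eq_of_genKG_eq m h1 ζ').trans (l2Pair_zero_left _)
  exact (Submodule.Quotient.mk_eq_zero _).2 ⟨β, hβ, h2⟩

theorem optimal (m : ℝ) {z z' : Label m} (h : z ≠ z') :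
    ∃ a : Config m, (labelMap m z).1 a ≠ (labelMap m z').1 a := by
  by_contra! hn
  exact h (labelMap_injective m (Subtype.ext (funext hn)))

/-- An odd test function that represents an observable. -/
def repKG (m : ℝ) (G : ObsKG m) : TestOdd := (genKG_surjective m G).choose

theorem genKG_repKG (m : ℝ) (G : ObsKG m) : genKG m (repKG m G) = G :=
  (genKG_surjective m G).choose_spec

theorem l2Pair_congr (m : ℝ) {ζ₁ ζ₂ ζ₁' ζ₂' : TestOdd} (h : genKG m ζ₁ = genKG m ζ₂)
    (h' : genKG m ζ₁' = genKG m ζ₂') :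
    l2Pair ζ₁ (propagator m (testToTc ζ₁')) = l2Pair ζ₂ (propagator m (testToTc ζ₂')) := by
  rw [l2Pair_eq_of_genKG_eq m h, l2Pair_testToTc_comm, l2Pair_eq_of_genKG_eq m h',
    ← l2Pair_testToTc_comm]

/-- The symplectic form `σ(F_ζ, F_ζ') = ⟨ζ, E ζ'⟩`. -/
def sigmaKG (m : ℝ) : ObsKG m →ₗ[ℝ] ObsKG m →ₗ[ℝ] ℝ :=
  LinearMap.mk₂ ℝ (fun G G' => l2Pair (repKG m G) (propagator m (testToTc (repKG m G'))))
    (fun G₁ G₂ G' => by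
      rw [← l2Pair_testOdd_add]
      refine l2Pair_congr m ?_ rfl
      rw [genKG_repKG]
      exact ((map_add (genKGLin m) _ _).trans
        (congrArg₂ _ (genKG_repKG m G₁) (genKG_repKG m G₂))).symm)
    (fun c G G' => by
      rw [smul_eq_mul, ← l2Pair_testOdd_smul]
      refine l2Pair_congr m ?_ rfl
      rw [genKG_repKG]
      exact ((map_smul (genKGLin m) _ _).trans (congrArg _ (genKG_repKG m G))).symm)
    (fun G G₁' G₂' => by
      rw [l2Pair_testToTc_comm, l2Pair_testToTc_comm m _ (repKG m G₁'),
        l2Pair_testToTc_comm m _ (repKG m G₂'), ← neg_add, ← l2Pair_testOdd_add]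
      refine congrArg _ (l2Pair_congr m ?_ rfl)
      rw [genKG_repKG]
      exact ((map_add (genKGLin m) _ _).trans
        (congrArg₂ _ (genKG_repKG m G₁') (genKG_repKG m G₂'))).symm)
    (fun c G G' => by
      rw [l2Pair_testToTc_comm, l2Pair_testToTc_comm m _ (repKG m G'), smul_neg, smul_eq_mul,
        ← l2Pair_testOdd_smul]
      refine congrArg _ (l2Pair_congr m ?_ rfl)
      rw [genKG_repKG]
      exact ((map_smul (genKGLin m) _ _).trans (congrArg _ (genKG_repKG m G'))).symm)

theorem sigmaKG_genKG (m : ℝ) (ζ ζ' : TestOdd) :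
    sigmaKG m (genKG m ζ) (genKG m ζ') = l2Pair ζ (propagator m (testToTc ζ')) :=
  l2Pair_congr m (genKG_repKG m _) (genKG_repKG m _)

theorem isAlt_sigmaKG (m : ℝ) : (sigmaKG m).IsAlt := fun G => by
  have h := l2Pair_testToTc_comm m (repKG m G) (repKG m G)
  exact self_eq_neg.1 h

theorem separatingLeft_sigmaKG (m : ℝ) : (sigmaKG m).SeparatingLeft := fun G hG => by
  obtain ⟨ζ, rfl⟩ := genKG_surjective m G
  exact genKG_eq_zero m fun ζ' => (sigmaKG_genKG m ζ ζ').symm.trans (hG _)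

/-! ### The observables on the half space -/

theorem integrable_kinCP0_mul (f : KinCP0) (u : SmoothH) :
    Integrable (fun p : Half => (f : SmoothH) p * u p) (Measure.comap Subtype.val volume) := by
  obtain ⟨U, w, h⟩ := u.smooth
  set ζ : Smooth := ((etaDagger f : TestOdd) : Smooth) with hζ
  have hcl : IsClosed halfSet := isClosed_le continuous_const (continuous_apply 3)
  have h1 : IntegrableOn (fun p : Mink => (1 / √2 * (2 * ζ p)) * w p) halfSet := by
    have h2 : IntegrableOn (fun p : Mink => (1 / √2 * (2 * ζ p)) * w p) (tsupport ζ ∩ halfSet) := by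
      refine ContinuousOn.integrableOn_compact (IsCompact.inter_right (etaDagger f).2.1 hcl)
        (ContinuousOn.mul ?_ ?_)
      · exact (continuous_const.mul (continuous_const.mul ζ.continuous)).continuousOn
      · exact h.2.2.1.continuousOn.mono (inter_subset_right.trans h.2.1)
    refine h2.of_forall_sdiff_eq_zero hcl.measurableSet fun p hp => ?_
    have h3 : ζ p = 0 := image_eq_zero_of_notMem_tsupport fun hc => hp.2 ⟨hc, hp.1⟩
    rw [h3]; ring
  refine ((integrableOn_iff_comap_subtypeVal hcl.measurableSet).1 h1).congr
    (Filter.Eventually.of_forall fun p => ?_)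
  have h5 := congrArg (fun v : SmoothH => v p) (eta_etaDagger f)
  simp only [eta_apply_of_odd (etaDagger f).2.2] at h5
  simp only [Function.comp, h.2.2.2 p, ← h5, ← hζ]

theorem l2PairH_add (f f' : KinCP0) (u : SmoothH) :
    l2PairH (f + f' : KinCP0) u = l2PairH f u + l2PairH f' u := by
  unfold l2PairH
  rw [← integral_add (integrable_kinCP0_mul f u) (integrable_kinCP0_mul f' u)]
  refine integral_congr_ae (Filter.Eventually.of_forall fun p => ?_)
  exact add_mul _ _ _

theorem l2PairH_smul (c : ℝ) (f : KinCP0) (u : SmoothH) :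
    l2PairH (c • f : KinCP0) u = c * l2PairH f u := by
  unfold l2PairH
  rw [← integral_const_mul]
  refine integral_congr_ae (Filter.Eventually.of_forall fun p => ?_)
  exact mul_assoc _ _ _

/-- The map `f ↦ F_f` is linear. -/
def genCPLin (m : ℝ) : KinCP0 →ₗ[ℝ] ObsCP m where
  toFun := genCP m
  map_add' f f' := Subtype.ext (funext fun u => by
    show ((l2PairH (f + f' : KinCP0) _ : ℝ) : ℂ) = (l2PairH f _ : ℝ) + (l2PairH f' _ : ℝ)
    rw [l2PairH_add]; push_cast; rfl)
  map_smul' c f := Subtype.ext (funext fun u => by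
    show ((l2PairH (c • f : KinCP0) _ : ℝ) : ℂ) = c • ((l2PairH f _ : ℝ) : ℂ)
    rw [l2PairH_smul]; simp)

theorem genCP_surjective (m : ℝ) : Function.Surjective (genCP m) := by
  rintro ⟨G, hG⟩
  have h1 : Submodule.span ℝ (Set.range (obsCP m))
      ≤ LinearMap.range ((ObsCP m).subtype ∘ₗ genCPLin m) :=
    Submodule.span_le.2 (by rintro _ ⟨f, rfl⟩; exact ⟨f, rfl⟩)
  obtain ⟨f, hf⟩ := h1 hG
  exact ⟨f, Subtype.ext hf⟩

theorem genCP_eq_zero_of_eq_eta (m : ℝ) {f : KinCP0} {β : Smooth} (hβ : β ∈ TestOdd)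
    (h : (f : SmoothH) = eta (KG m β)) : genCP m f = 0 := by
  refine Subtype.ext (funext fun u => ?_)
  show ((l2PairH f u : ℝ) : ℂ) = 0
  rw [h, l2PairH_eta_KG m hβ u.2, Complex.ofReal_zero]

theorem genCP_of_mem_imageKGH (m : ℝ) {f : KinCP0} (h : f ∈ imageKGH m) : genCP m f = 0 := by
  obtain ⟨g, hg, h1⟩ := h
  refine genCP_eq_zero_of_eq_eta m (etaDagger ⟨g, hg⟩).2 ?_
  rw [← KGH_eta, eta_etaDagger]
  exact h1.symm

/-- The linear map `[f] ↦ F_[f]`. -/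
def labelMapCP (m : ℝ) : LabelCP m →ₗ[ℝ] ObsCP m :=
  (imageKGH m).liftQ (genCPLin m) fun _ h => genCP_of_mem_imageKGH m h

theorem genCP_etaQ (m : ℝ) (f : KinCP0) (a : Config m) :
    (genCP m f).1 (etaQ m a) = (genKG m (etaDagger f)).1 a :=
  congrArg Complex.ofReal (etaDagger_transpose f (propagatorQ m a)).symm

/-- The pull-back of observables along `[α] ↦ η(E(α))`. -/
def pullback (m : ℝ) : ObsCP m →ₗ[ℝ] ObsKG m :=
  (LinearMap.funLeft ℝ ℂ (etaQ m) ∘ₗ (ObsCP m).subtype).codRestrict (ObsKG m) fun G => by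
    obtain ⟨f, rfl⟩ := genCP_surjective m G
    have h : (LinearMap.funLeft ℝ ℂ (etaQ m) ∘ₗ (ObsCP m).subtype) (genCP m f)
        = (genKG m (etaDagger f)).1 := funext (genCP_etaQ m f)
    rw [h]
    exact (genKG m (etaDagger f)).2

theorem pullback_genCP (m : ℝ) (f : KinCP0) : pullback m (genCP m f) = genKG m (etaDagger f) :=
  Subtype.ext (funext (genCP_etaQ m f))

theorem pullback_bijective (m : ℝ) : Function.Bijective (pullback m) := by
  constructor
  · rw [injective_iff_map_eq_zero]
    intro G hG
    obtain ⟨f, rfl⟩ := genCP_surjective m G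
    rw [pullback_genCP] at hG
    have h1 : genKG m (etaDagger f) = genKG m 0 := hG.trans (map_zero (genKGLin m)).symm
    obtain ⟨β, hβ, h2⟩ := exists_KG_eq_of_l2Pair_eq_zero m (ζ := etaDagger f) fun ζ' =>
      (l2Pair_eq_of_genKG_eq m h1 ζ').trans (l2Pair_zero_left _)
    exact genCP_eq_zero_of_eq_eta m hβ (by rw [h2, eta_etaDagger])
  · intro G
    obtain ⟨ζ, rfl⟩ := genKG_surjective m G
    exact ⟨genCP m ⟨eta ζ, eta_mem_kinCP0 ζ.2⟩, by rw [pullback_genCP, etaDagger_eta]⟩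

/-- The symplectic form on the observables of the half space, transported along the pull-back. -/
def sigmaCP (m : ℝ) : ObsCP m →ₗ[ℝ] ObsCP m →ₗ[ℝ] ℝ :=
  (sigmaKG m).compl₁₂ (pullback m) (pullback m)

theorem sigmaCP_genCP (m : ℝ) (f f' : KinCP0) :
    sigmaCP m (genCP m f) (genCP m f') = l2PairH f (propagatorCP m f') := by
  rw [sigmaCP, LinearMap.compl₁₂_apply, pullback_genCP, pullback_genCP, sigmaKG_genKG,
    etaDagger_transpose]
  rfl

theorem separatingLeft_sigmaCP (m : ℝ) : (sigmaCP m).SeparatingLeft := fun G hG => by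
  refine (pullback_bijective m).1 ?_
  rw [map_zero]
  refine separatingLeft_sigmaKG m _ fun H => ?_
  obtain ⟨G', rfl⟩ := (pullback_bijective m).2 H
  exact hG G'

end
end CasimirPolder

open CasimirPolder

theorem proposition2p2 (m : ℝ) (hm : 0 ≤ m) :
    -- the Green operators `E⁺` and `E⁻` exist and are unique
    (∃! G : TimelikeCompact →ₗ[ℝ] Smooth, IsGreenOperator m causalFuture G) ∧
    (∃! G : TimelikeCompact →ₗ[ℝ] Smooth, IsGreenOperator m causalPast G) ∧
    -- the functionals depend (linearly) only on the classes of their labels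
    ∃ (F : Label m →ₗ[ℝ] ObsKG m) (FH : LabelCP m →ₗ[ℝ] ObsCP m),
      (∀ ζ : TestOdd, F (Submodule.Quotient.mk ζ) = genKG m ζ) ∧
      (∀ f : KinCP0, FH (Submodule.Quotient.mk f) = genCP m f) ∧
      -- separating
      (∀ a a' : Config m, a ≠ a' → ∃ z : Label m, (F z).1 a ≠ (F z).1 a') ∧
      -- optimal
      (∀ z z' : Label m, z ≠ z' → ∃ a : Config m, (F z).1 a ≠ (F z').1 a) ∧
      -- the (weakly non-degenerate) symplectic forms
      ∃ (σ : ObsKG m →ₗ[ℝ] ObsKG m →ₗ[ℝ] ℝ) (σH : ObsCP m →ₗ[ℝ] ObsCP m →ₗ[ℝ] ℝ),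
        (∀ ζ ζ' : TestOdd,
          σ (genKG m ζ) (genKG m ζ') = l2Pair ζ (propagator m (testToTc ζ'))) ∧
        σ.IsAlt ∧ σ.SeparatingLeft ∧
        (∀ f f' : KinCP0, σH (genCP m f) (genCP m f') = l2PairH f (propagatorCP m f')) ∧
        σH.IsAlt ∧ σH.SeparatingLeft ∧
        -- the pull-back along `η` is an isomorphism of symplectic spaces
        ∃ T : ObsCP m ≃ₗ[ℝ] ObsKG m,
          (∀ (G : ObsCP m) (a : Config m), (T G).1 a = G.1 (etaQ m a)) ∧
          ∀ G G' : ObsCP m, σ (T G) (T G') = σH G G' := by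
  refine ⟨?_, ?_, labelMap m, labelMapCP m, fun _ => rfl, fun _ => rfl,
    fun a a' h => separating m h, fun z z' h => optimal m h, sigmaKG m, sigmaCP m,
    sigmaKG_genKG m, isAlt_sigmaKG m, separatingLeft_sigmaKG m, sigmaCP_genCP m,
    fun G => isAlt_sigmaKG m (pullback m G), separatingLeft_sigmaCP m,
    LinearEquiv.ofBijective (pullback m) (pullback_bijective m), fun _ _ => rfl, fun _ _ => rfl⟩
  · rw [← causalSet_one]
    exact existsUnique_isGreenOperator (.inl rfl) m
  · rw [← causalSet_neg_one]
    exact existsUnique_isGreenOperator (.inr rfl) m
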